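/- Let $(X,\mu)$ be a $\sigma$-finite measure space and let $p:(0,\infty)\times X\times X\to[0,\infty)$ be a pointwise consistent $\mu$-heat kernel, that is, a measurable map such that for all $s,t>0$ and $x,y\in X$ $$p(t+s,x,y)=\int_X p(t,x,z)p(s,z,y)\,d\mu(z),\qquad p(t,x,y)=p(t,y,x),\qquad \int_X p(t,x,z)\,d\mu(z)\le 1,$$ and such that the operators $P_tf(x)=\int_X p(t,x,y)f(y)\,d\mu(y)$ satisfy $\|P_tf-f\|_{L^2(X,\mu)}\to0$ as $t\to0+$ for all $f\in L^2(X,\mu)$. Let $H_p\ge 0$ be the self-adjoint operator in $L^2(X,\mu)$ with $e^{-tH_p}=P_t$ for $t>0$. Let $q\ge1$ and let $F_1:X\to(0,\infty)$ be an $L^q$-control function for $p$, that is, a measurable function for which there is a measurable $F_2:(0,\infty)\to(0,\infty)$ with $$p(t,x,x)\le F_1(x)F_2(t)\ \text{ for all } t>0,\ x\in X,\qquad \int_0^\infty e^{-t}F_2(t)^{1/(2q)}\,dt<\infty .$$ Let $E\to X$ be a measurable Hermitian vector bundle of finite rank $d$ which is countably generated: $X$ is covered by a sequence of measurable sets $U_n$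 for which there are bijections $E|_{U_n}\to U_n\times\mathbb{C}^d$ over $U_n$ that are measurable in both directions and fibrewise linear, and $x\mapsto(\psi_1(x),\psi_2(x))_x$ is measurable for all measurable sections $\psi_1,\psi_2$ of $E$. Let $\Gamma_{L^2}(X,E;\mu)$ be the Hilbert space of $\mu$-classes of measurable sections $f$ with $\int_X|f(x)|_x^2\,d\mu(x)<\infty$. Let $\tilde H\ge0$ be a self-adjoint operator in $\Gamma_{L^2}(X,E;\mu)$ which dominates $H_p$ in the Kato sense: for all $t\ge0$ and $f\in\Gamma_{L^2}(X,E;\mu)$ one has $|e^{-t\tilde H}f(x)|_x\le e^{-tH_p}|f|(x)$ for $\mu$-a.e. $x$; equivalently, for all $a>0$ and $f$ one has $|(\tilde H+a)^{-1}f(x)|_x\le (H_p+a)^{-1}|f|(x)$ for $\mu$-a.e. $x$. Let $W=W_1+W_2$, where $W_1,W_2$ are measurable sections of $\mathrm{End}(E)$ that are pointwise self-adjoint, let $|W_j|(x)$ be the operator norm of $W_j(x)$, and let $\hat W$ be the maximally defined multiplication operator by $W$ in $\Gamma_{L^2}(X,E;\mu)$, with domain $\{f: Wf\in\Gamma_{L^2}(X,E;\mu)\}$.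 Say that a measurable function $h$ vanishes $\nu$-weakly at $\infty$ if $\nu\{|h|\ge c\}<\infty$ for all $c>0$. Assume that either (i) $q=1$, $|W_1|\in L^2(X,F_1\,d\mu)$, $|W_2|\in L^\infty(X,\mu)$, and $|W_2|$ vanishes both $\mu$-weakly and $F_1\,d\mu$-weakly at $\infty$; or (ii) $q>1$, $F_1\equiv1$, $|W_1|\in L^{2q}(X,\mu)$, $|W_2|\in L^\infty(X,\mu)$, and $|W_2|$ vanishes $\mu$-weakly at $\infty$. Then $\hat W(\tilde H+a)^{-1}$ is an everywhere defined compact operator in $\Gamma_{L^2}(X,E;\mu)$ for all $a>0$. Moreover, $\mathrm{Dom}(\tilde H+\hat W)=\mathrm{Dom}(\tilde H)$, the operator $\tilde H+\hat W$ is self-adjoint and semibounded from below, and $\sigma_{\mathrm{ess}}(\tilde H+\hat W)=\sigma_{\mathrm{ess}}(\tilde H)$, where the essential spectrum consists of the points of the spectrum that are accumulation points of the spectrum or eigenvalues of infinite multiplicity. -/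

import Mathlib

open MeasureTheory Filter Bundle
open scoped Topology NNReal ENNReal ComplexOrder

noncomputable section

namespace BundleSchrodinger

universe u v

/-! ### Measurable Hermitian vector bundles -/

section Bundle

variable {X : Type u} [MeasurableSpace X] (d : ℕ) (E : X → Type v)

/-- A vector bundle chart of rank `d` with domain `U` for the bundle with fibres `E x` and total
space `TotalSpace (Fin d → ℂ) E`: a bijection `π⁻¹(U) → U × ℂᵈ` over `U`, measurable in both
directions, that is a linear isomorphism on each fibre. -/
structure VectorBundleChart [∀ x, AddCommGroup (E x)] [∀ x, Module ℂ (E x)]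
    [MeasurableSpace (TotalSpace (Fin d → ℂ) E)] (U : Set X) where
  fiberEquiv : ∀ x : U, E x ≃ₗ[ℂ] (Fin d → ℂ)
  measurable_toFun : Measurable
    (fun v : (TotalSpace.proj ⁻¹' U : Set (TotalSpace (Fin d → ℂ) E)) =>
      ((⟨v.1.proj, v.2⟩, fiberEquiv ⟨v.1.proj, v.2⟩ v.1.snd) : U × (Fin d → ℂ)))
  measurable_invFun : Measurable
    (fun w : U × (Fin d → ℂ) =>
      (⟨⟨w.1, (fiberEquiv w.1).symm w.2⟩, w.1.2⟩ :
        (TotalSpace.proj ⁻¹' U : Set (TotalSpace (Fin d → ℂ) E))))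

/-- `E → X` is a complex measurable vector bundle of rank `d`. -/
class IsMeasurableVectorBundle [∀ x, AddCommGroup (E x)] [∀ x, Module ℂ (E x)]
    [MeasurableSpace (TotalSpace (Fin d → ℂ) E)] : Prop where
  measurable_proj : Measurable (TotalSpace.proj : TotalSpace (Fin d → ℂ) E → X)
  exists_chart : ∀ x : X, ∃ U : Set X, MeasurableSet U ∧ x ∈ U ∧
    Nonempty (VectorBundleChart d E U)

/-- `X` is covered by a sequence of measurable domains of vector bundle charts. -/
class IsCountablyGeneratedBundle [∀ x, AddCommGroup (E x)] [∀ x, Module ℂ (E x)]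
    [MeasurableSpace (TotalSpace (Fin d → ℂ) E)] : Prop where
  exists_cover : ∃ U : ℕ → Set X, (∀ n, MeasurableSet (U n)) ∧ (⋃ n, U n) = Set.univ ∧
    ∀ n, Nonempty (VectorBundleChart d E (U n))

/-- `f` is a measurable section, i.e. an element of `Γ(X, E)`. -/
def IsMeasurableSection [MeasurableSpace (TotalSpace (Fin d → ℂ) E)] (f : ∀ x, E x) : Prop :=
  Measurable (fun x => (⟨x, f x⟩ : TotalSpace (Fin d → ℂ) E))

/-- The fibrewise scalar products form a measurable Hermitian structure. -/
class IsMeasurableHermitian [∀ x, NormedAddCommGroup (E x)] [∀ x, InnerProductSpace ℂ (E x)]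
    [MeasurableSpace (TotalSpace (Fin d → ℂ) E)] : Prop where
  measurable_inner : ∀ f g : ∀ x, E x, IsMeasurableSection d E f → IsMeasurableSection d E g →
    Measurable (fun x => inner ℂ (f x) (g x))

variable [∀ x, NormedAddCommGroup (E x)] [∀ x, InnerProductSpace ℂ (E x)]
  [MeasurableSpace (TotalSpace (Fin d → ℂ) E)]

/-- `W` is a measurable section of `End(E)`: in every vector bundle chart of `E`, the matrix of `W`
is a measurable function. (All linear endomorphisms of the finite dimensional fibres are
continuous, and `‖W x‖` is the operator norm.) -/
def IsMeasurableEndSection (W : ∀ x, E x →L[ℂ] E x) : Prop :=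
  ∀ U : Set X, MeasurableSet U → ∀ φ : VectorBundleChart d E U, ∀ i j : Fin d,
    Measurable (fun x : U =>
      φ.fiberEquiv x (W x ((φ.fiberEquiv x).symm (Pi.single j 1))) i)

variable {d E}

lemma VectorBundleChart.measurable_coord {U : Set X} (φ : VectorBundleChart d E U)
    {f : ∀ x, E x} (hf : IsMeasurableSection d E f) :
    Measurable (fun x : U => φ.fiberEquiv x (f x)) := by
  have h1 : Measurable (fun x : U => (⟨⟨x, f x⟩, x.2⟩ :
      (TotalSpace.proj ⁻¹' U : Set (TotalSpace (Fin d → ℂ) E)))) :=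
    (hf.comp measurable_subtype_coe).subtype_mk
  exact (φ.measurable_toFun.comp h1).snd

lemma isMeasurableSection_of_coord {U : ℕ → Set X} (hU : ∀ n, MeasurableSet (U n))
    (hcov : (⋃ n, U n) = Set.univ) (φ : ∀ n, VectorBundleChart d E (U n))
    {f : ∀ x, E x} (hf : ∀ n, Measurable (fun x : U n => (φ n).fiberEquiv x (f x))) :
    IsMeasurableSection d E f := by
  intro s hs
  have hn : ∀ n, Measurable (fun x : U n => (⟨x, f x⟩ : TotalSpace (Fin d → ℂ) E)) := by
    intro n
    have h := measurable_subtype_coe.comp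
      ((φ n).measurable_invFun.comp (measurable_id.prodMk (hf n)))
    convert h using 2 with x
    simp
  have : (fun x => (⟨x, f x⟩ : TotalSpace (Fin d → ℂ) E)) ⁻¹' s =
      ⋃ n, Subtype.val '' ((fun x : U n => (⟨x, f x⟩ : TotalSpace (Fin d → ℂ) E)) ⁻¹' s) := by
    ext x
    have hx : x ∈ ⋃ n, U n := by rw [hcov]; trivial
    obtain ⟨n, hxn⟩ := Set.mem_iUnion.1 hx
    simp only [Set.mem_preimage, Set.mem_iUnion, Set.mem_image, Subtype.exists, exists_and_right,
      exists_eq_right]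
    exact ⟨fun h => ⟨n, hxn, h⟩, fun ⟨_, _, h⟩ => h⟩
  rw [this]
  exact MeasurableSet.iUnion fun n => (hU n).subtype_image (hn n hs)

section
variable [IsCountablyGeneratedBundle d E]

lemma IsMeasurableSection.zero : IsMeasurableSection d E (0 : ∀ x, E x) := by
  obtain ⟨U, hU, hc, hφ⟩ := IsCountablyGeneratedBundle.exists_cover (d := d) (E := E)
  refine isMeasurableSection_of_coord hU hc (fun n => (hφ n).some) fun n => ?_
  simp

lemma IsMeasurableSection.add {f g : ∀ x, E x} (hf : IsMeasurableSection d E f)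
    (hg : IsMeasurableSection d E g) : IsMeasurableSection d E (f + g) := by
  obtain ⟨U, hU, hc, hφ⟩ := IsCountablyGeneratedBundle.exists_cover (d := d) (E := E)
  refine isMeasurableSection_of_coord hU hc (fun n => (hφ n).some) fun n => ?_
  have h := ((hφ n).some.measurable_coord hf).add ((hφ n).some.measurable_coord hg)
  convert h using 2 with x
  simp

lemma IsMeasurableSection.smul {f : ∀ x, E x} (c : ℂ) (hf : IsMeasurableSection d E f) :
    IsMeasurableSection d E (c • f) := by
  obtain ⟨U, hU, hc, hφ⟩ := IsCountablyGeneratedBundle.exists_cover (d := d) (E := E)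
  refine isMeasurableSection_of_coord hU hc (fun n => (hφ n).some) fun n => ?_
  have h := ((hφ n).some.measurable_coord hf).const_smul c
  convert h using 2 with x
  simp

open Classical in
lemma IsMeasurableSection.piecewise_zero {f : ∀ x, E x} (hf : IsMeasurableSection d E f)
    {s : Set X} (hs : MeasurableSet s) :
    IsMeasurableSection d E (fun x => if x ∈ s then f x else 0) := by
  have : (fun x => (⟨x, if x ∈ s then f x else 0⟩ : TotalSpace (Fin d → ℂ) E)) =
      fun x => if x ∈ s then ⟨x, f x⟩ else ⟨x, (0 : ∀ x, E x) x⟩ := by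
    funext x; split_ifs <;> rfl
  rw [IsMeasurableSection, this]
  exact Measurable.ite hs hf IsMeasurableSection.zero

lemma finiteDimensional_fiber (d : ℕ) (E : X → Type v) [∀ x, NormedAddCommGroup (E x)]
    [∀ x, InnerProductSpace ℂ (E x)] [MeasurableSpace (TotalSpace (Fin d → ℂ) E)]
    [IsCountablyGeneratedBundle d E] (x : X) : FiniteDimensional ℂ (E x) := by
  obtain ⟨U, hU, hc, hφ⟩ := IsCountablyGeneratedBundle.exists_cover (d := d) (E := E)
  have hx : x ∈ ⋃ n, U n := by rw [hc]; trivial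
  obtain ⟨n, hxn⟩ := Set.mem_iUnion.1 hx
  exact Module.Finite.equiv ((hφ n).some.fiberEquiv ⟨x, hxn⟩).symm

lemma IsMeasurableSection.of_tendsto {f : ℕ → ∀ x, E x} {g : ∀ x, E x}
    (hf : ∀ n, IsMeasurableSection d E (f n))
    (h : ∀ x, Tendsto (fun n => f n x) atTop (𝓝 (g x))) : IsMeasurableSection d E g := by
  obtain ⟨U, hU, hc, hφ⟩ := IsCountablyGeneratedBundle.exists_cover (d := d) (E := E)
  refine isMeasurableSection_of_coord hU hc (fun n => (hφ n).some) fun n => ?_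
  refine measurable_of_tendsto_metrizable (fun k => (hφ n).some.measurable_coord (hf k)) ?_
  rw [tendsto_pi_nhds]
  intro x
  have := finiteDimensional_fiber d E x
  exact (((hφ n).some.fiberEquiv x).toLinearMap.continuous_of_finiteDimensional.tendsto _).comp
    (h x)

end

lemma IsMeasurableSection.norm [IsMeasurableHermitian d E] {f : ∀ x, E x}
    (hf : IsMeasurableSection d E f) : Measurable (fun x => ‖f x‖) := by
  have h := IsMeasurableHermitian.measurable_inner f f hf hf
  have : (fun x => ‖f x‖) = fun x => √(RCLike.re (inner ℂ (f x) (f x))) := by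
    funext x; exact norm_eq_sqrt_re_inner (f x)
  rw [this]
  exact (RCLike.measurable_re.comp h).sqrt

lemma measurable_enorm_sq [IsMeasurableHermitian d E] {f : ∀ x, E x} (hf : IsMeasurableSection d E f) :
    Measurable (fun x => ‖f x‖ₑ ^ 2) := by
  have : (fun x => ‖f x‖ₑ ^ 2) = fun x => ENNReal.ofReal ‖f x‖ ^ 2 := by
    funext x; rw [ofReal_norm]
  rw [this]
  exact (hf.norm.ennreal_ofReal).pow_const 2

end Bundle

/-! ### The Hilbert space of square integrable sections -/

section L2

variable {X : Type u} [MeasurableSpace X] (d : ℕ) (E : X → Type v)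
  [∀ x, NormedAddCommGroup (E x)] [∀ x, InnerProductSpace ℂ (E x)]
  [MeasurableSpace (TotalSpace (Fin d → ℂ) E)]
  [IsCountablyGeneratedBundle d E] [IsMeasurableHermitian d E] (μ : Measure X)

/-- The space of measurable sections `f` with `∫ |f(x)|² dμ(x) < ∞`. -/
def sqIntegrableSections : Submodule ℂ (∀ x, E x) where
  carrier := {f | IsMeasurableSection d E f ∧ MemLp (fun x => ‖f x‖) 2 μ}
  zero_mem' := ⟨IsMeasurableSection.zero, by simp⟩
  add_mem' {f g} hf hg := ⟨hf.1.add hg.1, (hf.2.add hg.2).mono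
    (hf.1.add hg.1).norm.aestronglyMeasurable (.of_forall fun x => by
      simpa [abs_of_nonneg (add_nonneg (norm_nonneg (f x)) (norm_nonneg (g x)))]
        using norm_add_le (f x) (g x))⟩
  smul_mem' c f hf := ⟨hf.1.smul c, by simpa [norm_smul] using hf.2.const_mul ‖c‖⟩

/-- `sqIntegrableSections` with the `L²` seminorm. -/
def PreL2Sections : Type (max u v) := sqIntegrableSections d E μ

instance : AddCommGroup (PreL2Sections d E μ) :=
  inferInstanceAs (AddCommGroup (sqIntegrableSections d E μ))

instance : Module ℂ (PreL2Sections d E μ) :=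
  inferInstanceAs (Module ℂ (sqIntegrableSections d E μ))

variable {d E μ}

instance : CoeFun (PreL2Sections d E μ) (fun _ => ∀ x, E x) := ⟨fun f => f.1⟩

namespace PreL2Sections

@[simp] lemma coe_add (f g : PreL2Sections d E μ) (x : X) : (f + g) x = f x + g x := rfl
@[simp] lemma coe_sub (f g : PreL2Sections d E μ) (x : X) : (f - g) x = f x - g x := rfl
@[simp] lemma coe_smul (c : ℂ) (f : PreL2Sections d E μ) (x : X) : (c • f) x = c • f x := rfl

lemma integrable_inner (f g : PreL2Sections d E μ) :
    Integrable (fun x => inner ℂ (f x) (g x)) μ :=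
  (f.2.2.integrable_mul g.2.2).mono
    (IsMeasurableHermitian.measurable_inner f g f.2.1 g.2.1).aestronglyMeasurable
    (.of_forall fun x => by simpa using norm_inner_le_norm (𝕜 := ℂ) (f x) (g x))

variable (d E μ) in
/-- The scalar product `∫ (f(x), g(x))_x dμ(x)`. -/
@[reducible] def core : PreInnerProductSpace.Core ℂ (PreL2Sections d E μ) where
  inner f g := ∫ x, inner ℂ (f x) (g x) ∂μ
  conj_inner_symm f g := by
    rw [← integral_conj]
    simp
  re_inner_nonneg f := by
    have h := integral_re (integrable_inner f f)
    rw [← h]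
    exact integral_nonneg fun x => inner_self_nonneg (𝕜 := ℂ)
  add_left f g h := by
    simp only [coe_add, inner_add_left]
    exact integral_add (integrable_inner f h) (integrable_inner g h)
  smul_left f g c := by
    simp only [coe_smul, inner_smul_left]
    exact integral_const_mul _ _

instance : SeminormedAddCommGroup (PreL2Sections d E μ) :=
  @InnerProductSpace.Core.toSeminormedAddCommGroup ℂ _ _ _ _ (core d E μ)

instance : InnerProductSpace ℂ (PreL2Sections d E μ) := InnerProductSpace.ofCore (core d E μ)

lemma inner_def (f g : PreL2Sections d E μ) :
    inner ℂ f g = ∫ x, inner ℂ (f x) (g x) ∂μ := rfl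

lemma ofReal_norm_sq (f : PreL2Sections d E μ) :
    ENNReal.ofReal (‖f‖ ^ 2) = ∫⁻ x, ‖f x‖ₑ ^ 2 ∂μ := by
  have h1 : ‖f‖ ^ 2 = ∫ x, ‖f x‖ ^ 2 ∂μ := by
    rw [← inner_self_eq_norm_sq (𝕜 := ℂ) f, inner_def, ← integral_re (integrable_inner f f)]
    exact integral_congr_ae (.of_forall fun x => inner_self_eq_norm_sq (𝕜 := ℂ) (f x))
  rw [h1, ofReal_integral_eq_lintegral_ofReal f.2.2.integrable_sq
    (.of_forall fun x => by positivity)]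
  refine lintegral_congr fun x => ?_
  rw [ENNReal.ofReal_pow (norm_nonneg _), ofReal_norm]

lemma norm_eq_zero_iff (f : PreL2Sections d E μ) : ‖f‖ = 0 ↔ ∀ᵐ x ∂μ, f x = 0 := by
  have h := ofReal_norm_sq f
  have h2 : ‖f‖ = 0 ↔ ∫⁻ x, ‖f x‖ₑ ^ 2 ∂μ = 0 := by
    rw [← h, ENNReal.ofReal_eq_zero]
    constructor
    · intro h0; simp [h0]
    · intro h0; exact pow_eq_zero_iff two_ne_zero |>.1 (le_antisymm h0 (by positivity))
  rw [h2, lintegral_eq_zero_iff (measurable_enorm_sq f.2.1)]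
  refine ⟨fun h => h.mono fun x hx => ?_, fun h => h.mono fun x hx => ?_⟩
  · simpa using hx
  · simp [hx]

open Classical in
instance : CompleteSpace (PreL2Sections d E μ) := by
  refine Metric.complete_of_convergent_controlled_sequences (fun n => (1 / 4 : ℝ) ^ n)
    (fun n => by positivity) fun u hu => ?_
  -- almost everywhere convergence
  have hmarkov : ∀ n, μ {x | ((1 / 2 : ℝ≥0∞) ^ n) ^ 2 ≤ ‖(u (n + 1) - u n) x‖ₑ ^ 2} ≤
      (1 / 4 : ℝ≥0∞) ^ n := by
    intro n
    have h1 := mul_meas_ge_le_lintegral (μ := μ) (measurable_enorm_sq (u (n + 1) - u n).2.1)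
      (((1 / 2 : ℝ≥0∞) ^ n) ^ 2)
    rw [← ofReal_norm_sq] at h1
    have h2 : ‖u (n + 1) - u n‖ ≤ (1 / 4 : ℝ) ^ n := by
      have := hu n (n + 1) n (Nat.le_succ n) le_rfl
      rw [dist_eq_norm] at this
      exact this.le
    have h3 : ENNReal.ofReal (‖u (n + 1) - u n‖ ^ 2) ≤ ((1 / 4 : ℝ≥0∞) ^ n) ^ 2 := by
      have : ((1 / 4 : ℝ≥0∞) ^ n) ^ 2 = ENNReal.ofReal (((1 / 4 : ℝ) ^ n) ^ 2) := by
        rw [ENNReal.ofReal_pow (by positivity), ENNReal.ofReal_pow (by positivity),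
          ENNReal.ofReal_div_of_pos (by norm_num)]
        simp
      rw [this]
      exact ENNReal.ofReal_le_ofReal (by gcongr)
    have h4 : ((1 / 2 : ℝ≥0∞) ^ n) ^ 2 = (1 / 4 : ℝ≥0∞) ^ n := by
      rw [← pow_mul, mul_comm, pow_mul]
      congr 1
      rw [one_div, one_div, ← ENNReal.inv_pow]; norm_num
    rw [h4] at h1 ⊢
    have h5 := h1.trans h3
    rw [sq] at h5
    exact (ENNReal.mul_le_mul_iff_right (by simp) (by simp)).1 h5
  have hae : ∀ᵐ x ∂μ, CauchySeq (fun n => u n x) := by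
    have hsum : ∑' n, μ {x | ((1 / 2 : ℝ≥0∞) ^ n) ^ 2 ≤ ‖(u (n + 1) - u n) x‖ₑ ^ 2} ≠ ∞ := by
      refine ne_top_of_le_ne_top ?_ (ENNReal.tsum_le_tsum hmarkov)
      rw [ENNReal.tsum_geometric]
      refine ENNReal.inv_ne_top.2 ?_
      rw [Ne, tsub_eq_zero_iff_le, not_le]
      rw [one_div]
      exact ENNReal.inv_lt_one.2 (by norm_num)
    filter_upwards [ae_eventually_notMem hsum] with x hx
    refine cauchySeq_of_summable_dist ?_
    refine Summable.of_norm_bounded_eventually_nat (g := fun n => (1 / 2 : ℝ) ^ n)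
      summable_geometric_two ?_
    filter_upwards [hx] with n hn
    simp only [not_le] at hn
    have h1 : ‖(u (n + 1) - u n) x‖ₑ < (1 / 2 : ℝ≥0∞) ^ n := lt_of_pow_lt_pow_left' 2 hn
    rw [Real.norm_of_nonneg dist_nonneg, dist_comm, dist_eq_norm]
    have h2 : (1 / 2 : ℝ≥0∞) ^ n = ENNReal.ofReal ((1 / 2 : ℝ) ^ n) := by
      rw [ENNReal.ofReal_pow (by positivity), ENNReal.ofReal_div_of_pos (by norm_num)]
      simp
    rw [h2, ← ofReal_norm] at h1
    exact (ENNReal.ofReal_lt_ofReal_iff_of_nonneg (norm_nonneg _)).1 h1 |>.le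
  obtain ⟨s, hs, hsm, hs0⟩ : ∃ s : Set X, (∀ x ∈ s, CauchySeq (fun n => u n x)) ∧
      MeasurableSet s ∧ ∀ᵐ x ∂μ, x ∈ s := by
    obtain ⟨t, ht, htm, ht0⟩ := exists_measurable_superset_of_null (ae_iff.1 hae)
    refine ⟨tᶜ, fun x hx => ?_, htm.compl, ?_⟩
    · by_contra h
      exact hx (ht h)
    · rw [ae_iff]; simpa using ht0
  have hlim : ∀ x, ∃ y : E x, Tendsto (fun n => if x ∈ s then u n x else 0) atTop (𝓝 y) := by
    intro x
    by_cases hx : x ∈ s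
    · have := finiteDimensional_fiber d E x
      have := FiniteDimensional.complete ℂ (E x)
      simpa [hx] using cauchySeq_tendsto_of_complete (hs x hx)
    · exact ⟨0, by simp [hx]⟩
  choose g hg using hlim
  have hgm : IsMeasurableSection d E g :=
    IsMeasurableSection.of_tendsto (fun n => (u n).2.1.piecewise_zero hsm) hg
  have hfatou : ∀ N, ∫⁻ x, ‖g x - u N x‖ₑ ^ 2 ∂μ ≤ ENNReal.ofReal (((1 / 4 : ℝ) ^ N) ^ 2) := by
    intro N
    have h1 : ∫⁻ x, ‖g x - u N x‖ₑ ^ 2 ∂μ ≤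
        ∫⁻ x, liminf (fun n => ‖(u n - u N) x‖ₑ ^ 2) atTop ∂μ := by
      refine lintegral_mono_ae ?_
      filter_upwards [hs0] with x hx
      have h2 : Tendsto (fun n => u n x) atTop (𝓝 (g x)) := by simpa [hx] using hg x
      have h3 : Tendsto (fun n => ‖(u n - u N) x‖ₑ ^ 2) atTop (𝓝 (‖g x - u N x‖ₑ ^ 2)) :=
        ENNReal.Tendsto.pow (h2.sub_const (u N x)).enorm
      exact h3.liminf_eq.ge
    refine h1.trans ((lintegral_liminf_le
      (fun n => measurable_enorm_sq (u n - u N).2.1)).trans ?_)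
    refine liminf_le_of_frequently_le' (Eventually.frequently ?_)
    filter_upwards [eventually_ge_atTop N] with n hn
    rw [← ofReal_norm_sq]
    refine ENNReal.ofReal_le_ofReal ?_
    have := (hu N n N hn le_rfl).le
    rw [dist_eq_norm] at this
    gcongr
  have hdm : IsMeasurableSection d E (fun x => g x - u 0 x) := by
    have := hgm.add ((u 0).2.1.smul (-1))
    convert this using 2 with x
    simp [sub_eq_add_neg]
  have hdmem : (fun x => g x - u 0 x) ∈ sqIntegrableSections d E μ := by
    refine ⟨hdm, hdm.norm.aestronglyMeasurable, ?_⟩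
    rw [eLpNorm_lt_top_iff_lintegral_rpow_enorm_lt_top (by simp) (by simp)]
    refine lt_of_le_of_lt ?_ ((hfatou 0).trans_lt ENNReal.ofReal_lt_top)
    refine lintegral_mono fun x => ?_
    simp
  have hgmem : g ∈ sqIntegrableSections d E μ := by
    have := (sqIntegrableSections d E μ).add_mem hdmem (u 0).2
    convert this using 1
    funext x
    exact (sub_add_cancel (g x) (u 0 x)).symm
  let G : PreL2Sections d E μ := ⟨g, hgmem⟩
  refine ⟨G, ?_⟩
  rw [tendsto_iff_dist_tendsto_zero]
  refine squeeze_zero (fun n => dist_nonneg) (fun n => ?_)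
    (tendsto_pow_atTop_nhds_zero_of_lt_one (r := (1 / 4 : ℝ)) (by norm_num) (by norm_num))
  rw [dist_comm, dist_eq_norm]
  have h := hfatou n
  have h1 : ∫⁻ x, ‖g x - u n x‖ₑ ^ 2 ∂μ = ENNReal.ofReal (‖G - u n‖ ^ 2) :=
    (ofReal_norm_sq (G - u n)).symm
  rw [h1, ENNReal.ofReal_le_ofReal_iff (by positivity)] at h
  exact (pow_le_pow_iff_left₀ (norm_nonneg _) (by positivity) two_ne_zero).1 h

end PreL2Sections

variable (d E μ) in
/-- The complex Hilbert space of `μ`-equivalence classes of square integrable measurable sections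
(two sections are identified iff they agree `μ`-almost everywhere, see `L2Sections.mk_eq_mk`). -/
abbrev L2Sections : Type (max u v) := SeparationQuotient (PreL2Sections d E μ)

namespace L2Sections

lemma mk_eq_mk {f g : PreL2Sections d E μ} :
    (SeparationQuotient.mk f : L2Sections d E μ) = SeparationQuotient.mk g ↔
      ∀ᵐ x ∂μ, f x = g x := by
  rw [SeparationQuotient.mk_eq_mk, Metric.inseparable_iff, dist_eq_norm,
    PreL2Sections.norm_eq_zero_iff]
  simp [sub_eq_zero]

/-- A representative of an equivalence class of sections. -/
def rep (f : L2Sections d E μ) : PreL2Sections d E μ :=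
  Function.surjInv SeparationQuotient.surjective_mk f

instance : CoeFun (L2Sections d E μ) (fun _ => ∀ x, E x) := ⟨fun f => rep f⟩

lemma mk_rep (f : L2Sections d E μ) : SeparationQuotient.mk (rep f) = f :=
  Function.surjInv_eq SeparationQuotient.surjective_mk f

lemma coe_mk (f : PreL2Sections d E μ) :
    ∀ᵐ x ∂μ, (SeparationQuotient.mk f : L2Sections d E μ) x = f x :=
  mk_eq_mk.1 (mk_rep _)

lemma ext_ae {f g : L2Sections d E μ} (h : ∀ᵐ x ∂μ, f x = g x) : f = g := by
  rw [← mk_rep f, ← mk_rep g]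
  exact mk_eq_mk.2 h

lemma coe_zero : ∀ᵐ x ∂μ, (0 : L2Sections d E μ) x = 0 := coe_mk 0

lemma coe_add (f g : L2Sections d E μ) : ∀ᵐ x ∂μ, (f + g) x = f x + g x := by
  have h := coe_mk (rep f + rep g)
  rw [SeparationQuotient.mk_add, mk_rep, mk_rep] at h
  exact h

lemma coe_smul (c : ℂ) (f : L2Sections d E μ) : ∀ᵐ x ∂μ, (c • f) x = c • f x := by
  have h := coe_mk (c • rep f)
  rw [SeparationQuotient.mk_smul, mk_rep] at h
  exact h

/-- The function `|f| : x ↦ |f(x)|_x` as an element of `L²(X, μ)`. -/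
def abs (f : L2Sections d E μ) : Lp ℂ 2 μ :=
  MemLp.toLp (fun x => (‖f x‖ : ℂ)) (rep f).2.2.ofReal

end L2Sections

/-- The maximally defined multiplication operator by the endomorphism section `W`:
its domain consists of the `f` in `L²` for which `W f` is in `L²`. -/
def mulOp (d : ℕ) {E : X → Type v} [∀ x, NormedAddCommGroup (E x)]
    [∀ x, InnerProductSpace ℂ (E x)] [MeasurableSpace (TotalSpace (Fin d → ℂ) E)]
    [IsCountablyGeneratedBundle d E] [IsMeasurableHermitian d E] (μ : Measure X)
    (W : ∀ x, E x →L[ℂ] E x) : L2Sections d E μ →ₗ.[ℂ] L2Sections d E μ :=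
  Submodule.toLinearPMap
    { carrier := {z | ∀ᵐ x ∂μ, z.2 x = W x (z.1 x)}
      zero_mem' := by
        filter_upwards [L2Sections.coe_zero (d := d) (E := E) (μ := μ)] with x hx
        simp only [Prod.fst_zero, Prod.snd_zero, hx, map_zero]
      add_mem' := by
        intro y z hy hz
        filter_upwards [hy, hz, L2Sections.coe_add y.1 z.1, L2Sections.coe_add y.2 z.2]
          with x h1 h2 h3 h4
        rw [Prod.fst_add, Prod.snd_add, h3, h4, h1, h2, map_add]
      smul_mem' := by
        intro c z hz
        filter_upwards [hz, L2Sections.coe_smul c z.1, L2Sections.coe_smul c z.2] with x h1 h2 h3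
        rw [Prod.smul_fst, Prod.smul_snd, h2, h3, h1, map_smul] }

lemma mem_graph_mulOp (W : ∀ x, E x →L[ℂ] E x) (f g : L2Sections d E μ) :
    (f, g) ∈ (mulOp d μ W).graph ↔ ∀ᵐ x ∂μ, g x = W x (f x) := by
  unfold mulOp
  rw [Submodule.toLinearPMap_graph_eq]
  · rfl
  · rintro ⟨y, z⟩ hz (rfl : y = 0)
    refine L2Sections.ext_ae ?_
    have hz' : ∀ᵐ x ∂μ, z x = W x ((0 : L2Sections d E μ) x) := hz
    filter_upwards [hz', L2Sections.coe_zero (d := d) (E := E) (μ := μ)] with x h1 h2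
    rw [h1, h2, map_zero]

end L2

/-! ### Operators in Hilbert spaces -/

section Operators

variable {H : Type*} [NormedAddCommGroup H] [InnerProductSpace ℂ H]

/-- The operator `T + z`, with the domain of `T`. -/
def shift (T : H →ₗ.[ℂ] H) (z : ℂ) : H →ₗ.[ℂ] H := (z • (LinearMap.id : H →ₗ[ℂ] H)) +ᵥ T

/-- `R` is the everywhere defined bounded inverse `T⁻¹` of `T`. -/
def IsBoundedInverse (T : H →ₗ.[ℂ] H) (R : H →L[ℂ] H) : Prop :=
  (∀ f, (R f, f) ∈ T.graph) ∧ ∀ u : T.domain, R (T u) = u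

/-- The spectrum of an operator. -/
def opSpectrum (T : H →ₗ.[ℂ] H) : Set ℂ :=
  {z | ¬ ∃ R : H →L[ℂ] H, IsBoundedInverse (shift T (-z)) R}

/-- The eigenspace of `T` at `z`. -/
def opEigenspace (T : H →ₗ.[ℂ] H) (z : ℂ) : Submodule ℂ H :=
  (LinearMap.ker (shift T (-z)).toFun).map (shift T (-z)).domain.subtype

/-- The essential spectrum of a self-adjoint operator: the points of the spectrum that are
accumulation points of the spectrum or eigenvalues of infinite multiplicity. -/
def essSpectrum (T : H →ₗ.[ℂ] H) : Set ℂ :=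
  {z ∈ opSpectrum T | AccPt z (𝓟 (opSpectrum T)) ∨ ¬ FiniteDimensional ℂ (opEigenspace T z)}

/-- `T ≥ c`, for a symmetric operator `T`. -/
def BoundedBelowBy (T : H →ₗ.[ℂ] H) (c : ℝ) : Prop :=
  ∀ u : T.domain, c * ‖(u : H)‖ ^ 2 ≤ (inner ℂ (u : H) (T u)).re

/-- The operator `T` with `T f = lim_{t → 0+} (f - S t f) / t`, defined for those `f` for which the
limit exists; that is, `-T` is the generator of the semigroup `S`. -/
def negGenerator (S : ℝ → H →L[ℂ] H) : H →ₗ.[ℂ] H :=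
  Submodule.toLinearPMap
    { carrier := {z | Tendsto (fun t : ℝ => (t : ℂ)⁻¹ • (z.1 - S t z.1)) (𝓝[>] 0) (𝓝 z.2)}
      zero_mem' := by simp
      add_mem' := by
        intro y z hy hz
        refine (Tendsto.add hy hz).congr fun t => ?_
        rw [← smul_add, Prod.fst_add, map_add]
        congr 1
        abel
      smul_mem' := by
        intro c z hz
        refine (Tendsto.const_smul hz c).congr fun t => ?_
        rw [Prod.smul_fst, map_smul, smul_comm, smul_sub] }

lemma mem_graph_negGenerator (S : ℝ → H →L[ℂ] H) (f g : H) :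
    (f, g) ∈ (negGenerator S).graph ↔
      Tendsto (fun t : ℝ => (t : ℂ)⁻¹ • (f - S t f)) (𝓝[>] 0) (𝓝 g) := by
  unfold negGenerator
  rw [Submodule.toLinearPMap_graph_eq]
  · rfl
  · rintro ⟨y, z⟩ hz (rfl : y = 0)
    have hz' : Tendsto (fun t : ℝ => (t : ℂ)⁻¹ • ((0 : H) - S t 0)) (𝓝[>] 0) (𝓝 z) := hz
    simp only [map_zero, sub_zero, smul_zero] at hz'
    exact tendsto_nhds_unique hz' tendsto_const_nhds

/-- `S` is the semigroup `(e^{-tT})_{t ≥ 0}` of the self-adjoint operator `T ≥ 0`: the strongly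
continuous contraction semigroup with generator `-T`. -/
structure IsSemigroupOf (T : H →ₗ.[ℂ] H) (S : ℝ → H →L[ℂ] H) : Prop where
  zero : S 0 = ContinuousLinearMap.id ℂ H
  add : ∀ s t : ℝ, 0 ≤ s → 0 ≤ t → S (s + t) = (S s).comp (S t)
  continuousOn : ∀ f : H, ContinuousOn (fun t => S t f) (Set.Ici 0)
  norm_le : ∀ t : ℝ, 0 ≤ t → ‖S t‖ ≤ 1
  negGenerator_eq : negGenerator S = T

end Operators

/-! ### Heat kernels -/

section HeatKernel

variable {X : Type u} [MeasurableSpace X]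

/-- `p : (0, ∞) × X × X → [0, ∞)` is a pointwise consistent `μ`-heat kernel. The values of `p` at
times `t ≤ 0` are irrelevant. -/
structure IsHeatKernel (μ : Measure X) (p : ℝ → X → X → ℝ≥0) : Prop where
  measurable : Measurable (fun z : Set.Ioi (0 : ℝ) × X × X => p z.1 z.2.1 z.2.2)
  chapman_kolmogorov : ∀ t s : ℝ, 0 < t → 0 < s → ∀ x y : X,
    (p (t + s) x y : ℝ≥0∞) = ∫⁻ z, (p t x z : ℝ≥0∞) * p s z y ∂μ
  symm : ∀ t : ℝ, 0 < t → ∀ x y : X, p t x y = p t y x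
  lintegral_le_one : ∀ t : ℝ, 0 < t → ∀ x : X, ∫⁻ y, (p t x y : ℝ≥0∞) ∂μ ≤ 1
  tendsto : ∀ f : X → ℂ, MemLp f 2 μ →
    Tendsto (fun t : ℝ => eLpNorm (fun x => (∫ y, (p t x y : ℝ) • f y ∂μ) - f x) 2 μ)
      (𝓝[>] 0) (𝓝 0)

namespace IsHeatKernel

variable {μ : Measure X} {p : ℝ → X → X → ℝ≥0}

lemma measurable_kernel (hp : IsHeatKernel μ p) {t : ℝ} (ht : 0 < t) :
    Measurable (fun z : X × X => p t z.1 z.2) :=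
  hp.measurable.comp (measurable_const.prodMk measurable_id :
    Measurable (fun z : X × X => ((⟨t, ht⟩ : Set.Ioi (0 : ℝ)), z)))

lemma integrable_kernel_smul (hp : IsHeatKernel μ p) {t : ℝ} (ht : 0 < t) (x : X)
    {f : X → ℂ} (hf : MemLp f 2 μ) : Integrable (fun y => (p t x y : ℝ) • f y) μ := by
  have hm : Measurable (fun y => (p t x y : ℝ)) :=
    ((hp.measurable_kernel ht).comp (measurable_const.prodMk measurable_id)).coe_nnreal_real
  have hk : MemLp (fun y => (p t x y : ℝ)) 2 μ := by
    refine ⟨hm.aestronglyMeasurable, ?_⟩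
    rw [eLpNorm_lt_top_iff_lintegral_rpow_enorm_lt_top (by simp) (by simp)]
    have h := hp.chapman_kolmogorov t t ht ht x x
    have h2 : ∫⁻ y, ‖(p t x y : ℝ)‖ₑ ^ (2 : ℝ≥0∞).toReal ∂μ = p (t + t) x x := by
      rw [h]
      refine lintegral_congr fun y => ?_
      rw [hp.symm t ht y x]
      simp [sq, enorm_eq_nnnorm]
    rw [h2]
    exact ENNReal.coe_lt_top
  exact memLp_one_iff_integrable.1 (hf.smul hk)

/-- Schur's test. -/
lemma lintegral_sq_le [SigmaFinite μ] (hp : IsHeatKernel μ p) {t : ℝ} (ht : 0 < t)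
    {f : X → ℂ} (hf : Measurable f) :
    ∫⁻ x, ‖∫ y, (p t x y : ℝ) • f y ∂μ‖ₑ ^ (2 : ℝ) ∂μ ≤ ∫⁻ y, ‖f y‖ₑ ^ (2 : ℝ) ∂μ := by
  have hk := hp.measurable_kernel ht
  have hkx : ∀ x, Measurable (fun y => (p t x y : ℝ≥0∞)) := fun x =>
    (hk.comp (measurable_const.prodMk measurable_id)).coe_nnreal_ennreal
  have hfe : Measurable (fun y => ‖f y‖ₑ) := hf.enorm
  have h1 : ∀ x, ‖∫ y, (p t x y : ℝ) • f y ∂μ‖ₑ ^ (2 : ℝ) ≤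
      ∫⁻ y, (p t x y : ℝ≥0∞) * ‖f y‖ₑ ^ (2 : ℝ) ∂μ := by
    intro x
    have a1 : ‖∫ y, (p t x y : ℝ) • f y ∂μ‖ₑ ≤ ∫⁻ y, (p t x y : ℝ≥0∞) * ‖f y‖ₑ ∂μ := by
      refine (enorm_integral_le_lintegral_enorm _).trans (le_of_eq (lintegral_congr fun y => ?_))
      rw [enorm_smul]
      simp [enorm_eq_nnnorm]
    have a2 := ENNReal.lintegral_mul_le_Lp_mul_Lq μ Real.HolderConjugate.two_two
      (f := fun y => (p t x y : ℝ≥0∞) ^ (1 / 2 : ℝ))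
      (g := fun y => (p t x y : ℝ≥0∞) ^ (1 / 2 : ℝ) * ‖f y‖ₑ)
      ((hkx x).pow_const _).aemeasurable (((hkx x).pow_const _).mul hfe).aemeasurable
    have a3 : ∀ y, (p t x y : ℝ≥0∞) ^ (1 / 2 : ℝ) * (p t x y : ℝ≥0∞) ^ (1 / 2 : ℝ) = p t x y := by
      intro y
      rw [← ENNReal.rpow_add_of_nonneg _ _ (by norm_num) (by norm_num)]
      norm_num
    have a4 : ∀ y, ((p t x y : ℝ≥0∞) ^ (1 / 2 : ℝ)) ^ (2 : ℝ) = p t x y := by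
      intro y
      rw [← ENNReal.rpow_mul]
      norm_num
    simp only [Pi.mul_apply, ← mul_assoc, a3, ENNReal.mul_rpow_of_nonneg _ _ zero_le_two, a4] at a2
    calc _ ≤ (∫⁻ y, (p t x y : ℝ≥0∞) * ‖f y‖ₑ ∂μ) ^ (2 : ℝ) := by gcongr
      _ ≤ ((∫⁻ y, (p t x y : ℝ≥0∞) ∂μ) ^ (1 / 2 : ℝ) *
          (∫⁻ y, (p t x y : ℝ≥0∞) * ‖f y‖ₑ ^ (2 : ℝ) ∂μ) ^ (1 / 2 : ℝ)) ^ (2 : ℝ) := by gcongr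
      _ = (∫⁻ y, (p t x y : ℝ≥0∞) ∂μ) * ∫⁻ y, (p t x y : ℝ≥0∞) * ‖f y‖ₑ ^ (2 : ℝ) ∂μ := by
          rw [ENNReal.mul_rpow_of_nonneg _ _ zero_le_two, ← ENNReal.rpow_mul, ← ENNReal.rpow_mul]
          norm_num
      _ ≤ 1 * _ := by gcongr; exact hp.lintegral_le_one t ht x
      _ = _ := one_mul _
  calc _ ≤ ∫⁻ x, ∫⁻ y, (p t x y : ℝ≥0∞) * ‖f y‖ₑ ^ (2 : ℝ) ∂μ ∂μ := lintegral_mono h1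
    _ = ∫⁻ y, ∫⁻ x, (p t x y : ℝ≥0∞) * ‖f y‖ₑ ^ (2 : ℝ) ∂μ ∂μ := by
        refine lintegral_lintegral_swap (Measurable.aemeasurable ?_)
        exact hk.coe_nnreal_ennreal.mul ((hfe.comp measurable_snd).pow_const _)
    _ ≤ ∫⁻ y, ‖f y‖ₑ ^ (2 : ℝ) ∂μ := by
        refine lintegral_mono fun y => ?_
        have hky : Measurable (fun x => (p t x y : ℝ≥0∞)) :=
          (hk.comp (measurable_id.prodMk measurable_const)).coe_nnreal_ennreal
        rw [lintegral_mul_const _ hky]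
        have : ∫⁻ x, (p t x y : ℝ≥0∞) ∂μ ≤ 1 := by
          refine le_of_eq_of_le (lintegral_congr fun x => ?_) (hp.lintegral_le_one t ht y)
          rw [hp.symm t ht x y]
        calc _ ≤ 1 * ‖f y‖ₑ ^ (2 : ℝ) := by gcongr
          _ = _ := one_mul _

lemma eLpNorm_le [SigmaFinite μ] (hp : IsHeatKernel μ p) {t : ℝ} (ht : 0 < t)
    (f : Lp ℂ 2 μ) :
    eLpNorm (fun x => ∫ y, (p t x y : ℝ) • f y ∂μ) 2 μ ≤ eLpNorm f 2 μ := by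
  rw [eLpNorm_eq_lintegral_rpow_enorm_toReal (by simp) (by simp),
    eLpNorm_eq_lintegral_rpow_enorm_toReal (by simp) (by simp)]
  simp only [ENNReal.toReal_ofNat]
  refine ENNReal.rpow_le_rpow ?_ (by norm_num)
  exact hp.lintegral_sq_le ht (Lp.stronglyMeasurable f).measurable

lemma memLp [SigmaFinite μ] (hp : IsHeatKernel μ p) {t : ℝ} (ht : 0 < t) (f : Lp ℂ 2 μ) :
    MemLp (fun x => ∫ y, (p t x y : ℝ) • f y ∂μ) 2 μ := by
  refine ⟨?_, (hp.eLpNorm_le ht f).trans_lt (Lp.eLpNorm_lt_top f)⟩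
  have h : StronglyMeasurable (fun z : X × X => (p t z.1 z.2 : ℝ) • f z.2) :=
    (hp.measurable_kernel ht).coe_nnreal_real.stronglyMeasurable.smul
      ((Lp.stronglyMeasurable f).comp_measurable measurable_snd)
  exact h.integral_prod_right.aestronglyMeasurable

/-- The operators `P_t` in `L²(X, μ)`, with `P_t f(x) = ∫ p(t,x,y) f(y) dμ(y)` for `t > 0` and
`P_0 = id` (the values for `t < 0` are irrelevant). -/
def P [SigmaFinite μ] (hp : IsHeatKernel μ p) (t : ℝ) : Lp ℂ 2 μ →L[ℂ] Lp ℂ 2 μ :=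
  if ht : 0 < t then
    LinearMap.mkContinuous
      { toFun := fun f => (hp.memLp ht f).toLp
        map_add' := by
          intro f g
          rw [← MemLp.toLp_add]
          refine MemLp.toLp_congr _ _ (.of_forall fun x => ?_)
          rw [Pi.add_apply, ← integral_add (hp.integrable_kernel_smul ht x (Lp.memLp f))
            (hp.integrable_kernel_smul ht x (Lp.memLp g))]
          refine integral_congr_ae ?_
          filter_upwards [Lp.coeFn_add f g] with y hy
          rw [hy, Pi.add_apply, smul_add]
        map_smul' := by
          intro c f
          rw [RingHom.id_apply, ← MemLp.toLp_const_smul]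
          refine MemLp.toLp_congr _ _ (.of_forall fun x => ?_)
          rw [Pi.smul_apply, ← integral_smul]
          refine integral_congr_ae ?_
          filter_upwards [Lp.coeFn_smul c f] with y hy
          rw [hy, Pi.smul_apply, smul_comm] }
      1 (fun f => by
        rw [one_mul, Lp.norm_def f]
        change ‖(hp.memLp ht f).toLp‖ ≤ _
        rw [Lp.norm_toLp]
        exact ENNReal.toReal_mono (Lp.eLpNorm_ne_top f) (hp.eLpNorm_le ht f))
  else ContinuousLinearMap.id ℂ _

/-- The operator `H_p` with `e^{-t H_p} = P_t`. -/
def generator [SigmaFinite μ] (hp : IsHeatKernel μ p) : Lp ℂ 2 μ →ₗ.[ℂ] Lp ℂ 2 μ :=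
  negGenerator hp.P

end IsHeatKernel

/-- `F₁ : X → (0, ∞)` is an `L^q`-control function for `p`. -/
def IsControlFunction (p : ℝ → X → X → ℝ≥0) (q : ℝ) (F₁ : X → ℝ) : Prop :=
  Measurable F₁ ∧ (∀ x, 0 < F₁ x) ∧
  ∃ F₂ : ℝ → ℝ, Measurable (fun t : Set.Ioi (0 : ℝ) => F₂ t) ∧ (∀ t, 0 < t → 0 < F₂ t) ∧
    (∀ t, 0 < t → ∀ x : X, (p t x x : ℝ) ≤ F₁ x * F₂ t) ∧
    ∫⁻ t in Set.Ioi (0 : ℝ), ENNReal.ofReal (Real.exp (-t) * F₂ t ^ (1 / (2 * q))) < ∞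

/-- `h` vanishes `μ`-weakly at infinity. -/
def VanishesWeakly (h : X → ℝ) (μ : Measure X) : Prop :=
  ∀ c : ℝ, 0 < c → μ {x | c ≤ |h x|} < ∞

/-- The measure `F dμ`. -/
def weighted (F : X → ℝ) (μ : Measure X) : Measure X :=
  μ.withDensity (fun x => ENNReal.ofReal (F x))

end HeatKernel

/-! ### Kato domination -/

section Kato

variable {X : Type u} [MeasurableSpace X] {d : ℕ} {E : X → Type v}
  [∀ x, NormedAddCommGroup (E x)] [∀ x, InnerProductSpace ℂ (E x)]
  [MeasurableSpace (TotalSpace (Fin d → ℂ) E)]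
  [IsCountablyGeneratedBundle d E] [IsMeasurableHermitian d E] {μ : Measure X}

/-- `|e^{-tT} f| ≤ e^{-tS} |f|` almost everywhere, for all `t ≥ 0` and `f`. -/
def SemigroupDominates (T : L2Sections d E μ →ₗ.[ℂ] L2Sections d E μ)
    (S : Lp ℂ 2 μ →ₗ.[ℂ] Lp ℂ 2 μ) : Prop :=
  ∃ (U : ℝ → L2Sections d E μ →L[ℂ] L2Sections d E μ) (V : ℝ → Lp ℂ 2 μ →L[ℂ] Lp ℂ 2 μ),
    IsSemigroupOf T U ∧ IsSemigroupOf S V ∧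
    ∀ t : ℝ, 0 ≤ t → ∀ f : L2Sections d E μ, ∀ᵐ x ∂μ, (‖U t f x‖ : ℂ) ≤ V t f.abs x

/-- `|(T + a)⁻¹ f| ≤ (S + a)⁻¹ |f|` almost everywhere, for all `a > 0` and `f`. -/
def ResolventDominates (T : L2Sections d E μ →ₗ.[ℂ] L2Sections d E μ)
    (S : Lp ℂ 2 μ →ₗ.[ℂ] Lp ℂ 2 μ) : Prop :=
  ∀ a : ℝ, 0 < a → ∃ (R : L2Sections d E μ →L[ℂ] L2Sections d E μ)
    (Q : Lp ℂ 2 μ →L[ℂ] Lp ℂ 2 μ),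
    IsBoundedInverse (shift T a) R ∧ IsBoundedInverse (shift S a) Q ∧
    ∀ f : L2Sections d E μ, ∀ᵐ x ∂μ, (‖R f x‖ : ℂ) ≤ Q f.abs x

/-- `T` dominates `S` in the Kato sense. For self-adjoint nonnegative operators the two conditions
are equivalent, and either of them may be used as the definition. -/
def KatoDominates (T : L2Sections d E μ →ₗ.[ℂ] L2Sections d E μ)
    (S : Lp ℂ 2 μ →ₗ.[ℂ] Lp ℂ 2 μ) : Prop :=
  SemigroupDominates T S ∨ ResolventDominates T S

end Kato

end BundleSchrodinger

end

open BundleSchrodinger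

noncomputable section

namespace BundleSchrodinger

universe u v

/-! ### Resolvents of unbounded symmetric and self-adjoint operators -/

section OperatorTheory

variable {H : Type*} [NormedAddCommGroup H] [InnerProductSpace ℂ H]

/-! Write `T` for the operator in the bundle, `V` for multiplication by `W`, and `R = (T + 1)⁻¹`.
The heart of the matter is that `V R` is compact; the remaining conclusions follow from the abstract
theory of relatively compact symmetric perturbations.

Compactness. Kato domination gives the pointwise bound `|R f| ≤ ∫₀^∞ e^{-t} P_t |f| dt`
(`KatoDominates.exists_isBoundedInverse`), so only bounds for the scalar kernel matter. By
Chapman-Kolmogorov and Cauchy-Schwarz, `(P_t g)(x)² ≤ p(t,x,x) ‖g‖²`. This has two consequences.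
Interpolation with the `L²`-contractivity of `P_t` gives `‖w R f‖² ≤ C (∫ w^{2q} F₁ dμ)^{1/q} ‖f‖²`
(`IsControlFunction.lintegral_mul_resOp_sq_le`), so that cutting off `W₁` costs little in operator
norm. Iterating `k ≥ q` resolvents gives `|((T + b)⁻¹)^k f(x)| ≤ C F₁(x)^{1/2} ‖f‖`
(`IsControlFunction.resOp_iterate_le`). On a set `D` with `∫_D F₁ dμ < ∞` the right side is an `L²`
function times `‖f‖`, and an operator with such a bound is Hilbert-Schmidt, the fibres having
dimension `d` (`L2Sections.isCompactOperator_of_pointwise_bound`). Since `(b (T + b)⁻¹)^k R → R` in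
norm as `b → ∞`, the cut-off resolvent `1_D R` is compact (`isCompactOperator_indicator_comp`).
Finally `W₁` and `W₂` are approximated by bounded multipliers supported on such sets.

Perturbation theory. Let `K = V (T - w)⁻¹` be compact and `V` symmetric. For nonreal `w`, symmetry
makes `1 + K` injective, hence invertible by the Fredholm alternative, and the range criterion gives
self-adjointness of `T + V`. For semiboundedness, `V (T + n + 1)⁻¹` tends to `0` in norm, and by
symmetry the norm bound is also a form bound. For the essential spectrum, its complement is
described by a compactness property of Weyl sequences (`isWeylRegular_iff_notMem_essSpectrum`), and
that property survives relatively compact perturbations. -/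

lemma mem_graph_shift {T : H →ₗ.[ℂ] H} {z : ℂ} {u v : H} :
    (u, v) ∈ (shift T z).graph ↔ (u, v - z • u) ∈ T.graph := by
  simp only [LinearPMap.mem_graph_iff]
  constructor
  · rintro ⟨y, rfl, rfl⟩
    refine ⟨y, rfl, ?_⟩
    change T y = (z • (y : H) + T y) - z • (y : H)
    abel
  · rintro ⟨y, rfl, hy⟩
    refine ⟨y, rfl, ?_⟩
    change z • (y : H) + T y = v
    rw [hy]; simp

lemma isBoundedInverse_iff {T : H →ₗ.[ℂ] H} {R : H →L[ℂ] H} :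
    IsBoundedInverse T R ↔ ∀ u f, (u, f) ∈ T.graph ↔ R f = u := by
  constructor
  · rintro ⟨h1, h2⟩ u f
    constructor
    · intro h
      obtain ⟨y, hy, hy'⟩ := (LinearPMap.mem_graph_iff _).1 h
      simp only at hy hy'
      rw [← hy', h2, hy]
    · rintro rfl
      exact h1 f
  · intro h
    exact ⟨fun f => (h _ _).2 rfl, fun u => (h _ _).1 (T.mem_graph u)⟩

/-- Resolvents are used in this graph form throughout, so that membership in the domain and the
value of `T` are tracked by one statement, without subtypes. -/
lemma isBoundedInverse_shift_iff {T : H →ₗ.[ℂ] H} {z : ℂ} {R : H →L[ℂ] H} :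
    IsBoundedInverse (shift T z) R ↔ ∀ u v, (u, v) ∈ T.graph ↔ R (v + z • u) = u := by
  rw [isBoundedInverse_iff]
  constructor
  · intro h u v
    rw [← h, mem_graph_shift, add_sub_cancel_right]
  · intro h u f
    rw [mem_graph_shift, h, sub_add_cancel]

lemma IsBoundedInverse.mem_graph {T : H →ₗ.[ℂ] H} {z : ℂ} {R : H →L[ℂ] H}
    (h : IsBoundedInverse (shift T z) R) (f : H) : (R f, f - z • R f) ∈ T.graph := by
  rw [isBoundedInverse_shift_iff.1 h, sub_add_cancel]

/-- The first resolvent identity. -/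
lemma IsBoundedInverse.resolvent_identity {T : H →ₗ.[ℂ] H} {z w : ℂ} {R S : H →L[ℂ] H}
    (hR : IsBoundedInverse (shift T z) R) (hS : IsBoundedInverse (shift T w) S) (f : H) :
    R f = S f + (w - z) • S (R f) := by
  have h := (isBoundedInverse_shift_iff.1 hS _ _).1 (hR.mem_graph f)
  rw [sub_add_eq_add_sub, add_sub_assoc, ← sub_smul, map_add, map_smul] at h
  exact h.symm

/-- `T` is symmetric. -/
def IsSymmetricOp (T : H →ₗ.[ℂ] H) : Prop :=
  ∀ u v u' v', (u, v) ∈ T.graph → (u', v') ∈ T.graph → inner ℂ v u' = inner ℂ u v'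

lemma IsSymmetricOp.inner_self {T : H →ₗ.[ℂ] H} (hT : IsSymmetricOp T) {u v : H}
    (h : (u, v) ∈ T.graph) : ((inner ℂ u v : ℂ).re : ℂ) = inner ℂ u v := by
  have h1 := hT u v u v h h
  rw [← inner_conj_symm] at h1
  exact Complex.conj_eq_iff_re.1 h1

/-- `‖(T - w)u‖² = ‖(T - Re w)u‖² + (Im w)² ‖u‖²`. -/
lemma IsSymmetricOp.norm_sub_smul_sq {T : H →ₗ.[ℂ] H} (hT : IsSymmetricOp T) {u v : H}
    (h : (u, v) ∈ T.graph) (w : ℂ) :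
    ‖v - w • u‖ ^ 2 = ‖v - (w.re : ℂ) • u‖ ^ 2 + w.im ^ 2 * ‖u‖ ^ 2 := by
  have h1 := hT.inner_self h
  have e1 : (inner ℂ u v : ℂ).im = 0 := by
    have := congrArg Complex.im h1; simpa using this.symm
  have e2 : (inner ℂ v u : ℂ).im = 0 := by
    rw [← inner_conj_symm, Complex.conj_im, e1, neg_zero]
  have key : ∀ w : ℂ, ‖v - w • u‖ ^ 2 =
      ‖v‖ ^ 2 - 2 * (w.re * (inner ℂ v u : ℂ).re) + (w.re ^ 2 + w.im ^ 2) * ‖u‖ ^ 2 := by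
    intro w
    rw [@norm_sub_sq ℂ, inner_smul_right, norm_smul, mul_pow, ← Complex.normSq_eq_norm_sq w,
      Complex.normSq_apply]
    simp only [RCLike.re_eq_complex_re, Complex.mul_re, e2]
    ring
  rw [key w, key (w.re : ℂ)]
  simp only [Complex.ofReal_re, Complex.ofReal_im]
  ring

/-- The preceding identity sees `w` only through `Re w` and `(Im w)²`. This transfers lower bounds
from `T - w` to `T - w̄`. -/
lemma IsSymmetricOp.norm_sub_conj_smul {T : H →ₗ.[ℂ] H} (hT : IsSymmetricOp T) {u v : H}
    (h : (u, v) ∈ T.graph) (w : ℂ) :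
    ‖v - (starRingEnd ℂ w) • u‖ = ‖v - w • u‖ := by
  rw [← sq_eq_sq₀ (norm_nonneg _) (norm_nonneg _), hT.norm_sub_smul_sq h, hT.norm_sub_smul_sq h w]
  simp

lemma IsSymmetricOp.abs_im_mul_norm_le {T : H →ₗ.[ℂ] H} (hT : IsSymmetricOp T) {u v : H}
    (h : (u, v) ∈ T.graph) (w : ℂ) : |w.im| * ‖u‖ ≤ ‖v - w • u‖ := by
  refine (sq_le_sq₀ (by positivity) (norm_nonneg _)).1 ?_
  rw [hT.norm_sub_smul_sq h, mul_pow, sq_abs]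
  have := sq_nonneg ‖v - (w.re : ℂ) • u‖
  linarith

variable [CompleteSpace H]

/-- This is `A = A*` read on graphs; the right-to-left direction is the tool for showing that a
vector lies in the domain. -/
lemma mem_graph_iff_of_isSelfAdjoint {A : H →ₗ.[ℂ] H} (hA : IsSelfAdjoint A) {y w : H} :
    (y, w) ∈ A.graph ↔ ∀ u v, (u, v) ∈ A.graph → inner ℂ v y = inner ℂ u w := by
  have h := LinearPMap.adjoint_graph_eq_graph_adjoint hA.dense_domain
  rw [LinearPMap.isSelfAdjoint_def.1 hA] at h
  conv_lhs => rw [h]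
  rw [Submodule.mem_adjoint_iff]
  simp only [sub_eq_zero]

lemma isSymmetricOp_of_isSelfAdjoint {A : H →ₗ.[ℂ] H} (hA : IsSelfAdjoint A) :
    IsSymmetricOp A := fun _ _ _ _ h h' => (mem_graph_iff_of_isSelfAdjoint hA).1 h' _ _ h

/-- A point at which a self-adjoint operator is bounded below lies in the resolvent set. -/
lemma exists_isBoundedInverse_of_le {A : H →ₗ.[ℂ] H} (hA : IsSelfAdjoint A) {w : ℂ} {c : ℝ}
    (hc : 0 < c) (h : ∀ u v, (u, v) ∈ A.graph → c * ‖u‖ ≤ ‖v - w • u‖) :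
    ∃ R : H →L[ℂ] H, IsBoundedInverse (shift A (-w)) R ∧ ∀ f, ‖R f‖ ≤ c⁻¹ * ‖f‖ := by
  have hsymm := isSymmetricOp_of_isSelfAdjoint hA
  have hclosed : IsClosed (A.graph : Set (H × H)) := hA.isClosed
  have hcomplete : CompleteSpace A.graph := hclosed.completeSpace_coe
  -- `A - w` is viewed as a bounded map on the graph, which is complete because `A` is closed. The
  -- lower bound controls `u`, and then `v = L x + w u`, so `L` is injective with closed range.
  let L : A.graph →L[ℂ] H :=
    (ContinuousLinearMap.snd ℂ H H - w • ContinuousLinearMap.fst ℂ H H).comp A.graph.subtypeL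
  have hL : ∀ x : A.graph, L x = x.1.2 - w • x.1.1 := fun x => rfl
  have hanti : AntilipschitzWith (max c⁻¹ (1 + ‖w‖ * c⁻¹)).toNNReal L := by
    refine ContinuousLinearMap.antilipschitz_of_bound _ fun x => ?_
    rw [Real.coe_toNNReal _ (le_max_of_le_left (inv_pos.2 hc).le)]
    have h1 : ‖x.1.1‖ ≤ c⁻¹ * ‖L x‖ := by
      rw [inv_mul_eq_div, le_div_iff₀ hc, mul_comm, hL]
      exact h _ _ x.2
    have h2 : ‖x.1.2‖ ≤ (1 + ‖w‖ * c⁻¹) * ‖L x‖ := by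
      have e : x.1.2 = L x + w • x.1.1 := by rw [hL]; abel
      calc ‖x.1.2‖ = ‖L x + w • x.1.1‖ := by rw [← e]
        _ ≤ ‖L x‖ + ‖w‖ * ‖x.1.1‖ := (norm_add_le _ _).trans (by rw [norm_smul])
        _ ≤ ‖L x‖ + ‖w‖ * (c⁻¹ * ‖L x‖) := by gcongr
        _ = _ := by ring
    change ‖x.1‖ ≤ _
    rw [Prod.norm_def]
    refine max_le (h1.trans ?_) (h2.trans ?_)
    · gcongr; exact le_max_left _ _
    · gcongr; exact le_max_right _ _
  have hrange : IsClosed (LinearMap.range (L : A.graph →ₗ[ℂ] H) : Set H) := by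
    have := hanti.isClosed_range L.uniformContinuous
    exact this
  have hbot : (LinearMap.range (L : A.graph →ₗ[ℂ] H))ᗮ = ⊥ := by
    rw [Submodule.eq_bot_iff]
    intro y hy
    rw [Submodule.mem_orthogonal] at hy
    -- A vector orthogonal to the range of `A - w` lies in the domain of the adjoint, which is `A`,
    -- and satisfies `A y = w̄ y`. The lower bound, transferred to `A - w̄`, then forces `y = 0`.
    have hmem : (y, (starRingEnd ℂ w) • y) ∈ A.graph := by
      rw [mem_graph_iff_of_isSelfAdjoint hA]
      intro u v huv
      have := hy (L ⟨(u, v), huv⟩) ⟨_, rfl⟩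
      rw [hL, inner_sub_left, sub_eq_zero, inner_smul_left] at this
      rw [this, inner_smul_right]
    have h1 := h _ _ hmem
    rw [← hsymm.norm_sub_conj_smul hmem, sub_self, norm_zero] at h1
    have : ‖y‖ ≤ 0 := by
      by_contra hh
      push Not at hh
      nlinarith [mul_pos hc hh]
    exact norm_le_zero_iff.1 this
  have hsurj : ∀ f, ∃ x : A.graph, L x = f := by
    intro f
    have : CompleteSpace (LinearMap.range (L : A.graph →ₗ[ℂ] H)) := hrange.completeSpace_coe
    have htop := Submodule.orthogonal_eq_bot_iff.1 hbot
    have hf : f ∈ LinearMap.range (L : A.graph →ₗ[ℂ] H) := by rw [htop]; trivial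
    exact hf
  choose g hg using hsurj
  have hinj : Function.Injective L := hanti.injective
  have hadd : ∀ f f', g (f + f') = g f + g f' := fun f f' => hinj (by rw [map_add, hg, hg, hg])
  have hsmul : ∀ (a : ℂ) f, g (a • f) = a • g f := fun a f => hinj (by rw [map_smul, hg, hg])
  have hbound : ∀ f, ‖(g f).1.1‖ ≤ c⁻¹ * ‖f‖ := by
    intro f
    have := h _ _ (g f).2
    rw [← hL, hg] at this
    rwa [inv_mul_eq_div, le_div_iff₀ hc, mul_comm]
  let R : H →L[ℂ] H := LinearMap.mkContinuous
    { toFun := fun f => (g f).1.1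
      map_add' := fun f f' => by rw [hadd]; rfl
      map_smul' := fun a f => by rw [hsmul]; rfl } c⁻¹ hbound
  refine ⟨R, isBoundedInverse_shift_iff.2 fun u v => ?_, hbound⟩
  have hRg : ∀ f, R f = (g f).1.1 := fun f => rfl
  constructor
  · intro huv
    have e : g (v + (-w) • u) = ⟨(u, v), huv⟩ := hinj (by rw [hg, hL]; simp [sub_eq_add_neg])
    rw [hRg, e]
  · intro huv
    rw [hRg] at huv
    have h1 := (g (v + (-w) • u)).2
    have h2 := hg (v + (-w) • u)
    rw [hL, huv] at h2
    have h3 : (g (v + (-w) • u)).1 = (u, v) := by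
      refine Prod.ext huv ?_
      have := sub_eq_iff_eq_add.1 h2
      rw [this]; simp
    rw [h3] at h1
    exact h1

lemma exists_isBoundedInverse_of_im_ne_zero {A : H →ₗ.[ℂ] H} (hA : IsSelfAdjoint A) {w : ℂ}
    (hw : w.im ≠ 0) : ∃ R : H →L[ℂ] H, IsBoundedInverse (shift A (-w)) R :=
  let ⟨R, hR, _⟩ := exists_isBoundedInverse_of_le hA (abs_pos.2 hw)
    fun _ _ h => (isSymmetricOp_of_isSelfAdjoint hA).abs_im_mul_norm_le h w
  ⟨R, hR⟩

/-- The resolvent of a nonnegative self-adjoint operator. -/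
lemma exists_isBoundedInverse_of_nonneg {A : H →ₗ.[ℂ] H} (hA : IsSelfAdjoint A)
    (h0 : BoundedBelowBy A 0) {a : ℝ} (ha : 0 < a) :
    ∃ R : H →L[ℂ] H, IsBoundedInverse (shift A a) R ∧ ∀ f, ‖R f‖ ≤ a⁻¹ * ‖f‖ := by
  have h := exists_isBoundedInverse_of_le hA (w := -(a : ℂ)) ha fun u v huv => ?_
  · simpa using h
  obtain ⟨y, rfl, rfl⟩ := (LinearPMap.mem_graph_iff _).1 huv
  have h1 := h0 y
  simp only [zero_mul] at h1
  have h2 : a * ‖(y : H)‖ ^ 2 ≤ ‖A y - -(a : ℂ) • (y : H)‖ * ‖(y : H)‖ := by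
    calc a * ‖(y : H)‖ ^ 2 ≤ (inner ℂ (y : H) (A y - -(a : ℂ) • (y : H))).re := by
          rw [neg_smul, sub_neg_eq_add, inner_add_right, inner_smul_right, Complex.add_re,
            inner_self_eq_norm_sq_to_K]
          have : ((a : ℂ) * ((‖(y : H)‖ : ℂ)) ^ 2).re = a * ‖(y : H)‖ ^ 2 := by
            rw [← Complex.ofReal_pow, ← Complex.ofReal_mul, Complex.ofReal_re]
          have e : (((‖(y : H)‖ : ℝ) : ℂ)) = (RCLike.ofReal ‖(y : H)‖ : ℂ) := rfl
          rw [← e, this]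
          linarith
      _ ≤ ‖(inner ℂ (y : H) (A y - -(a : ℂ) • (y : H)) : ℂ)‖ := Complex.re_le_norm _
      _ ≤ ‖(y : H)‖ * ‖A y - -(a : ℂ) • (y : H)‖ := norm_inner_le_norm _ _
      _ = _ := mul_comm _ _
  rcases (norm_nonneg (y : H)).eq_or_lt with h3 | h3
  · rw [← h3, mul_zero]; positivity
  · rw [sq, ← mul_assoc] at h2
    exact le_of_mul_le_mul_right h2 h3

/-- The basic criterion for self-adjointness. -/
lemma isSelfAdjoint_of_range {A : H →ₗ.[ℂ] H} (hd : Dense (A.domain : Set H))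
    (hs : IsSymmetricOp A) (w : ℂ)
    (h1 : ∀ f, ∃ u v, (u, v) ∈ A.graph ∧ v - w • u = f)
    (h2 : ∀ f, ∃ u v, (u, v) ∈ A.graph ∧ v - (starRingEnd ℂ w) • u = f) : IsSelfAdjoint A := by
  rw [LinearPMap.isSelfAdjoint_def]
  refine LinearPMap.eq_of_eq_graph ?_
  rw [LinearPMap.adjoint_graph_eq_graph_adjoint hd]
  ext ⟨y, g⟩
  rw [Submodule.mem_adjoint_iff]
  simp only [sub_eq_zero]
  constructor
  · intro h
    -- For `(y, g)` in the adjoint graph, `u` is chosen with `(A - w) u = g - w y`. Then `y - u` is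
    -- orthogonal to the range of `A - w̄`, which is the whole space.
    obtain ⟨u, v, huv, hf⟩ := h1 (g - w • y)
    have key : ∀ f, inner ℂ f (y - u) = 0 := by
      intro f
      obtain ⟨u', v', huv', rfl⟩ := h2 f
      have e1 := h u' v' huv'
      have e2 := hs _ _ _ _ huv' huv
      have e3 : g - v = w • (y - u) := by
        rw [smul_sub]
        have := congrArg (· + w • y - v) hf
        rw [sub_add_cancel] at this
        rw [← this]; abel
      rw [inner_sub_left, inner_smul_left, RingHomCompTriple.comp_apply, RingHom.id_apply,
        inner_sub_right, e1, e2, ← inner_sub_right, e3, inner_smul_right, sub_self]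
    have hy : y = u := sub_eq_zero.1 (inner_self_eq_zero.1 (key (y - u)))
    subst hy
    have : g = v := (sub_left_inj.1 hf).symm
    rwa [this]
  · intro h u v huv
    exact hs _ _ _ _ huv h

end OperatorTheory

/-! ### The essential spectrum through Weyl sequences -/

section EssentialSpectrum

variable {H : Type*} [NormedAddCommGroup H] [InnerProductSpace ℂ H]

/-- Bounded sequences `u` in the domain for which `(T - z)u` converges have convergent
subsequences. For self-adjoint `T` this means that `z` is not in the essential spectrum. -/
def IsWeylRegular (T : H →ₗ.[ℂ] H) (z : ℂ) : Prop :=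
  ∀ u v : ℕ → H, (∀ n, (u n, v n) ∈ T.graph) → (∃ C, ∀ n, ‖u n‖ ≤ C) →
    (∃ h, Tendsto (fun n => v n - z • u n) atTop (𝓝 h)) →
    ∃ φ : ℕ → ℕ, StrictMono φ ∧ ∃ l, Tendsto (u ∘ φ) atTop (𝓝 l)

lemma mem_opEigenspace {T : H →ₗ.[ℂ] H} {z : ℂ} {u : H} :
    u ∈ opEigenspace T z ↔ (u, z • u) ∈ T.graph := by
  have h : (u, z • u) ∈ T.graph ↔ (u, 0) ∈ (shift T (-z)).graph := by
    rw [mem_graph_shift]; simp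
  rw [h, LinearPMap.mem_graph_iff, opEigenspace]
  constructor
  · rintro ⟨y, hy, rfl⟩
    exact ⟨y, rfl, hy⟩
  · rintro ⟨y, hy1, hy2⟩
    exact ⟨y, hy2, hy1⟩

lemma IsCompactOperator.exists_subseq_tendsto {K : H →L[ℂ] H} (hK : IsCompactOperator K)
    {u : ℕ → H} {C : ℝ} (hu : ∀ n, ‖u n‖ ≤ C) :
    ∃ φ : ℕ → ℕ, StrictMono φ ∧ ∃ l, Tendsto (fun n => K (u (φ n))) atTop (𝓝 l) := by
  have hc := IsCompactOperator.isCompact_closure_image_closedBall (f := (K : H →ₗ[ℂ] H)) hK C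
  obtain ⟨l, -, φ, hφ, h⟩ := hc.tendsto_subseq (x := fun n => K (u n))
    (fun n => subset_closure ⟨u n, by simpa using hu n, rfl⟩)
  exact ⟨φ, hφ, l, h⟩

/-- Invariance of Weyl regularity under relatively compact perturbations. -/
lemma IsWeylRegular.of_relatively_compact {T S : H →ₗ.[ℂ] H} {w : ℂ} {K : H →L[ℂ] H}
    (hK : IsCompactOperator K)
    (hST : ∀ u v, (u, v) ∈ S.graph → (u, v + K (v - w • u)) ∈ T.graph) {z : ℂ}
    (hT : IsWeylRegular T z) : IsWeylRegular S z := by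
  rintro u v huv ⟨C, hC⟩ ⟨h, hh⟩
  obtain ⟨D, hD⟩ := (Metric.isBounded_range_of_tendsto _ hh).exists_norm_le
  -- The hypothesis says `T = S + K (S - w)` on the domain of `S`. Since `(S - w) u n` is bounded,
  -- `K (S - w) u n` converges along a subsequence, and there `u n` is an admissible sequence for
  -- `T`.
  have hb : ∀ n, ‖v n - w • u n‖ ≤ D + ‖z - w‖ * C := by
    intro n
    have e : v n - w • u n = (v n - z • u n) + (z - w) • u n := by rw [sub_smul]; abel
    rw [e]
    refine (norm_add_le _ _).trans ?_
    rw [norm_smul]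
    have h1 := hD _ ⟨n, rfl⟩
    have h2 := hC n
    gcongr
  obtain ⟨φ, hφ, l, hl⟩ := IsCompactOperator.exists_subseq_tendsto hK hb
  obtain ⟨ψ, hψ, m, hm⟩ := hT (u ∘ φ) (fun n => v (φ n) + K (v (φ n) - w • u (φ n)))
    (fun n => hST _ _ (huv _)) ⟨C, fun n => hC _⟩ ⟨h + l, by
      refine ((hh.comp hφ.tendsto_atTop).add hl).congr fun n => ?_
      simp only [Function.comp_apply]
      abel⟩
  exact ⟨φ ∘ ψ, hφ.comp hψ, m, hm⟩

/-- The spectral mapping theorem for the resolvent, one inclusion. -/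
lemma notMem_spectrum_of_isBoundedInverse {T : H →ₗ.[ℂ] H} {w m : ℂ} (hm : m ≠ 0)
    {G G' : H →L[ℂ] H} (hG : IsBoundedInverse (shift T (-w)) G)
    (hG' : IsBoundedInverse (shift T (-(w + m⁻¹))) G') : m ∉ spectrum ℂ G := by
  rw [spectrum.notMem_iff]
  have h1 : ∀ f, G f = G' f - m⁻¹ • G' (G f) := fun f => by
    refine (hG.resolvent_identity hG' f).trans ?_
    rw [sub_eq_add_neg (G' f), ← neg_smul]
    congr 2; ring
  have h2 : ∀ f, G' f = G f + m⁻¹ • G (G' f) := fun f => by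
    refine (hG'.resolvent_identity hG f).trans ?_
    congr 2; ring
  -- Since `m - G = m (T - w - m⁻¹) (T - w)⁻¹`, the inverse is `m⁻¹ (T - w) G' = m⁻¹ (1 + m⁻¹ G')`.
  refine ⟨⟨algebraMap ℂ _ m - G, m⁻¹ • (1 + m⁻¹ • G'), ?_, ?_⟩, rfl⟩
  · ext f
    rw [Algebra.algebraMap_eq_smul_one]
    change m • (m⁻¹ • (f + m⁻¹ • G' f)) - G (m⁻¹ • (f + m⁻¹ • G' f)) = f
    rw [map_smul, map_add, map_smul, ← h2, smul_smul, mul_inv_cancel₀ hm, one_smul]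
    abel
  · ext f
    rw [Algebra.algebraMap_eq_smul_one]
    change m⁻¹ • ((m • f - G f) + m⁻¹ • G' (m • f - G f)) = f
    rw [map_sub, map_smul, smul_sub m⁻¹ (m • G' f), smul_smul m⁻¹ m (G' f), inv_mul_cancel₀ hm,
      one_smul, ← h1]
    rw [sub_add_cancel, smul_smul, inv_mul_cancel₀ hm, one_smul]

variable [CompleteSpace H]

lemma isClosed_opEigenspace {T : H →ₗ.[ℂ] H} (hT : IsSelfAdjoint T) (z : ℂ) :
    IsClosed (opEigenspace T z : Set H) := by
  have hclosed : IsClosed (T.graph : Set (H × H)) := hT.isClosed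
  have : (opEigenspace T z : Set H) = (fun u : H => (u, z • u)) ⁻¹' T.graph := by
    ext u; exact mem_opEigenspace
  rw [this]
  exact hclosed.preimage (by fun_prop)

/-- On the eigenspace `(T - z) u = 0`, so its closed unit ball is sequentially compact, and Riesz's
theorem applies. -/
lemma IsWeylRegular.finiteDimensional {T : H →ₗ.[ℂ] H} (hT : IsSelfAdjoint T) {z : ℂ}
    (h : IsWeylRegular T z) : FiniteDimensional ℂ (opEigenspace T z) := by
  refine FiniteDimensional.of_isCompact_closedBall₀ ℂ one_pos ?_
  refine IsSeqCompact.isCompact fun x hx => ?_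
  obtain ⟨φ, hφ, l, hl⟩ := h (fun n => x n) (fun n => z • (x n : H))
    (fun n => mem_opEigenspace.1 (x n).2) ⟨1, fun n => by simpa using hx n⟩
    ⟨0, by simp⟩
  have hlN : l ∈ opEigenspace T z :=
    (isClosed_opEigenspace hT z).mem_of_tendsto hl (.of_forall fun n => (x (φ n)).2)
  have hl' : Tendsto (x ∘ φ) atTop (𝓝 ⟨l, hlN⟩) := by
    rw [tendsto_subtype_rng]; exact hl
  exact ⟨⟨l, hlN⟩, Metric.isClosed_closedBall.mem_of_tendsto hl' (.of_forall fun n => hx _), φ, hφ,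
    hl'⟩

/-- Otherwise there are unit vectors `u n` orthogonal to the eigenspace with `(T - z) u n → 0`. A
subsequential limit is a unit vector lying both in the eigenspace, as the graph is closed, and in
its orthogonal complement. -/
lemma IsWeylRegular.exists_lower_bound {T : H →ₗ.[ℂ] H} (hT : IsSelfAdjoint T) {z : ℂ}
    (h : IsWeylRegular T z) : ∃ c : ℝ, 0 < c ∧ ∀ u v, (u, v) ∈ T.graph →
      u ∈ (opEigenspace T z)ᗮ → c * ‖u‖ ≤ ‖v - z • u‖ := by
  by_contra hcon
  push Not at hcon
  have hn : ∀ n : ℕ, ∃ u v, (u, v) ∈ T.graph ∧ u ∈ (opEigenspace T z)ᗮ ∧ ‖u‖ = 1 ∧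
      ‖v - z • u‖ ≤ 1 / ((n : ℝ) + 1) := by
    intro n
    obtain ⟨u, v, huv, hu, hlt⟩ := hcon (1 / ((n : ℝ) + 1)) Nat.one_div_pos_of_nat
    have hu0 : ‖u‖ ≠ 0 := by
      intro h0
      rw [h0, mul_zero] at hlt
      exact absurd hlt (not_lt.2 (norm_nonneg _))
    have hu1 : 0 < ‖u‖ := lt_of_le_of_ne (norm_nonneg _) (Ne.symm hu0)
    refine ⟨((‖u‖⁻¹ : ℝ) : ℂ) • u, ((‖u‖⁻¹ : ℝ) : ℂ) • v, T.graph.smul_mem _ huv,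
      Submodule.smul_mem _ _ hu, ?_, ?_⟩
    · rw [norm_smul, Complex.norm_real, norm_inv, norm_norm, inv_mul_cancel₀ hu0]
    · rw [smul_comm z, ← smul_sub, norm_smul, Complex.norm_real, norm_inv, norm_norm,
        inv_mul_le_iff₀ hu1, mul_comm]
      exact hlt.le
  choose u v huv hu hu1 hsmall using hn
  have hlim : Tendsto (fun n => v n - z • u n) atTop (𝓝 0) :=
    squeeze_zero_norm hsmall tendsto_one_div_add_atTop_nhds_zero_nat
  obtain ⟨φ, hφ, l, hl⟩ := h u v huv ⟨1, fun n => (hu1 n).le⟩ ⟨0, hlim⟩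
  have hl1 : ‖l‖ = 1 := tendsto_nhds_unique hl.norm (by simp [hu1])
  have hlo : l ∈ (opEigenspace T z)ᗮ :=
    (Submodule.isClosed_orthogonal _).mem_of_tendsto hl (.of_forall fun n => hu _)
  have hv : Tendsto (fun n => v (φ n)) atTop (𝓝 (z • l)) := by
    have := (hlim.comp hφ.tendsto_atTop).add (hl.const_smul z)
    simpa using this
  have hclosed : IsClosed (T.graph : Set (H × H)) := hT.isClosed
  have hmem : (l, z • l) ∈ T.graph :=
    hclosed.mem_of_tendsto (hl.prodMk_nhds hv) (.of_forall fun n => huv _)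
  have hl0 : l = 0 := by
    have := hlo l (mem_opEigenspace.2 hmem)
    exact inner_self_eq_zero.1 this
  rw [hl0, norm_zero] at hl1
  exact zero_ne_one hl1

lemma im_eq_zero_of_mem_opSpectrum {T : H →ₗ.[ℂ] H} (hT : IsSelfAdjoint T) {z : ℂ}
    (hz : z ∈ opSpectrum T) : z.im = 0 := by
  by_contra h
  exact hz (exists_isBoundedInverse_of_im_ne_zero hT h)

/-- Infinite multiplicity is excluded by the finite dimension of the eigenspace. If `c` bounds `T -
z` from below on the orthogonal complement of the eigenspace, then every `w ≠ z` with `|z - w| < c`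
is in the resolvent set, so `z` is no accumulation point of the spectrum. -/
lemma IsWeylRegular.notMem_essSpectrum {T : H →ₗ.[ℂ] H} (hT : IsSelfAdjoint T) {z : ℂ}
    (h : IsWeylRegular T z) : z ∉ essSpectrum T := by
  rintro ⟨hz, hz'⟩
  have hfin := h.finiteDimensional hT
  have hzreal : starRingEnd ℂ z = z :=
    Complex.conj_eq_iff_im.2 (im_eq_zero_of_mem_opSpectrum hT hz)
  have hsymm := isSymmetricOp_of_isSelfAdjoint hT
  rcases hz' with hacc | hinf
  swap
  · exact hinf hfin
  obtain ⟨c, hc, hlow⟩ := h.exists_lower_bound hT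
  rw [accPt_iff_nhds] at hacc
  obtain ⟨w, ⟨hwball, hw⟩, hwz⟩ := hacc (Metric.ball z c) (Metric.ball_mem_nhds z hc)
  rw [Metric.mem_ball, dist_eq_norm] at hwball
  have hzw : 0 < ‖z - w‖ := norm_pos_iff.2 (sub_ne_zero.2 hwz.symm)
  rw [norm_sub_rev] at hwball
  have hcw : 0 < c - ‖z - w‖ := by linarith
  apply hw
  suffices hbelow : ∀ u v, (u, v) ∈ T.graph →
      (‖z - w‖⁻¹ + (c - ‖z - w‖)⁻¹)⁻¹ * ‖u‖ ≤ ‖v - w • u‖ from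
    let ⟨R, hR, _⟩ := exists_isBoundedInverse_of_le hT (by positivity) hbelow
    ⟨R, hR⟩
  intro u v huv
  -- `T - w` is block diagonal for `N ⊕ Nᗮ`: it is `z - w` on `N` and bounded below by `c - |z - w|`
  -- on `Nᗮ`. The inverses of the two bounds add up because `‖n + u'‖ ≤ ‖n‖ + ‖u'‖`.
  set N := opEigenspace T z
  have hdecomp : ∃ n ∈ N, ∃ u' ∈ Nᗮ, u = n + u' :=
    ⟨N.starProjection u, Submodule.starProjection_apply_mem _ _, u - N.starProjection u,
      Submodule.sub_starProjection_mem_orthogonal u, by abel⟩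
  obtain ⟨n, hn, u', hu', rfl⟩ := hdecomp
  have hng : (n, z • n) ∈ T.graph := mem_opEigenspace.1 hn
  have hu'g : (u', v - z • n) ∈ T.graph := by
    have := T.graph.sub_mem huv hng
    simpa using this
  have hv'o : (v - z • n) ∈ Nᗮ := by
    intro m hm
    have hmg : (m, z • m) ∈ T.graph := mem_opEigenspace.1 hm
    rw [← hsymm _ _ _ _ hmg hu'g, inner_smul_left, hu' m hm, mul_zero]
  have hsplit : v - w • (n + u') = (z - w) • n + ((v - z • n) - w • u') := by
    rw [smul_add, sub_smul]; abel
  have horth : inner ℂ ((z - w) • n) ((v - z • n) - w • u') = 0 :=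
    (Nᗮ.sub_mem hv'o (Nᗮ.smul_mem w hu')) _ (N.smul_mem _ hn)
  have hpyth := norm_add_sq_eq_norm_sq_add_norm_sq_of_inner_eq_zero _ _ horth
  rw [← hsplit] at hpyth
  have h1 : ‖(z - w) • n‖ ≤ ‖v - w • (n + u')‖ :=
    (mul_self_le_mul_self_iff (norm_nonneg _) (norm_nonneg _)).2
      (by nlinarith [norm_nonneg ((v - z • n) - w • u')])
  have h2 : ‖(v - z • n) - w • u'‖ ≤ ‖v - w • (n + u')‖ :=
    (mul_self_le_mul_self_iff (norm_nonneg _) (norm_nonneg _)).2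
      (by nlinarith [norm_nonneg ((z - w) • n)])
  have h3 : (c - ‖z - w‖) * ‖u'‖ ≤ ‖(v - z • n) - w • u'‖ := by
    have a1 := hlow _ _ hu'g hu'
    have a2 : (v - z • n) - z • u' = ((v - z • n) - w • u') - (z - w) • u' := by
      rw [sub_smul]; abel
    have a3 := norm_sub_le ((v - z • n) - w • u') ((z - w) • u')
    rw [← a2, norm_smul] at a3
    linarith
  rw [norm_smul] at h1
  have h4 : ‖n‖ ≤ ‖z - w‖⁻¹ * ‖v - w • (n + u')‖ := by
    rwa [inv_mul_eq_div, le_div_iff₀ hzw, mul_comm]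
  have h5 : ‖u'‖ ≤ (c - ‖z - w‖)⁻¹ * ‖v - w • (n + u')‖ := by
    rw [inv_mul_eq_div, le_div_iff₀ hcw, mul_comm]
    exact h3.trans h2
  rw [inv_mul_le_iff₀ (by positivity)]
  calc ‖n + u'‖ ≤ ‖n‖ + ‖u'‖ := norm_add_le _ _
    _ ≤ _ := by rw [add_mul]; exact add_le_add h4 h5

/-- An isolated point of `s` imposes no continuity condition, so any value `a` may be prescribed
there. This feeds the continuous functional calculus at an isolated point of the spectrum. -/
lemma continuousOn_ite_of_isolated {s : Set ℂ} {l a : ℂ} {k : ℂ → ℂ}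
    (hs : ∀ᶠ x in 𝓝 l, x ∈ s → x = l) (hk : ∀ x, x ≠ l → ContinuousAt k x) :
    ContinuousOn (fun x => if x = l then a else k x) s := by
  intro x _
  by_cases hx : x = l
  · subst hx
    refine ContinuousWithinAt.congr_of_eventuallyEq (f := fun _ => a) continuousWithinAt_const ?_
      (by simp)
    rw [EventuallyEq, eventually_nhdsWithin_iff]
    filter_upwards [hs] with y hy hys
    simp [hy hys]
  · refine ContinuousAt.continuousWithinAt ((hk x hx).congr ?_)
    filter_upwards [isOpen_ne.mem_nhds hx] with y hy
    rw [if_neg hy]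

/-- At an isolated point `l` of its spectrum, a bounded self-adjoint operator `G` has a spectral
projection `E` onto the eigenspace, and `G - l` is invertible on the range of `1 - E`. -/
lemma exists_spectral_projection {G : H →L[ℂ] H} (hG : IsSelfAdjoint G) {l : ℂ}
    (hl : ∀ᶠ x in 𝓝 l, x ∈ spectrum ℂ G → x = l) :
    ∃ B E : H →L[ℂ] H, (∀ u, G (E u) = l • E u) ∧ ∀ u, B (G u - l • u) + E u = u := by
  have hn : IsStarNormal G := hG.isStarNormal
  -- Near `l` the spectrum contains at most `l`, so the indicator `f` of `{l}` and the function `g`,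
  -- equal to `(x - l)⁻¹` off `l`, are continuous on it. The functional calculus turns `(x - l) f =
  -- 0` and `g (x - l) + f = 1` into the two claims.
  let g : ℂ → ℂ := fun x => if x = l then 0 else (x - l)⁻¹
  let f : ℂ → ℂ := fun x => if x = l then 1 else 0
  have hg : ContinuousOn g (spectrum ℂ G) := continuousOn_ite_of_isolated hl fun x hx =>
    (continuousAt_id.sub continuousAt_const).inv₀ (sub_ne_zero.2 hx)
  have hf : ContinuousOn f (spectrum ℂ G) :=
    continuousOn_ite_of_isolated hl fun x _ => continuousAt_const
  have hid : cfc (fun x : ℂ => x - l) G = G - algebraMap ℂ _ l := by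
    rw [cfc_sub (fun x => x) (fun _ => l) G, cfc_id' ℂ G, cfc_const l G]
  have e1 : (G - algebraMap ℂ _ l) * cfc f G = 0 := by
    rw [← hid, ← cfc_mul (fun x : ℂ => x - l) f G, ← cfc_zero ℂ G]
    refine cfc_congr fun x _ => ?_
    by_cases hx : x = l <;> simp [f, hx]
  have e2 : cfc g G * (G - algebraMap ℂ _ l) + cfc f G = 1 := by
    rw [← hid, ← cfc_mul g (fun x : ℂ => x - l) G,
      ← cfc_add (a := G) (fun x => g x * (x - l)) f (hg.mul (by fun_prop)) hf, ← cfc_one ℂ G]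
    refine cfc_congr fun x _ => ?_
    by_cases hx : x = l
    · simp [f, g, hx]
    · simp [f, g, hx, sub_ne_zero.2 hx]
  refine ⟨cfc g G, cfc f G, fun u => ?_, fun u => ?_⟩
  · have := DFunLike.congr_fun e1 u
    simpa [Algebra.algebraMap_eq_smul_one, sub_eq_zero] using this
  · have := DFunLike.congr_fun e2 u
    simpa [Algebra.algebraMap_eq_smul_one] using this

lemma isSelfAdjoint_of_isBoundedInverse {T : H →ₗ.[ℂ] H} (hT : IsSymmetricOp T) {w : ℂ}
    (hw : starRingEnd ℂ w = w) {G : H →L[ℂ] H} (hG : IsBoundedInverse (shift T w) G) :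
    IsSelfAdjoint G := by
  rw [ContinuousLinearMap.isSelfAdjoint_iff_isSymmetric]
  intro f g
  have h := hT _ _ _ _ (hG.mem_graph f) (hG.mem_graph g)
  simp only [inner_sub_left, inner_sub_right, inner_smul_left, inner_smul_right, hw] at h
  simpa using h.symm

/-- Off the spectrum the resolvent recovers the limit of `u n`. At an isolated point with
finite-dimensional eigenspace, `u n` is the sum of a bounded operator applied to `(T - z) u n`,
which converges, and of its component in the eigenspace, where bounded sequences have convergent
subsequences. This decomposition comes from the functional calculus of the bounded operator `(T - z
- r)⁻¹`. -/
lemma isWeylRegular_of_notMem_essSpectrum {T : H →ₗ.[ℂ] H} (hT : IsSelfAdjoint T) {z : ℂ}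
    (hz : z ∉ essSpectrum T) : IsWeylRegular T z := by
  rintro u v huv ⟨C, hC⟩ ⟨h, hh⟩
  by_cases hzs : z ∈ opSpectrum T
  swap
  · rw [opSpectrum, Set.mem_ofPred_eq, not_not] at hzs
    obtain ⟨R, hR⟩ := hzs
    refine ⟨id, strictMono_id, R h, ?_⟩
    refine ((R.continuous.tendsto h).comp hh).congr fun n => ?_
    have := (isBoundedInverse_shift_iff.1 hR _ _).1 (huv n)
    simpa [sub_eq_add_neg] using this
  have hz2 : ¬ (AccPt z (𝓟 (opSpectrum T)) ∨ ¬ FiniteDimensional ℂ (opEigenspace T z)) :=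
    fun h => hz ⟨hzs, h⟩
  push Not at hz2
  obtain ⟨hacc, hfin⟩ := hz2
  have hzreal : starRingEnd ℂ z = z :=
    Complex.conj_eq_iff_im.2 (im_eq_zero_of_mem_opSpectrum hT hzs)
  have hev : ∀ᶠ x in 𝓝 z, x ≠ z → x ∉ opSpectrum T := by
    rw [accPt_iff_frequently_nhdsNE, not_frequently] at hacc
    exact eventually_nhdsWithin_iff.1 hacc
  obtain ⟨δ, hδ, hball⟩ := Metric.eventually_nhds_iff_ball.1 hev
  -- the resolvent at a nearby real point
  let r : ℂ := ((δ / 2 : ℝ) : ℂ)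
  have hr0 : r ≠ 0 := Complex.ofReal_ne_zero.2 (by positivity)
  have hrr : starRingEnd ℂ r = r := Complex.conj_ofReal _
  have hwρ : z + r ∉ opSpectrum T := by
    refine hball _ ?_ (by simpa using hr0)
    rw [Metric.mem_ball, dist_eq_norm, add_sub_cancel_left, Complex.norm_real,
      Real.norm_of_nonneg (by positivity)]
    linarith
  rw [opSpectrum, Set.mem_ofPred_eq, not_not] at hwρ
  obtain ⟨G, hG⟩ := hwρ
  have hGsa : IsSelfAdjoint G := isSelfAdjoint_of_isBoundedInverse
    (isSymmetricOp_of_isSelfAdjoint hT) (by rw [map_neg, map_add, hzreal, hrr]) hG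
  -- The point `l` is the image of `z` under `x ↦ (x - z - r)⁻¹`. By the spectral mapping, points of
  -- the spectrum of `G` near `l` come from points of the spectrum of `T` near `z`, so `l` is
  -- isolated as well.
  set l : ℂ := (-r)⁻¹ with hl
  have hl0 : l ≠ 0 := inv_ne_zero (neg_ne_zero.2 hr0)
  have hiso : ∀ᶠ x in 𝓝 l, x ∈ spectrum ℂ G → x = l := by
    have hcont : Tendsto (fun x : ℂ => z + r + x⁻¹) (𝓝 l) (𝓝 z) := by
      have : Tendsto (fun x : ℂ => z + r + x⁻¹) (𝓝 l) (𝓝 (z + r + l⁻¹)) :=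
        tendsto_const_nhds.add (tendsto_inv₀ hl0)
      simpa [hl] using this
    filter_upwards [hcont.eventually hev, isOpen_ne.mem_nhds hl0] with x hx hx0 hxs
    by_contra hxl
    have hne : z + r + x⁻¹ ≠ z := by
      intro he
      apply hxl
      have : x⁻¹ = -r := by linear_combination he
      rw [hl, ← this, inv_inv]
    have := hx hne
    rw [opSpectrum, Set.mem_ofPred_eq, not_not] at this
    obtain ⟨G', hG'⟩ := this
    exact notMem_spectrum_of_isBoundedInverse hx0 hG hG' hxs
  obtain ⟨B, E, hE, hB⟩ := exists_spectral_projection hGsa hiso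
  have hEmem : ∀ x, E x ∈ opEigenspace T z := by
    intro x
    rw [mem_opEigenspace, isBoundedInverse_shift_iff.1 hG, ← add_smul, map_smul, hE, smul_smul]
    have : (z + -(z + r)) * l = 1 := by
      rw [hl]; field_simp; ring
    rw [this, one_smul]
  -- With `l⁻¹ = -r` this is `(T - z - r)⁻¹ - l = -l (T - z - r)⁻¹ (T - z)`.
  have hGu : ∀ n, G (u n) - l • u n = (-l) • G (v n - z • u n) := by
    intro n
    have h1 := (isBoundedInverse_shift_iff.1 hG _ _).1 (huv n)
    have h2 : v n + -(z + r) • u n = (v n - z • u n) + (-r) • u n := by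
      simp only [neg_smul, add_smul]; abel
    rw [h2, map_add, map_smul] at h1
    have h3 : l • u n = l • G (v n - z • u n) + G (u n) := by
      conv_lhs => rw [← h1]
      rw [smul_add, smul_smul, hl, inv_mul_cancel₀ (neg_ne_zero.2 hr0), one_smul]
    rw [h3, neg_smul]; abel
  have hproper : ProperSpace (opEigenspace T z) := FiniteDimensional.proper ℂ _
  obtain ⟨y, -, φ, hφ, hy⟩ := tendsto_subseq_of_bounded
    (Metric.isBounded_closedBall (x := (0 : opEigenspace T z)) (r := ‖E‖ * C))
    (x := fun n => ⟨E (u n), hEmem _⟩) (fun n => by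
      rw [mem_closedBall_zero_iff]
      exact (E.le_opNorm _).trans (by gcongr; exact hC n))
  have hy' : Tendsto (fun n => E (u (φ n))) atTop (𝓝 (y : H)) :=
    (continuous_subtype_val.tendsto y).comp hy
  refine ⟨φ, hφ, B ((-l) • G h) + y, ?_⟩
  have h1 : Tendsto (fun n => B ((-l) • G (v (φ n) - z • u (φ n)))) atTop
      (𝓝 (B ((-l) • G h))) := by
    have hc : Continuous fun x => B ((-l) • G x) := by fun_prop
    exact (hc.tendsto h).comp (hh.comp hφ.tendsto_atTop)
  refine (h1.add hy').congr fun n => ?_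
  rw [← hGu, hB, Function.comp_apply]

theorem isWeylRegular_iff_notMem_essSpectrum {T : H →ₗ.[ℂ] H} (hT : IsSelfAdjoint T) {z : ℂ} :
    IsWeylRegular T z ↔ z ∉ essSpectrum T :=
  ⟨fun h => h.notMem_essSpectrum hT, isWeylRegular_of_notMem_essSpectrum hT⟩

end EssentialSpectrum

/-! ### Relatively compact symmetric perturbations -/

section Perturbation

variable {H : Type*} [NormedAddCommGroup H] [InnerProductSpace ℂ H]

lemma mem_graph_add {T V : H →ₗ.[ℂ] H} {u s : H} :
    (u, s) ∈ (T + V).graph ↔ ∃ v w, (u, v) ∈ T.graph ∧ (u, w) ∈ V.graph ∧ s = v + w := by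
  constructor
  · intro h
    obtain ⟨y, rfl, rfl⟩ := (LinearPMap.mem_graph_iff _).1 h
    exact ⟨T ⟨y, y.2.1⟩, V ⟨y, y.2.2⟩, T.mem_graph ⟨y, y.2.1⟩, V.mem_graph ⟨y, y.2.2⟩, rfl⟩
  · rintro ⟨v, w, hv, hw, rfl⟩
    obtain ⟨y, rfl, rfl⟩ := (LinearPMap.mem_graph_iff _).1 hv
    obtain ⟨y', hy', rfl⟩ := (LinearPMap.mem_graph_iff _).1 hw
    simp only at hy'
    have hmem : (y : H) ∈ (T + V).domain := ⟨y.2, hy' ▸ y'.2⟩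
    refine (LinearPMap.mem_graph_iff _).2 ⟨⟨y, hmem⟩, rfl, ?_⟩
    rw [LinearPMap.add_apply]
    congr 2
    exact Subtype.ext hy'.symm

lemma IsSymmetricOp.add {T V : H →ₗ.[ℂ] H} (hT : IsSymmetricOp T) (hV : IsSymmetricOp V) :
    IsSymmetricOp (T + V) := by
  intro u s u' s' h h'
  obtain ⟨v, w, hv, hw, rfl⟩ := mem_graph_add.1 h
  obtain ⟨v', w', hv', hw', rfl⟩ := mem_graph_add.1 h'
  rw [inner_add_left, inner_add_right, hT _ _ _ _ hv hv', hV _ _ _ _ hw hw']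

/-- `V` is `T`-compact, with `K = V (T - w)⁻¹`. -/
def IsRelativelyCompact (T V : H →ₗ.[ℂ] H) (w : ℂ) (K : H →L[ℂ] H) : Prop :=
  IsCompactOperator K ∧ ∀ u v, (u, v) ∈ T.graph → (u, K (v - w • u)) ∈ V.graph

/-- Since `(T - w) G = 1 + (w' - w) G`, one has `V G = K (1 + (w' - w) G)`. Thus compactness at one
base point passes to every point of the resolvent set. -/
lemma IsRelativelyCompact.change_point {T V : H →ₗ.[ℂ] H} {w w' : ℂ} {K G : H →L[ℂ] H}
    (h : IsRelativelyCompact T V w K) (hG : IsBoundedInverse (shift T (-w')) G) :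
    IsRelativelyCompact T V w' (K.comp (ContinuousLinearMap.id ℂ H + (w' - w) • G)) := by
  refine ⟨h.1.comp_clm _, fun u v huv => ?_⟩
  have h1 := (isBoundedInverse_shift_iff.1 hG _ _).1 huv
  have h2 : v - w • u = (v - w' • u) + (w' - w) • G (v - w' • u) := by
    rw [sub_eq_add_neg v (w' • u), ← neg_smul, h1, sub_smul, neg_smul]; abel
  have h3 := h.2 u v huv
  rw [h2] at h3
  exact h3

lemma IsRelativelyCompact.add_graph {T V : H →ₗ.[ℂ] H} {w : ℂ} {K : H →L[ℂ] H}
    (h : IsRelativelyCompact T V w K) {u v : H} (huv : (u, v) ∈ T.graph) :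
    (u, v + K (v - w • u)) ∈ (T + V).graph :=
  mem_graph_add.2 ⟨v, _, huv, h.2 _ _ huv, rfl⟩

lemma IsRelativelyCompact.exists_of_mem_add_graph {T V : H →ₗ.[ℂ] H} {w : ℂ} {K : H →L[ℂ] H}
    (h : IsRelativelyCompact T V w K) {u s : H} (hus : (u, s) ∈ (T + V).graph) :
    ∃ v, (u, v) ∈ T.graph ∧ s = v + K (v - w • u) := by
  obtain ⟨v, x, hv, hx, rfl⟩ := mem_graph_add.1 hus
  exact ⟨v, hv, by rw [LinearPMap.mem_graph_snd_inj V (h.2 _ _ hv) hx rfl]⟩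

lemma IsRelativelyCompact.domain_add {T V : H →ₗ.[ℂ] H} {w : ℂ} {K : H →L[ℂ] H}
    (h : IsRelativelyCompact T V w K) : (T + V).domain = T.domain := by
  refine le_antisymm (fun x hx => hx.1) fun x hx => ⟨hx, ?_⟩
  obtain ⟨y, hy, -⟩ := (LinearPMap.mem_graph_iff _).1 (h.2 _ _ (T.mem_graph ⟨x, hx⟩))
  simp only at hy
  exact hy ▸ y.2

/-- The Cauchy-Schwarz inequality for the form `⟨f, R g⟩` of a nonnegative symmetric operator. -/
lemma norm_inner_sq_le_of_nonneg {R : H →L[ℂ] H} (hR : ∀ f g, inner ℂ (R f) g = inner ℂ f (R g))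
    (hpos : ∀ f, 0 ≤ (inner ℂ f (R f) : ℂ).re) (f g : H) :
    ‖(inner ℂ f (R g) : ℂ)‖ ^ 2 ≤ (inner ℂ f (R f) : ℂ).re * (inner ℂ g (R g) : ℂ).re := by
  let c : PreInnerProductSpace.Core ℂ H :=
    { inner := fun f g => inner ℂ f (R g)
      conj_inner_symm := fun f g => by rw [inner_conj_symm, hR]
      re_inner_nonneg := fun f => hpos f
      add_left := fun f g h => inner_add_left _ _ _
      smul_left := fun f g r => inner_smul_left _ _ _ }
  have h := @InnerProductSpace.Core.inner_mul_inner_self_le ℂ H _ _ _ c f g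
  have h2 : ‖(inner ℂ g (R f) : ℂ)‖ = ‖(inner ℂ f (R g) : ℂ)‖ := by
    rw [← inner_conj_symm, RCLike.norm_conj, hR]
  rw [sq]
  calc _ = ‖(inner ℂ f (R g) : ℂ)‖ * ‖(inner ℂ g (R f) : ℂ)‖ := by rw [h2]
    _ ≤ _ := h

/-- An operator that is symmetric with respect to a nonnegative form is bounded in the form norm
by its operator norm. -/
lemma form_apply_le_of_symmetric {R N : H →L[ℂ] H}
    (hR : ∀ f g, inner ℂ (R f) g = inner ℂ f (R g))
    (hpos : ∀ f, 0 ≤ (inner ℂ f (R f) : ℂ).re)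
    (hN : ∀ f g, inner ℂ (N f) (R g) = inner ℂ f (R (N g))) {b : ℝ} (hb : 0 < b)
    (hNb : ∀ f, ‖N f‖ ≤ b * ‖f‖) (f : H) :
    (inner ℂ (N f) (R (N f)) : ℂ).re ≤ b ^ 2 * (inner ℂ f (R f) : ℂ).re := by
  -- `q n` is the squared form norm of `N ^ n f`. By Cauchy-Schwarz for the form and the symmetry of
  -- `N` it is log-convex, so `q 1 > b² q 0` would force growth at least like `(q 1 / q 0) ^ n`. The
  -- operator norm of `N` only allows growth like `(b ^ 2) ^ n`.
  let q : ℕ → ℝ := fun n => (inner ℂ ((N ^ n) f) (R ((N ^ n) f)) : ℂ).re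
  have hq0 : ∀ n, 0 ≤ q n := fun n => hpos _
  have hsucc : ∀ n, (N ^ (n + 1)) f = N ((N ^ n) f) := fun n => by rw [pow_succ']; rfl
  have hlog : ∀ n, q (n + 1) ^ 2 ≤ q n * q (n + 2) := by
    intro n
    have h1 : q (n + 1) = (inner ℂ ((N ^ n) f) (R ((N ^ (n + 2)) f)) : ℂ).re := by
      simp only [q]
      rw [hsucc (n + 1), ← hN, ← hsucc n]
    rw [h1]
    refine le_trans ?_ (norm_inner_sq_le_of_nonneg hR hpos _ _)
    exact sq_le_sq.2 (by rw [abs_norm]; exact Complex.abs_re_le_norm _)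
  have hnorm : ∀ n, ‖(N ^ n) f‖ ≤ b ^ n * ‖f‖ := by
    intro n
    induction n with
    | zero => simp
    | succ n ih =>
      rw [hsucc, pow_succ']
      calc _ ≤ b * ‖(N ^ n) f‖ := hNb _
        _ ≤ b * (b ^ n * ‖f‖) := by gcongr
        _ = _ := by ring
  have hupper : ∀ n, q n ≤ (b ^ 2) ^ n * (‖R‖ * ‖f‖ ^ 2) := by
    intro n
    calc q n ≤ ‖(inner ℂ ((N ^ n) f) (R ((N ^ n) f)) : ℂ)‖ := Complex.re_le_norm _
      _ ≤ ‖(N ^ n) f‖ * (‖R‖ * ‖(N ^ n) f‖) :=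
        (norm_inner_le_norm _ _).trans (by gcongr; exact R.le_opNorm _)
      _ ≤ (b ^ n * ‖f‖) * (‖R‖ * (b ^ n * ‖f‖)) := by gcongr <;> exact hnorm n
      _ = _ := by ring
  have h01 : q 0 = (inner ℂ f (R f) : ℂ).re := by simp [q]
  have h11 : q 1 = (inner ℂ (N f) (R (N f)) : ℂ).re := by simp [q]
  rw [← h01, ← h11]
  by_contra hcon
  push Not at hcon
  have hq00 : 0 < q 0 := by
    rcases (hq0 0).eq_or_lt with h | h
    · have := hlog 0
      rw [← h, zero_mul] at this
      have h1 : q 1 = 0 := pow_eq_zero_iff two_ne_zero |>.1 (le_antisymm this (sq_nonneg _))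
      rw [h1, ← h, mul_zero] at hcon
      exact absurd hcon (lt_irrefl _)
    · exact h
  set r := q 1 / q 0 with hr
  have hrb : b ^ 2 < r := by rwa [hr, lt_div_iff₀ hq00]
  have hr0 : 0 < r := lt_trans (by positivity) hrb
  have hstep : ∀ n, 0 < q n ∧ r * q n ≤ q (n + 1) := by
    intro n
    induction n with
    | zero => exact ⟨hq00, by rw [hr, div_mul_cancel₀ _ hq00.ne']⟩
    | succ n ih =>
      have hp : 0 < q (n + 1) := lt_of_lt_of_le (mul_pos hr0 ih.1) ih.2
      refine ⟨hp, ?_⟩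
      have h1 := hlog n
      have h2 : q n * (r * q (n + 1)) ≤ q n * q (n + 2) := by nlinarith [ih.2]
      exact le_of_mul_le_mul_left h2 ih.1
  have hlower : ∀ n, r ^ n * q 0 ≤ q n := by
    intro n
    induction n with
    | zero => simp
    | succ n ih =>
      calc r ^ (n + 1) * q 0 = r * (r ^ n * q 0) := by ring
        _ ≤ r * q n := by gcongr
        _ ≤ _ := (hstep n).2
  have hratio : 1 < r / b ^ 2 := by rwa [one_lt_div (by positivity)]
  obtain ⟨n, hn⟩ := pow_unbounded_of_one_lt (‖R‖ * ‖f‖ ^ 2 / q 0) hratio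
  have h1 := (hlower n).trans (hupper n)
  rw [div_pow, lt_div_iff₀ (by positivity), div_mul_eq_mul_div, div_lt_iff₀ hq00] at hn
  linarith

lemma BoundedBelowBy.re_inner_ge {T : H →ₗ.[ℂ] H} {c : ℝ} (h : BoundedBelowBy T c) {u v : H}
    (huv : (u, v) ∈ T.graph) : c * ‖u‖ ^ 2 ≤ (inner ℂ u v : ℂ).re := by
  obtain ⟨y, rfl, rfl⟩ := (LinearPMap.mem_graph_iff _).1 huv
  exact h y

variable [CompleteSpace H]

/-- By the Fredholm alternative `1 + K` is invertible unless `-1` is an eigenvalue of `K`. If `K f =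
-f`, then `(T + V - w) G f = (1 + K) f = 0`; a symmetric operator has no nonreal eigenvalues, so `G
f = 0` and `f = 0`. -/
lemma IsRelativelyCompact.exists_inverse {T V : H →ₗ.[ℂ] H} {w : ℂ} {K : H →L[ℂ] H}
    (h : IsRelativelyCompact T V w K) (hs : IsSymmetricOp (T + V)) (hw : w.im ≠ 0)
    {G : H →L[ℂ] H} (hG : IsBoundedInverse (shift T (-w)) G) :
    ∃ M : H →L[ℂ] H, (∀ f, M f + K (M f) = f) ∧ ∀ f, M (f + K f) = f := by
  have hne : ¬ Module.End.HasEigenvalue (K : Module.End ℂ H) (-1 : ℂ) := by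
    intro he
    obtain ⟨f, hf⟩ := he.exists_hasEigenvector
    have hKf : K f = -f := by simpa using hf.apply_eq_smul
    have hg := hG.mem_graph f
    have h1 := h.add_graph hg
    have e1 : f - -w • G f - w • G f = f := by rw [neg_smul]; abel
    rw [e1, hKf] at h1
    have h2 := hs.abs_im_mul_norm_le h1 w
    have e2 : f - -w • G f + -f - w • G f = 0 := by rw [neg_smul]; abel
    rw [e2, norm_zero] at h2
    have h3 : G f = 0 := by
      have : ‖G f‖ ≤ 0 := by
        by_contra hh
        push Not at hh
        nlinarith [mul_pos (abs_pos.2 hw) hh]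
      exact norm_le_zero_iff.1 this
    rw [h3, smul_zero, sub_zero] at hg
    exact hf.2 (LinearPMap.graph_fst_eq_zero_snd T hg rfl)
  have hres := (h.1.hasEigenvalue_or_mem_resolventSet (neg_ne_zero.2 one_ne_zero)).resolve_left hne
  rw [spectrum.mem_resolventSet_iff] at hres
  obtain ⟨U, hU⟩ := hres
  have hUf : ∀ f, U.1 f = -(f + K f) := fun f => by
    rw [hU, Algebra.algebraMap_eq_smul_one]
    change (-1 : ℂ) • f - K f = _
    rw [neg_smul, one_smul]; abel
  refine ⟨-U.2, fun f => ?_, fun f => ?_⟩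
  · have h1 : U.1 (U.2 f) = f := DFunLike.congr_fun U.3 f
    rw [hUf] at h1
    change -(U.2 f) + K (-(U.2 f)) = f
    rw [map_neg, ← neg_add, h1]
  · have h1 : U.2 (U.1 f) = f := DFunLike.congr_fun U.4 f
    rw [hUf, map_neg] at h1
    exact h1

/-- For nonreal `w'`, `(T + V - w') (T - w')⁻¹ = 1 + K'` with `K'` compact, and `1 + K'` is onto by
the preceding lemma. The range criterion is then applied at `i` and `-i`. -/
lemma IsRelativelyCompact.isSelfAdjoint_add {T V : H →ₗ.[ℂ] H} {w : ℂ} {K : H →L[ℂ] H}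
    (h : IsRelativelyCompact T V w K) (hT : IsSelfAdjoint T) (hV : IsSymmetricOp V) :
    IsSelfAdjoint (T + V) := by
  have hs : IsSymmetricOp (T + V) := (isSymmetricOp_of_isSelfAdjoint hT).add hV
  have key : ∀ w' : ℂ, w'.im ≠ 0 → ∀ f, ∃ u v, (u, v) ∈ (T + V).graph ∧ v - w' • u = f := by
    intro w' hw' f
    obtain ⟨G, hG⟩ := exists_isBoundedInverse_of_im_ne_zero hT hw'
    have h' := h.change_point hG
    obtain ⟨M, hM, -⟩ := h'.exists_inverse hs hw' hG
    refine ⟨_, _, h'.add_graph (hG.mem_graph (M f)), ?_⟩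
    have e1 : M f - -w' • G (M f) - w' • G (M f) = M f := by rw [neg_smul]; abel
    rw [e1]
    calc _ = M f + K.comp (ContinuousLinearMap.id ℂ H + (w' - w) • G) (M f) := by
          rw [neg_smul]; abel
      _ = f := hM f
  refine isSelfAdjoint_of_range ?_ hs Complex.I (key _ (by simp)) (key _ (by simp))
  rw [h.domain_add]
  exact hT.dense_domain

/-- Weyl's theorem. -/
theorem IsRelativelyCompact.essSpectrum_add {T V : H →ₗ.[ℂ] H} {w : ℂ} {K : H →L[ℂ] H}
    (h : IsRelativelyCompact T V w K) (hT : IsSelfAdjoint T) (hV : IsSymmetricOp V) :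
    essSpectrum (T + V) = essSpectrum T := by
  have hs : IsSymmetricOp (T + V) := (isSymmetricOp_of_isSelfAdjoint hT).add hV
  have hI : Complex.I.im ≠ 0 := by simp
  obtain ⟨G, hG⟩ := exists_isBoundedInverse_of_im_ne_zero hT hI
  have h' := h.change_point hG
  set L := K.comp (ContinuousLinearMap.id ℂ H + (Complex.I - w) • G)
  obtain ⟨M, -, hM⟩ := h'.exists_inverse hs hI hG
  ext z
  rw [← not_iff_not, ← isWeylRegular_iff_notMem_essSpectrum hT,
    ← isWeylRegular_iff_notMem_essSpectrum (h.isSelfAdjoint_add hT hV)]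
  constructor
  · exact IsWeylRegular.of_relatively_compact h'.1 fun u v huv => h'.add_graph huv
  -- The perturbation is undone by another compact one: from `(T + V - i) u = (1 + L) (T - i) u` and
  -- `M = (1 + L)⁻¹` it follows that `T = (T + V) - L M (T + V - i)`.
  · refine IsWeylRegular.of_relatively_compact (w := Complex.I) (K := -(L.comp M))
      ((h'.1.comp_clm M).neg) fun u s hus => ?_
    obtain ⟨v, hv, rfl⟩ := h'.exists_of_mem_add_graph hus
    have e : v + L (v - Complex.I • u) - Complex.I • u =
        (v - Complex.I • u) + L (v - Complex.I • u) := by abel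
    have e2 : (-(L.comp M)) (v + L (v - Complex.I • u) - Complex.I • u) =
        -L (v - Complex.I • u) := by
      rw [e]
      change -(L (M _)) = _
      rw [hM]
    rw [e2, add_neg_cancel_right]
    exact hv

/-- Composing a compact operator with self-adjoint operators that tend to `0` strongly gives
operators that tend to `0` in norm. -/
lemma exists_norm_comp_le {K : H →L[ℂ] H} (hK : IsCompactOperator K) {S : ℕ → H →L[ℂ] H}
    (hS : ∀ n, IsSelfAdjoint (S n)) {C : ℝ} (hSC : ∀ n, ‖S n‖ ≤ C)
    (hlim : ∀ f, Tendsto (fun n => S n f) atTop (𝓝 0)) {ε : ℝ} (hε : 0 < ε) :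
    ∃ N, ∀ n ≥ N, ‖K.comp (S n)‖ ≤ ε := by
  have hC0 : 0 ≤ C := (norm_nonneg _).trans (hSC 0)
  set A := ContinuousLinearMap.adjoint K with hA
  set δ : ℝ := ε / (2 * (C + 1)) with hδ
  have hδ0 : 0 < δ := by positivity
  -- The norm of `K S n` is that of its adjoint `S n A`. Total boundedness of the image of the unit
  -- ball under `K A` suffices to control `A`, since `‖A y‖² = ⟨y, K A y⟩`: for differences `y` of
  -- vectors of the unit ball, `‖K A y‖ < δ² / 2` gives `‖A y‖ ≤ δ`. The choice of `δ` makes `C δ ≤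
  -- ε / 2`.
  have hcomp : IsCompact (closure ((K.comp A : H →L[ℂ] H) '' Metric.closedBall 0 1)) :=
    IsCompactOperator.isCompact_closure_image_closedBall (f := ((K.comp A : H →L[ℂ] H) : H →ₗ[ℂ] H))
      (hK.comp_clm A) 1
  have htb := hcomp.totallyBounded.subset subset_closure
  obtain ⟨t, hts, htf, htc⟩ := Metric.finite_approx_of_totallyBounded htb (δ ^ 2 / 2)
    (by positivity)
  have hS' : ∀ᶠ n in atTop, ∀ y ∈ t, ∃ x, ‖x‖ ≤ 1 ∧ K (A x) = y ∧ ‖S n (A x)‖ ≤ ε / 2 := by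
    rw [htf.eventually_all]
    intro y hy
    obtain ⟨x, hx, rfl⟩ := hts hy
    have h1 := (hlim (A x)).norm
    rw [norm_zero] at h1
    filter_upwards [h1.eventually (ge_mem_nhds (show (0 : ℝ) < ε / 2 by positivity))] with n hn
    exact ⟨x, by simpa using hx, rfl, hn⟩
  obtain ⟨N, hN⟩ := eventually_atTop.1 hS'
  refine ⟨N, fun n hn => ?_⟩
  have hadj : K.comp (S n) = ContinuousLinearMap.adjoint ((S n).comp A) := by
    rw [ContinuousLinearMap.adjoint_comp, hA, ContinuousLinearMap.adjoint_adjoint]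
    congr 1
    exact (ContinuousLinearMap.isSelfAdjoint_iff'.1 (hS n)).symm
  rw [hadj, LinearIsometryEquiv.norm_map]
  refine ContinuousLinearMap.opNorm_le_of_unit_norm hε.le fun x hx => ?_
  have hxs : K (A x) ∈ (K.comp A : H →L[ℂ] H) '' Metric.closedBall 0 1 :=
    ⟨x, by simp [hx], rfl⟩
  obtain ⟨y, hy, hxy⟩ := Set.mem_iUnion₂.1 (htc hxs)
  obtain ⟨x', hx', rfl, hsmall⟩ := hN n hn y hy
  rw [Metric.mem_ball, dist_eq_norm, ← map_sub, ← map_sub] at hxy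
  have h1 : ‖A (x - x')‖ ≤ δ := by
    refine (sq_le_sq₀ (norm_nonneg _) hδ0.le).1 ?_
    have e : ‖A (x - x')‖ ^ 2 = (inner ℂ (x - x') (K (A (x - x'))) : ℂ).re := by
      have := ContinuousLinearMap.adjoint_inner_left K (A (x - x')) (x - x')
      rw [← this, ← hA, ← inner_self_eq_norm_sq (𝕜 := ℂ)]
      rfl
    rw [e]
    calc _ ≤ ‖(inner ℂ (x - x') (K (A (x - x'))) : ℂ)‖ := Complex.re_le_norm _
      _ ≤ ‖x - x'‖ * ‖K (A (x - x'))‖ := norm_inner_le_norm _ _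
      _ ≤ 2 * (δ ^ 2 / 2) := by
        gcongr
        calc ‖x - x'‖ ≤ ‖x‖ + ‖x'‖ := norm_sub_le _ _
          _ ≤ 2 := by rw [hx]; linarith
      _ = δ ^ 2 := by ring
  have e : (S n).comp A x = S n (A (x - x')) + S n (A x') := by
    rw [← map_add, ← map_add, sub_add_cancel]; rfl
  rw [e]
  calc _ ≤ ‖S n (A (x - x'))‖ + ‖S n (A x')‖ := norm_add_le _ _
    _ ≤ C * δ + ε / 2 := by
      gcongr
      exact (ContinuousLinearMap.le_opNorm _ _).trans (by gcongr; exact hSC n)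
    _ ≤ (C + 1) * δ + ε / 2 := by gcongr; linarith
    _ = ε := by rw [hδ]; field_simp; ring

/-- A relatively compact symmetric perturbation of a nonnegative operator is semibounded. -/
theorem IsRelativelyCompact.exists_boundedBelowBy {T V : H →ₗ.[ℂ] H} {w : ℂ} {K : H →L[ℂ] H}
    (h : IsRelativelyCompact T V w K) (hT : IsSelfAdjoint T) (h0 : BoundedBelowBy T 0)
    (hV : IsSymmetricOp V) : ∃ c : ℝ, BoundedBelowBy (T + V) c := by
  have hsT := isSymmetricOp_of_isSelfAdjoint hT
  choose R hR hRn using fun n : ℕ =>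
    exists_isBoundedInverse_of_nonneg hT h0 (a := (n : ℝ) + 1) (by positivity)
  let a : ℕ → ℂ := fun n => (((n : ℝ) + 1 : ℝ) : ℂ)
  have hR' : ∀ n, IsBoundedInverse (shift T (-(-a n))) (R n) := fun n => by
    rw [neg_neg]; exact hR n
  -- move the base point to `-1`
  obtain ⟨K, h⟩ : ∃ K, IsRelativelyCompact T V (-a 0) K := ⟨_, h.change_point (hR' 0)⟩
  -- `S n = 1 - n (T + n + 1)⁻¹ = (T + 1) (T + n + 1)⁻¹` tends to `0` strongly. As `K` is compact,
  -- `V (T + n + 1)⁻¹ = K S n` tends to `0` in norm.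
  let S : ℕ → H →L[ℂ] H := fun n => ContinuousLinearMap.id ℂ H + (-a n - -a 0) • R n
  have hh : ∀ n, IsRelativelyCompact T V (-a n) (K.comp (S n)) := fun n => h.change_point (hR' n)
  have han : ∀ n, -a n - -a 0 = ((-(n : ℝ) : ℝ) : ℂ) := fun n => by
    simp only [a]; push_cast; ring
  have hSf : ∀ n f, S n f = f + ((-(n : ℝ) : ℝ) : ℂ) • R n f := fun n f => by
    rw [← han]; rfl
  have hRsa : ∀ n, IsSelfAdjoint (R n) := fun n =>
    isSelfAdjoint_of_isBoundedInverse hsT (Complex.conj_ofReal _) (hR n)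
  have hRsymm : ∀ n f g, inner ℂ (R n f) g = inner ℂ f (R n g) := fun n f g =>
    (ContinuousLinearMap.isSelfAdjoint_iff_isSymmetric.1 (hRsa n)) f g
  have hSsa : ∀ n, IsSelfAdjoint (S n) := by
    intro n
    rw [ContinuousLinearMap.isSelfAdjoint_iff_isSymmetric]
    intro f g
    change inner ℂ (S n f) g = inner ℂ f (S n g)
    rw [hSf, hSf, inner_add_left, inner_add_right, inner_smul_left, inner_smul_right, hRsymm,
      Complex.conj_ofReal]
  have hnR : ∀ (n : ℕ) f, ‖((-(n : ℝ) : ℝ) : ℂ) • R n f‖ ≤ ‖f‖ := by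
    intro n f
    rw [norm_smul, Complex.norm_real, norm_neg, Real.norm_of_nonneg (by positivity)]
    calc (n : ℝ) * ‖R n f‖ ≤ n * (((n : ℝ) + 1)⁻¹ * ‖f‖) := by gcongr; exact hRn n f
      _ = (n * ((n : ℝ) + 1)⁻¹) * ‖f‖ := by ring
      _ ≤ 1 * ‖f‖ := by
        gcongr
        rw [← div_eq_mul_inv, div_le_one (by positivity)]; linarith
      _ = _ := one_mul _
  have hSn : ∀ n, ‖S n‖ ≤ 2 := by
    intro n
    refine ContinuousLinearMap.opNorm_le_bound _ zero_le_two fun f => ?_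
    rw [hSf]
    calc _ ≤ ‖f‖ + ‖f‖ := (norm_add_le _ _).trans (by gcongr; exact hnR n f)
      _ = _ := by ring
  have hSdom : ∀ u v, (u, v) ∈ T.graph → Tendsto (fun n => S n u) atTop (𝓝 0) := by
    intro u v huv
    refine squeeze_zero_norm (a := fun n : ℕ => 1 / ((n : ℝ) + 1) * ‖v + u‖) (fun n => ?_) ?_
    · have h1 := (isBoundedInverse_shift_iff.1 (hR n) _ _).1 huv
      have h2 : S n u = R n (v + u) := by
        rw [hSf]
        nth_rewrite 1 [← h1]
        rw [← map_smul, ← map_add]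
        congr 1
        rw [add_assoc, ← add_smul]
        congr 1
        conv_rhs => rw [← one_smul ℂ u]
        congr 1
        push_cast; ring
      rw [h2, one_div]
      exact hRn n _
    · simpa using tendsto_one_div_add_atTop_nhds_zero_nat.mul_const ‖v + u‖
  have hSlim : ∀ f, Tendsto (fun n => S n f) atTop (𝓝 0) := by
    intro f
    rw [Metric.tendsto_atTop]
    intro ε hε
    obtain ⟨u, hu, hfu⟩ := Metric.dense_iff.1 hT.dense_domain f (ε / 4) (by positivity)
    rw [Metric.mem_ball, dist_comm, dist_eq_norm] at hu
    obtain ⟨N, hN⟩ := Metric.tendsto_atTop.1 (hSdom u _ (T.mem_graph ⟨u, hfu⟩)) (ε / 2)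
      (by positivity)
    refine ⟨N, fun n hn => ?_⟩
    have h1 := hN n hn
    rw [dist_zero_right] at h1 ⊢
    have e : S n f = S n (f - u) + S n u := by rw [← map_add, sub_add_cancel]
    have h2 : ‖S n (f - u)‖ ≤ 2 * ‖f - u‖ :=
      ((S n).le_opNorm _).trans (by gcongr; exact hSn n)
    rw [e]
    calc _ ≤ ‖S n (f - u)‖ + ‖S n u‖ := norm_add_le _ _
      _ < ε := by linarith
  obtain ⟨n, hn⟩ := exists_norm_comp_le h.1 hSsa hSn hSlim (ε := 1 / 2) (by norm_num)
  have hn := hn n le_rfl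
  set N := K.comp (S n) with hNdef
  have hVR : ∀ f, (R n f, N f) ∈ V.graph := by
    intro f
    have h1 := (hh n).2 _ _ ((hR n).mem_graph f)
    have e : f - (((n : ℝ) + 1 : ℝ) : ℂ) • R n f - -a n • R n f = f := by
      simp only [a, neg_smul]; abel
    rwa [e] at h1
  have hpos : ∀ f, 0 ≤ (inner ℂ f (R n f) : ℂ).re := by
    intro f
    have h1 := h0.re_inner_ge ((hR n).mem_graph f)
    rw [inner_sub_right, inner_smul_right, zero_mul, Complex.sub_re, Complex.re_ofReal_mul] at h1
    have h2 : (0 : ℝ) ≤ (inner ℂ (R n f) (R n f) : ℂ).re := inner_self_nonneg (𝕜 := ℂ)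
    rw [← hRsymm]
    have : 0 ≤ ((n : ℝ) + 1) * (inner ℂ (R n f) (R n f) : ℂ).re := by positivity
    linarith
  -- Symmetry of `V` makes `N = V R n` symmetric for the nonnegative form `⟨f, R n g⟩`, so its norm
  -- bound `1 / 2` is also a bound in the form norm.
  have hNsymm : ∀ f g, inner ℂ (N f) (R n g) = inner ℂ f (R n (N g)) := fun f g => by
    rw [hV _ _ _ _ (hVR f) (hVR g), hRsymm]
  have hform := form_apply_le_of_symmetric (hRsymm n) hpos hNsymm (b := 1 / 2) (by norm_num)
    (fun f => (N.le_opNorm f).trans (by gcongr))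
  -- With `f = (T + n + 1) u` the form bound reads `|Re ⟨u, V u⟩| ≤ (⟨u, T u⟩ + (n + 1) ‖u‖²) / 2`.
  -- Together with `T ≥ 0` this leaves the lower bound `-(n + 1) / 2`.
  refine ⟨-(((n : ℝ) + 1) / 2), fun y => ?_⟩
  obtain ⟨v, x, hv, hx, hsum⟩ := mem_graph_add.1 ((T + V).mem_graph y)
  rw [hsum]
  set u : H := (y : H) with hu
  set f : H := v + (((n : ℝ) + 1 : ℝ) : ℂ) • u with hf
  have hRf : R n f = u := (isBoundedInverse_shift_iff.1 (hR n) _ _).1 hv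
  have hxN : x = N f := LinearPMap.mem_graph_snd_inj V hx (hVR f) hRf.symm
  have hq : (inner ℂ f (R n f) : ℂ).re = (inner ℂ u v : ℂ).re + ((n : ℝ) + 1) * ‖u‖ ^ 2 := by
    have e1 : (inner ℂ u u : ℂ).re = ‖u‖ ^ 2 := inner_self_eq_norm_sq (𝕜 := ℂ) u
    rw [← hRsymm, hRf, hf, inner_add_right, inner_smul_right, Complex.add_re,
      Complex.re_ofReal_mul, e1]
  have huv := h0.re_inner_ge hv
  rw [zero_mul] at huv
  set q := (inner ℂ f (R n f) : ℂ).re with hqdef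
  have hcs : |(inner ℂ u x : ℂ).re| ≤ q / 2 := by
    have e1 : (inner ℂ u x : ℂ) = inner ℂ f (R n (N f)) := by rw [hxN, ← hRf, hRsymm]
    have h1 := norm_inner_sq_le_of_nonneg (hRsymm n) hpos f (N f)
    have h2 : ‖(inner ℂ f (R n (N f)) : ℂ)‖ ^ 2 ≤ (q / 2) ^ 2 := by
      calc _ ≤ q * ((1 / 2) ^ 2 * q) := h1.trans (by gcongr; exacts [hpos f, hform f])
        _ = _ := by ring
    rw [e1]
    exact (Complex.abs_re_le_norm _).trans
      ((sq_le_sq₀ (norm_nonneg _) (div_nonneg (hpos f) zero_le_two)).1 h2)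
  rw [inner_add_right, Complex.add_re]
  have := (abs_le.1 hcs).1
  rw [hq] at this
  linarith

end Perturbation

/-! ### Contraction semigroups and their Laplace transforms -/

section Semigroups

variable {H : Type*} [NormedAddCommGroup H] [InnerProductSpace ℂ H]

/-- The Laplace transform `∫₀^∞ e^{-at} S_t f dt`. -/
def laplace (S : ℝ → H →L[ℂ] H) (a : ℝ) (f : H) : H :=
  ∫ t in Set.Ioi (0 : ℝ), Real.exp (-a * t) • S t f

lemma IsSemigroupOf.norm_apply_le {T : H →ₗ.[ℂ] H} {S : ℝ → H →L[ℂ] H} (hS : IsSemigroupOf T S)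
    {t : ℝ} (ht : 0 ≤ t) (f : H) : ‖S t f‖ ≤ ‖f‖ :=
  ((S t).le_opNorm f).trans (mul_le_of_le_one_left (norm_nonneg _) (hS.norm_le t ht))

lemma IsSemigroupOf.continuousOn_exp_smul {T : H →ₗ.[ℂ] H} {S : ℝ → H →L[ℂ] H}
    (hS : IsSemigroupOf T S) (a : ℝ) (f : H) :
    ContinuousOn (fun t : ℝ => Real.exp (-a * t) • S t f) (Set.Ici 0) := by
  have h : ContinuousOn (fun t : ℝ => Real.exp (-a * t)) (Set.Ici 0) := by fun_prop
  exact h.smul (hS.continuousOn f)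

lemma IsSemigroupOf.integrableOn {T : H →ₗ.[ℂ] H} {S : ℝ → H →L[ℂ] H} (hS : IsSemigroupOf T S)
    {a : ℝ} (ha : 0 < a) (f : H) :
    IntegrableOn (fun t : ℝ => Real.exp (-a * t) • S t f) (Set.Ioi 0) := by
  refine Integrable.mono' ((exp_neg_integrableOn_Ioi 0 ha).mul_const ‖f‖)
    (((hS.continuousOn_exp_smul a f).mono Set.Ioi_subset_Ici_self).aestronglyMeasurable
      measurableSet_Ioi) ?_
  filter_upwards [ae_restrict_mem measurableSet_Ioi] with t ht
  rw [norm_smul, Real.norm_of_nonneg (Real.exp_nonneg _)]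
  gcongr
  exact hS.norm_apply_le (le_of_lt ht) f

lemma IsSemigroupOf.intervalIntegrable {T : H →ₗ.[ℂ] H} {S : ℝ → H →L[ℂ] H}
    (hS : IsSemigroupOf T S) (a : ℝ) (f : H) {b : ℝ} (hb : 0 ≤ b) :
    IntervalIntegrable (fun t : ℝ => Real.exp (-a * t) • S t f) volume 0 b := by
  refine ContinuousOn.intervalIntegrable ((hS.continuousOn_exp_smul a f).mono ?_)
  rw [Set.uIcc_of_le hb]
  exact Set.Icc_subset_Ici_self

lemma IsSemigroupOf.mem_graph_iff {T : H →ₗ.[ℂ] H} {S : ℝ → H →L[ℂ] H} (hS : IsSemigroupOf T S)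
    {u v : H} : (u, v) ∈ T.graph ↔
      Tendsto (fun t : ℝ => t⁻¹ • (u - S t u)) (𝓝[>] 0) (𝓝 v) := by
  rw [← hS.negGenerator_eq, mem_graph_negGenerator]
  refine tendsto_congr fun t => ?_
  rw [← Complex.ofReal_inv, Complex.coe_smul]

/-- The semigroup law reduces the derivative at `t` to the one at `0`. Right derivatives are enough
for the fundamental theorem of calculus used below. -/
lemma IsSemigroupOf.hasDerivWithinAt {T : H →ₗ.[ℂ] H} {S : ℝ → H →L[ℂ] H}
    (hS : IsSemigroupOf T S) {u v : H} (huv : (u, v) ∈ T.graph) {t : ℝ} (ht : 0 ≤ t) :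
    HasDerivWithinAt (fun s => S s u) (-S t v) (Set.Ioi t) t := by
  rw [hasDerivWithinAt_iff_tendsto_slope' Set.self_notMem_Ioi]
  have h1 : Tendsto (fun s : ℝ => s - t) (𝓝[>] t) (𝓝[>] 0) := by
    refine tendsto_nhdsWithin_iff.2 ⟨?_, ?_⟩
    · have : Tendsto (fun s : ℝ => s - t) (𝓝 t) (𝓝 (t - t)) :=
        (continuous_id.sub continuous_const).tendsto t
      rw [sub_self] at this
      exact this.mono_left nhdsWithin_le_nhds
    · filter_upwards [self_mem_nhdsWithin] with s hs
      exact sub_pos.2 (Set.mem_Ioi.1 hs)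
  have h2 := ((S t).continuous.tendsto v).comp ((hS.mem_graph_iff.1 huv).comp h1)
  refine (h2.neg).congr' ?_
  filter_upwards [self_mem_nhdsWithin] with s hs
  have hst : 0 ≤ s - t := (sub_pos.2 (Set.mem_Ioi.1 hs)).le
  have h3 : S s u = S t (S (s - t) u) := by
    have := hS.add t (s - t) ht hst
    rw [add_sub_cancel] at this
    rw [this]; rfl
  have h4 : S t ((s - t)⁻¹ • (u - S (s - t) u)) = (s - t)⁻¹ • (S t u - S s u) := by
    rw [h3, ← map_sub, ← Complex.coe_smul, ← Complex.coe_smul, map_smul]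
  rw [Function.comp_apply, Function.comp_apply, h4, slope_def_module, ← smul_neg, neg_sub]

variable [CompleteSpace H]

/-- `-e^{-at} S_t u` is a primitive of `e^{-at} S_t (T + a) u`, and it decays at infinity;
integration over `(0, ∞)` leaves `u`. -/
lemma IsSemigroupOf.laplace_eq_of_mem_graph {T : H →ₗ.[ℂ] H} {S : ℝ → H →L[ℂ] H}
    (hS : IsSemigroupOf T S) {a : ℝ} (ha : 0 < a) {u g : H}
    (hug : (u, g) ∈ (shift T (a : ℂ)).graph) : laplace S a g = u := by
  have hv := mem_graph_shift.1 hug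
  rw [Complex.coe_smul] at hv
  have hderiv : ∀ t : ℝ, 0 ≤ t → HasDerivWithinAt (fun t : ℝ => -(Real.exp (-a * t) • S t u))
      (Real.exp (-a * t) • S t g) (Set.Ioi t) t := by
    intro t ht
    have h1 : HasDerivWithinAt (fun t : ℝ => Real.exp (-a * t)) (Real.exp (-a * t) * (-a))
        (Set.Ioi t) t := by
      have : HasDerivAt (fun t : ℝ => -a * t) (-a) t := by
        simpa using (hasDerivAt_id t).const_mul (-a)
      exact this.exp.hasDerivWithinAt
    have h2 := (h1.smul (hS.hasDerivWithinAt hv ht)).neg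
    refine h2.congr_deriv ?_
    rw [map_sub, ← Complex.coe_smul a u, map_smul, Complex.coe_smul, mul_smul, ← smul_add,
      ← smul_neg]
    congr 1
    rw [neg_smul]; abel
  have hfin : ∀ b : ℝ, 0 ≤ b → ∫ t in (0 : ℝ)..b, Real.exp (-a * t) • S t g =
      u - Real.exp (-a * b) • S b u := by
    intro b hb
    rw [intervalIntegral.integral_eq_sub_of_hasDeriv_right_of_le hb
      (((hS.continuousOn_exp_smul a u).mono Set.Icc_subset_Ici_self).neg)
      (fun t ht => hderiv t ht.1.le) (hS.intervalIntegrable a g hb)]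
    simp only [Pi.neg_apply, hS.zero]
    simp
    abel
  have hlim := intervalIntegral_tendsto_integral_Ioi (0 : ℝ) (hS.integrableOn ha g) tendsto_id
  refine tendsto_nhds_unique hlim ?_
  have h0 : Tendsto (fun b : ℝ => Real.exp (-a * b) • S b u) atTop (𝓝 0) := by
    refine squeeze_zero_norm' (a := fun b : ℝ => Real.exp (-a * b) * ‖u‖) ?_ ?_
    · filter_upwards [eventually_ge_atTop 0] with b hb
      rw [norm_smul, Real.norm_of_nonneg (Real.exp_nonneg _)]
      gcongr
      exact hS.norm_apply_le hb u
    · have : Tendsto (fun b : ℝ => Real.exp (-a * b)) atTop (𝓝 0) := by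
        refine Real.tendsto_exp_atBot.comp ?_
        exact tendsto_id.const_mul_atTop_of_neg (neg_lt_zero.2 ha)
      simpa using this.mul_const ‖u‖
  have h1 : Tendsto (fun b : ℝ => u - Real.exp (-a * b) • S b u) atTop (𝓝 u) := by
    simpa using tendsto_const_nhds.sub h0
  refine h1.congr' ?_
  filter_upwards [eventually_ge_atTop 0] with b hb
  rw [id, hfin b hb]

/-- The semigroup law shifts the integration variable by `h`. The resulting formula can be
differentiated at `h = 0` from the right, which places the Laplace transform in the domain of `T`.
-/
lemma IsSemigroupOf.apply_laplace {T : H →ₗ.[ℂ] H} {S : ℝ → H →L[ℂ] H}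
    (hS : IsSemigroupOf T S) {a : ℝ} (ha : 0 < a) (g : H) {h : ℝ} (hh : 0 ≤ h) :
    S h (laplace S a g) = Real.exp (a * h) •
      (laplace S a g - ∫ t in (0 : ℝ)..h, Real.exp (-a * t) • S t g) := by
  have hi := hS.integrableOn ha g
  have hi' : IntegrableOn (fun t : ℝ => Real.exp (-a * t) • S t g) (Set.Ioi h) :=
    hi.mono_set (Set.Ioi_subset_Ioi hh)
  have e1 : laplace S a g - ∫ t in (0 : ℝ)..h, Real.exp (-a * t) • S t g =
      ∫ t in Set.Ioi h, Real.exp (-a * t) • S t g := by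
    rw [laplace, ← intervalIntegral.integral_interval_add_Ioi hi hi', add_sub_cancel_left]
  rw [e1, laplace, ← ContinuousLinearMap.integral_comp_comm (S h) hi,
    ← (measurePreserving_add_right volume h).setIntegral_preimage_emb
      (measurableEmbedding_addRight h) _ (Set.Ioi h), ← integral_smul]
  have e2 : (fun x : ℝ => x + h) ⁻¹' Set.Ioi h = Set.Ioi 0 := by ext x; simp
  rw [e2]
  refine setIntegral_congr_fun measurableSet_Ioi fun t ht => ?_
  have e3 : S (t + h) g = S h (S t g) := by
    rw [add_comm, hS.add h t hh (le_of_lt ht)]; rfl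
  rw [← Complex.coe_smul, map_smul, Complex.coe_smul, e3, smul_smul, ← Real.exp_add]
  congr 2
  ring

lemma IsSemigroupOf.laplace_mem_graph {T : H →ₗ.[ℂ] H} {S : ℝ → H →L[ℂ] H}
    (hS : IsSemigroupOf T S) {a : ℝ} (ha : 0 < a) (g : H) :
    (laplace S a g, g) ∈ (shift T (a : ℂ)).graph := by
  rw [mem_graph_shift, hS.mem_graph_iff, Complex.coe_smul]
  set u := laplace S a g
  have hI : HasDerivWithinAt (fun h : ℝ => ∫ t in (0 : ℝ)..h, Real.exp (-a * t) • S t g)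
      (Real.exp (-a * 0) • S 0 g) (Set.Ici 0) 0 := by
    refine intervalIntegral.integral_hasDerivWithinAt_right (t := Set.Ioi 0) (by simp) ?_ ?_
    · exact ⟨Set.Ioi 0, self_mem_nhdsWithin,
        ((hS.continuousOn_exp_smul a g).mono Set.Ioi_subset_Ici_self).aestronglyMeasurable
          measurableSet_Ioi⟩
    · exact (hS.continuousOn_exp_smul a g 0 Set.self_mem_Ici).mono Set.Ioi_subset_Ici_self
  have hexp : HasDerivWithinAt (fun h : ℝ => Real.exp (a * h)) (Real.exp (a * 0) * a)
      (Set.Ici 0) 0 := by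
    have : HasDerivAt (fun h : ℝ => a * h) a 0 := by
      simpa using (hasDerivAt_id (0 : ℝ)).const_mul a
    exact this.exp.hasDerivWithinAt
  have hd := (hexp.smul ((hasDerivWithinAt_const (0 : ℝ) (Set.Ici 0) u).sub hI)).neg.Ioi_of_Ici
  rw [hasDerivWithinAt_iff_tendsto_slope' Set.self_notMem_Ioi] at hd
  have hlim : -(Real.exp (a * 0) • (0 - Real.exp (-a * 0) • S 0 g) + (Real.exp (a * 0) * a) •
      (u - ∫ t in (0 : ℝ)..0, Real.exp (-a * t) • S t g)) = g - a • u := by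
    simp [hS.zero]
    abel
  simp only [Pi.sub_apply] at hd
  rw [hlim] at hd
  refine hd.congr' ?_
  filter_upwards [self_mem_nhdsWithin] with h hh
  rw [hS.apply_laplace ha g (le_of_lt hh), slope_def_module]
  simp only [Pi.neg_apply, Pi.smul_apply', Pi.sub_apply, sub_zero, mul_zero, Real.exp_zero,
    one_smul, intervalIntegral.integral_same]
  congr 1
  simp only [u]
  abel

/-- Semigroups with the same generator have the same Laplace transforms. -/
lemma IsSemigroupOf.laplace_eq {T : H →ₗ.[ℂ] H} {S S' : ℝ → H →L[ℂ] H} (hS : IsSemigroupOf T S)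
    (hS' : IsSemigroupOf T S') {a : ℝ} (ha : 0 < a) (g : H) : laplace S a g = laplace S' a g :=
  hS.laplace_eq_of_mem_graph ha (hS'.laplace_mem_graph ha g)

lemma IsSemigroupOf.laplace_eq_of_isBoundedInverse {T : H →ₗ.[ℂ] H} {S : ℝ → H →L[ℂ] H}
    (hS : IsSemigroupOf T S) {a : ℝ} (ha : 0 < a) {R : H →L[ℂ] H}
    (hR : IsBoundedInverse (shift T (a : ℂ)) R) (g : H) : laplace S a g = R g :=
  hS.laplace_eq_of_mem_graph ha (hR.1 g)

end Semigroups

/-- Integrals of functions with values in a closed convex cone lie in the cone. -/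
lemma integral_Ioi_mem_cone {E : Type*} [NormedAddCommGroup E] [NormedSpace ℝ E] [CompleteSpace E]
    {C : Set E} (hC : Convex ℝ C) (hclosed : IsClosed C)
    (hcone : ∀ c : ℝ, 0 ≤ c → ∀ x ∈ C, c • x ∈ C) {f : ℝ → E} (hf : IntegrableOn f (Set.Ioi 0))
    (hfC : ∀ t, 0 < t → f t ∈ C) : ∫ t in Set.Ioi (0 : ℝ), f t ∈ C := by
  have hlim := intervalIntegral_tendsto_integral_Ioi (0 : ℝ) hf
    (tendsto_natCast_atTop_atTop (R := ℝ))
  refine hclosed.mem_of_tendsto hlim ?_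
  filter_upwards [eventually_gt_atTop 0] with n hn
  have hn' : (0 : ℝ) < n := Nat.cast_pos.2 hn
  have hvol : volume (Set.Ioc (0 : ℝ) n) = ENNReal.ofReal n := by simp
  -- The average over `(0, n]` lies in the closed convex set, and the cone property permits
  -- multiplying it by the length `n` to recover the integral.
  have hmem := hC.set_average_mem hclosed (μ := volume) (t := Set.Ioc (0 : ℝ) n) (f := f)
    (by rw [hvol]; simpa using hn'.ne') (by rw [hvol]; exact ENNReal.ofReal_ne_top)
    (by filter_upwards [ae_restrict_mem measurableSet_Ioc] with t ht using hfC t ht.1)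
    (hf.mono_set Set.Ioc_subset_Ioi_self)
  have := hcone n hn'.le _ hmem
  rw [setAverage_eq, smul_smul] at this
  rw [intervalIntegral.integral_of_le hn'.le]
  have e : (n : ℝ) * (volume.real (Set.Ioc (0 : ℝ) n))⁻¹ = 1 := by
    rw [Measure.real, hvol, ENNReal.toReal_ofReal hn'.le, mul_inv_cancel₀ hn'.ne']
  rwa [e, one_smul] at this

/-! ### Resolvent bounds from the diagonal of the heat kernel -/

section KernelEstimates

/-- The Cauchy-Schwarz inequality. -/
lemma lintegral_mul_sq_le {α : Type*} [MeasurableSpace α] (ν : Measure α) {f g : α → ℝ≥0∞}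
    (hf : AEMeasurable f ν) (hg : AEMeasurable g ν) :
    (∫⁻ x, f x * g x ∂ν) ^ 2 ≤ (∫⁻ x, f x ^ 2 ∂ν) * ∫⁻ x, g x ^ 2 ∂ν := by
  have h := ENNReal.lintegral_mul_le_Lp_mul_Lq ν Real.HolderConjugate.two_two hf hg
  simp only [Pi.mul_apply, ENNReal.rpow_two] at h
  calc _ ≤ ((∫⁻ x, f x ^ 2 ∂ν) ^ (1 / 2 : ℝ) * (∫⁻ x, g x ^ 2 ∂ν) ^ (1 / 2 : ℝ)) ^ 2 := by
        gcongr
    _ = _ := by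
        rw [mul_pow, ← ENNReal.rpow_two, ← ENNReal.rpow_two, ← ENNReal.rpow_mul,
          ← ENNReal.rpow_mul]
        norm_num

variable {X : Type u}

/-- The heat kernel, extended by `0` to nonpositive times. -/
def heatK (p : ℝ → X → X → ℝ≥0) (t : ℝ) (x y : X) : ℝ≥0∞ := if 0 < t then p t x y else 0

lemma heatK_of_pos {p : ℝ → X → X → ℝ≥0} {t : ℝ} (ht : 0 < t) (x y : X) :
    heatK p t x y = p t x y := if_pos ht

variable [MeasurableSpace X]

/-- `∫ p(t,x,y) g(y) dμ(y)` for `g ≥ 0`. -/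
def heatOp (μ : Measure X) (p : ℝ → X → X → ℝ≥0) (t : ℝ) (g : X → ℝ≥0∞) (x : X) : ℝ≥0∞ :=
  ∫⁻ y, heatK p t x y * g y ∂μ

/-- `∫₀^∞ e^{-at} ∫ p(t,x,y) g(y) dμ(y) dt` for `g ≥ 0`. -/
def resOp (μ : Measure X) (p : ℝ → X → X → ℝ≥0) (a : ℝ) (g : X → ℝ≥0∞) (x : X) : ℝ≥0∞ :=
  ∫⁻ t in Set.Ioi (0 : ℝ), ENNReal.ofReal (Real.exp (-a * t)) * heatOp μ p t g x

variable {μ : Measure X} {p : ℝ → X → X → ℝ≥0}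

lemma heatOp_mono_ae {t : ℝ} {g g' : X → ℝ≥0∞} (h : ∀ᵐ y ∂μ, g y ≤ g' y) (x : X) :
    heatOp μ p t g x ≤ heatOp μ p t g' x :=
  lintegral_mono_ae (h.mono fun y hy => by gcongr)

lemma resOp_mono_ae {a : ℝ} {g g' : X → ℝ≥0∞} (h : ∀ᵐ y ∂μ, g y ≤ g' y) (x : X) :
    resOp μ p a g x ≤ resOp μ p a g' x :=
  lintegral_mono fun t => by
    gcongr
    exact heatOp_mono_ae h x

namespace IsHeatKernel

lemma measurable_heatK (hp : IsHeatKernel μ p) :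
    Measurable (fun z : ℝ × X × X => heatK p z.1 z.2.1 z.2.2) := by
  classical
  have hs : MeasurableSet {z : ℝ × X × X | 0 < z.1} :=
    measurableSet_lt measurable_const measurable_fst
  have h1 : Measurable (fun z : {z : ℝ × X × X | 0 < z.1} =>
      (p z.1.1 z.1.2.1 z.1.2.2 : ℝ≥0∞)) := by
    have h2 : Measurable (fun z : {z : ℝ × X × X | 0 < z.1} =>
        ((⟨z.1.1, z.2⟩, z.1.2) : Set.Ioi (0 : ℝ) × X × X)) :=
      (Measurable.subtype_mk (measurable_fst.comp measurable_subtype_coe)).prodMk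
        (measurable_snd.comp measurable_subtype_coe)
    exact (hp.measurable.comp h2).coe_nnreal_ennreal
  have h3 := Measurable.dite h1 (measurable_const (a := (0 : ℝ≥0∞))) hs
  refine (congrArg Measurable (funext fun z => ?_)).mp h3
  by_cases hz : 0 < z.1 <;> simp [heatK, hz]

lemma measurable_heatK_right (hp : IsHeatKernel μ p) (t : ℝ) (x : X) :
    Measurable (heatK p t x) :=
  hp.measurable_heatK.comp
    (measurable_const.prodMk (measurable_const.prodMk measurable_id) :
      Measurable (fun y : X => (t, x, y)))

lemma measurable_heatK_left (hp : IsHeatKernel μ p) (t : ℝ) (y : X) :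
    Measurable (fun x => heatK p t x y) :=
  hp.measurable_heatK.comp
    (measurable_const.prodMk (measurable_id.prodMk measurable_const) :
      Measurable (fun x : X => (t, x, y)))

lemma measurable_heatK_diag (hp : IsHeatKernel μ p) (x : X) :
    Measurable (fun t => heatK p t x x) :=
  hp.measurable_heatK.comp
    (measurable_id.prodMk (measurable_const.prodMk measurable_const) :
      Measurable (fun t : ℝ => (t, x, x)))

lemma heatK_symm (hp : IsHeatKernel μ p) (t : ℝ) (x y : X) : heatK p t x y = heatK p t y x := by
  unfold heatK
  split_ifs with h
  · rw [hp.symm t h]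
  · rfl

lemma lintegral_heatK_le (hp : IsHeatKernel μ p) (t : ℝ) (x : X) : ∫⁻ y, heatK p t x y ∂μ ≤ 1 := by
  unfold heatK
  split_ifs with h
  · exact hp.lintegral_le_one t h x
  · simp

lemma heatK_add (hp : IsHeatKernel μ p) {t s : ℝ} (ht : 0 < t) (hs : 0 < s) (x y : X) :
    heatK p (t + s) x y = ∫⁻ z, heatK p t x z * heatK p s z y ∂μ := by
  simp only [heatK_of_pos ht, heatK_of_pos hs, heatK_of_pos (add_pos ht hs)]
  exact hp.chapman_kolmogorov t s ht hs x y

lemma heatK_double (hp : IsHeatKernel μ p) {t : ℝ} (ht : 0 < t) (x : X) :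
    heatK p (t + t) x x = ∫⁻ y, heatK p t x y ^ 2 ∂μ := by
  rw [hp.heatK_add ht ht]
  refine lintegral_congr fun y => ?_
  rw [hp.heatK_symm t y x, sq]

lemma heatOp_sq_le (hp : IsHeatKernel μ p) {g : X → ℝ≥0∞} (hg : Measurable g) (t : ℝ) (x : X) :
    heatOp μ p t g x ^ 2 ≤ ∫⁻ y, heatK p t x y * g y ^ 2 ∂μ := by
  have hk := hp.measurable_heatK_right t x
  have h2 : ∀ y, (heatK p t x y ^ (1 / 2 : ℝ)) ^ 2 = heatK p t x y := fun y => by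
    rw [← ENNReal.rpow_two, ← ENNReal.rpow_mul]; norm_num
  have h := lintegral_mul_sq_le μ (f := fun y => heatK p t x y ^ (1 / 2 : ℝ))
    (g := fun y => heatK p t x y ^ (1 / 2 : ℝ) * g y) (hk.pow_const _).aemeasurable
    ((hk.pow_const _).mul hg).aemeasurable
  simp only [mul_pow, h2, ← mul_assoc, ← sq] at h
  calc _ ≤ (∫⁻ y, heatK p t x y ∂μ) * ∫⁻ y, heatK p t x y * g y ^ 2 ∂μ := h
    _ ≤ 1 * _ := by gcongr; exact hp.lintegral_heatK_le t x
    _ = _ := one_mul _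

variable [SigmaFinite μ]

lemma measurable_heatOp_uncurry (hp : IsHeatKernel μ p) {g : X → ℝ≥0∞} (hg : Measurable g) :
    Measurable (fun z : ℝ × X => heatOp μ p z.1 g z.2) := by
  have h1 : Measurable (fun z : (ℝ × X) × X => (z.1.1, z.1.2, z.2)) :=
    (measurable_fst.comp measurable_fst).prodMk
      ((measurable_snd.comp measurable_fst).prodMk measurable_snd)
  exact Measurable.lintegral_prod_right'
    (f := fun z : (ℝ × X) × X => heatK p z.1.1 z.1.2 z.2 * g z.2)
    ((hp.measurable_heatK.comp h1).mul (hg.comp measurable_snd))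

lemma measurable_heatOp (hp : IsHeatKernel μ p) {g : X → ℝ≥0∞} (hg : Measurable g) (t : ℝ) :
    Measurable (heatOp μ p t g) :=
  (hp.measurable_heatOp_uncurry hg).comp (measurable_const.prodMk measurable_id)

lemma measurable_heatOp_time (hp : IsHeatKernel μ p) {g : X → ℝ≥0∞} (hg : Measurable g) (x : X) :
    Measurable (fun t => heatOp μ p t g x) :=
  (hp.measurable_heatOp_uncurry hg).comp (measurable_id.prodMk measurable_const)

lemma measurable_exp_mul_heatOp (hp : IsHeatKernel μ p) {g : X → ℝ≥0∞} (hg : Measurable g)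
    (a : ℝ) : Measurable (fun z : X × ℝ =>
      ENNReal.ofReal (Real.exp (-a * z.2)) * heatOp μ p z.2 g z.1) :=
  (by fun_prop : Measurable (fun z : X × ℝ => ENNReal.ofReal (Real.exp (-a * z.2)))).mul
    ((hp.measurable_heatOp_uncurry hg).comp measurable_swap)

lemma measurable_resOp (hp : IsHeatKernel μ p) {g : X → ℝ≥0∞} (hg : Measurable g) (a : ℝ) :
    Measurable (resOp μ p a g) :=
  Measurable.lintegral_prod_right' (hp.measurable_exp_mul_heatOp hg a)

lemma measurable_resOp_iterate (hp : IsHeatKernel μ p) {g : X → ℝ≥0∞} (hg : Measurable g) (a : ℝ)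
    (j : ℕ) : Measurable ((resOp μ p a)^[j] g) := by
  induction j with
  | zero => exact hg
  | succ j ih =>
    rw [Function.iterate_succ_apply']
    exact hp.measurable_resOp ih a

lemma heatOp_heatOp (hp : IsHeatKernel μ p) {g : X → ℝ≥0∞} (hg : Measurable g) {t s : ℝ}
    (ht : 0 < t) (hs : 0 < s) (x : X) :
    heatOp μ p t (heatOp μ p s g) x = heatOp μ p (t + s) g x := by
  unfold heatOp
  calc _ = ∫⁻ z, ∫⁻ y, heatK p t x z * (heatK p s z y * g y) ∂μ ∂μ := by
        refine lintegral_congr fun z => ?_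
        rw [lintegral_const_mul]
        exact (hp.measurable_heatK_right s z).mul hg
    _ = ∫⁻ y, ∫⁻ z, heatK p t x z * (heatK p s z y * g y) ∂μ ∂μ := by
        refine lintegral_lintegral_swap (Measurable.aemeasurable ?_)
        have h1 : Measurable (fun z : X × X => heatK p t x z.1) :=
          (hp.measurable_heatK_right t x).comp measurable_fst
        have h2 : Measurable (fun z : X × X => heatK p s z.1 z.2) :=
          hp.measurable_heatK.comp (measurable_const.prodMk measurable_id :
            Measurable (fun z : X × X => (s, z)))
        exact h1.mul (h2.mul (hg.comp measurable_snd))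
    _ = _ := by
        refine lintegral_congr fun y => ?_
        simp only [← mul_assoc]
        rw [hp.heatK_add ht hs, lintegral_mul_const]
        exact (hp.measurable_heatK_right t x).mul (hp.measurable_heatK_left s y)

lemma heatOp_resOp (hp : IsHeatKernel μ p) {g : X → ℝ≥0∞} (hg : Measurable g) {s : ℝ}
    (hs : 0 < s) (a : ℝ) (x : X) :
    heatOp μ p s (resOp μ p a g) x =
      ∫⁻ t in Set.Ioi (0 : ℝ), ENNReal.ofReal (Real.exp (-a * t)) * heatOp μ p (s + t) g x := by
  have hm := hp.measurable_exp_mul_heatOp hg a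
  calc heatOp μ p s (resOp μ p a g) x
      = ∫⁻ y, (∫⁻ t in Set.Ioi (0 : ℝ), heatK p s x y *
          (ENNReal.ofReal (Real.exp (-a * t)) * heatOp μ p t g y)) ∂μ := by
        refine lintegral_congr fun y => ?_
        rw [resOp, lintegral_const_mul]
        exact hm.comp (measurable_const.prodMk measurable_id)
    _ = ∫⁻ t in Set.Ioi (0 : ℝ), ∫⁻ y, heatK p s x y *
          (ENNReal.ofReal (Real.exp (-a * t)) * heatOp μ p t g y) ∂μ :=
        lintegral_lintegral_swap
          (((hp.measurable_heatK_right s x).comp measurable_fst).mul hm).aemeasurable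
    _ = _ := by
        refine setLIntegral_congr_fun measurableSet_Ioi fun t ht => ?_
        simp only [mul_left_comm (heatK p s x _)]
        rw [← hp.heatOp_heatOp hg hs ht, lintegral_const_mul]
        · rfl
        · exact (hp.measurable_heatK_right s x).mul (hp.measurable_heatOp hg t)

lemma lintegral_heatOp_sq_le (hp : IsHeatKernel μ p) {g : X → ℝ≥0∞} (hg : Measurable g) (t : ℝ) :
    ∫⁻ x, heatOp μ p t g x ^ 2 ∂μ ≤ ∫⁻ y, g y ^ 2 ∂μ := by
  calc _ ≤ ∫⁻ x, ∫⁻ y, heatK p t x y * g y ^ 2 ∂μ ∂μ := lintegral_mono (hp.heatOp_sq_le hg t)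
    _ = ∫⁻ y, ∫⁻ x, heatK p t x y * g y ^ 2 ∂μ ∂μ := by
        refine lintegral_lintegral_swap (Measurable.aemeasurable ?_)
        have h2 : Measurable (fun z : X × X => heatK p t z.1 z.2) :=
          hp.measurable_heatK.comp (measurable_const.prodMk measurable_id :
            Measurable (fun z : X × X => (t, z)))
        exact h2.mul ((hg.comp measurable_snd).pow_const _)
    _ ≤ ∫⁻ y, g y ^ 2 ∂μ := by
        refine lintegral_mono fun y => ?_
        rw [lintegral_mul_const _ (hp.measurable_heatK_left t y)]
        simp only [hp.heatK_symm t _ y]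
        calc _ ≤ 1 * g y ^ 2 := by gcongr; exact hp.lintegral_heatK_le t y
          _ = _ := one_mul _

/-- `p(t,x,x)` decreases in `t`. -/
lemma heatK_diag_anti (hp : IsHeatKernel μ p) {t s : ℝ} (ht : 0 < t) (hs : 0 < s) (x : X) :
    heatK p (t + s) x x ≤ heatK p t x x := by
  have ht2 : 0 < t / 2 := half_pos ht
  have hs2 : 0 < s / 2 := half_pos hs
  -- `p(t + s, x, x)` is the squared `L²` norm of `P_{s/2} p(t/2, ·, x)`, and `P_{s/2}` is a
  -- contraction.
  have e1 : heatK p (t + s) x x = ∫⁻ y, heatK p (s / 2 + t / 2) x y ^ 2 ∂μ := by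
    rw [← hp.heatK_double (by positivity)]
    congr 1; ring
  have e2 : heatK p t x x = ∫⁻ y, heatK p (t / 2) y x ^ 2 ∂μ := by
    simp only [hp.heatK_symm (t / 2) _ x]
    rw [← hp.heatK_double ht2, add_halves]
  rw [e1, e2]
  refine le_trans (le_of_eq ?_) (hp.lintegral_heatOp_sq_le (hp.measurable_heatK_left (t / 2) x)
    (s / 2))
  refine lintegral_congr fun y => ?_
  rw [hp.heatK_symm, hp.heatK_add hs2 ht2]
  rfl

/-- Cauchy-Schwarz and Chapman-Kolmogorov give the factor `p(2t, x, x)`, which is at most `p(t, x,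
x)`. -/
lemma heatOp_sq_le_diag (hp : IsHeatKernel μ p) {g : X → ℝ≥0∞} (hg : Measurable g) {t : ℝ}
    (ht : 0 < t) (x : X) : heatOp μ p t g x ^ 2 ≤ heatK p t x x * ∫⁻ y, g y ^ 2 ∂μ := by
  refine (lintegral_mul_sq_le μ (hp.measurable_heatK_right t x).aemeasurable
    hg.aemeasurable).trans ?_
  rw [← hp.heatK_double ht]
  gcongr
  exact hp.heatK_diag_anti ht ht x

/-- Pointwise bounds for the powers of the resolvent. -/
lemma heatOp_resOp_iterate_le (hp : IsHeatKernel μ p) {g : X → ℝ≥0∞} (hg : Measurable g) (a : ℝ)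
    {k : ℕ} (hk : 0 < k) (x : X) (j : ℕ) (hj : j ≤ k) {s : ℝ} (hs : 0 < s) :
    heatOp μ p s ((resOp μ p a)^[j] g) x ≤
      (∫⁻ t in Set.Ioi (0 : ℝ), ENNReal.ofReal (Real.exp (-a * t)) *
        heatK p t x x ^ (1 / (2 * k : ℝ))) ^ j *
      heatK p s x x ^ (((k : ℝ) - j) / (2 * k)) * (∫⁻ y, g y ^ 2 ∂μ) ^ (1 / 2 : ℝ) := by
  have hk' : (0 : ℝ) < k := Nat.cast_pos.2 hk
  set C := ∫⁻ t in Set.Ioi (0 : ℝ), ENNReal.ofReal (Real.exp (-a * t)) *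
    heatK p t x x ^ (1 / (2 * k : ℝ)) with hC
  set N := (∫⁻ y, g y ^ 2 ∂μ) ^ (1 / 2 : ℝ) with hN
  induction j generalizing s with
  | zero =>
    have h := ENNReal.rpow_le_rpow (hp.heatOp_sq_le_diag hg hs x)
      (show (0 : ℝ) ≤ 1 / 2 by norm_num)
    rw [ENNReal.mul_rpow_of_nonneg _ _ (by norm_num), ← ENNReal.rpow_two, ← ENNReal.rpow_mul,
      mul_one_div_cancel two_ne_zero, ENNReal.rpow_one] at h
    have e : ((k : ℝ) - (0 : ℕ)) / (2 * k) = 1 / 2 := by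
      field_simp; simp
    simpa only [Function.iterate_zero, id_eq, pow_zero, one_mul, e] using h
  | succ j ih =>
    have hjk : ((j + 1 : ℕ) : ℝ) ≤ k := Nat.cast_le.2 hj
    rw [Function.iterate_succ_apply',
      hp.heatOp_resOp (hp.measurable_resOp_iterate hg a j) hs]
    set e : ℝ := ((k : ℝ) - (j + 1 : ℕ)) / (2 * k) with he
    have he0 : 0 ≤ e := div_nonneg (sub_nonneg.2 hjk) (by positivity)
    have hd0 : (0 : ℝ) ≤ 1 / (2 * k) := by positivity
    -- Each resolvent uses up the exponent `1 / (2k)` of the diagonal value. Since `p(s + t, x, x)`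
    -- is at most `p(s, x, x)` and at most `p(t, x, x)`, its power may be divided between the two,
    -- and the factor in `t` integrates to `C`.
    have hsum : ((k : ℝ) - j) / (2 * k) = e + 1 / (2 * k) := by
      rw [he]; push_cast; field_simp; ring
    calc _ ≤ ∫⁻ t in Set.Ioi (0 : ℝ), (C ^ j * heatK p s x x ^ e * N) *
          (ENNReal.ofReal (Real.exp (-a * t)) * heatK p t x x ^ (1 / (2 * k : ℝ))) := by
          refine setLIntegral_mono' measurableSet_Ioi fun t ht => ?_
          have h1 := ih (Nat.le_of_succ_le hj) (add_pos hs ht)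
          rw [hsum, ENNReal.rpow_add_of_nonneg _ _ he0 hd0] at h1
          have h2 : heatK p (s + t) x x ≤ heatK p s x x := hp.heatK_diag_anti hs ht x
          have h3 : heatK p (s + t) x x ≤ heatK p t x x := by
            rw [add_comm]; exact hp.heatK_diag_anti ht hs x
          calc _ ≤ ENNReal.ofReal (Real.exp (-a * t)) *
                (C ^ j * (heatK p s x x ^ e * heatK p t x x ^ (1 / (2 * k : ℝ))) * N) := by
                gcongr
                refine h1.trans ?_
                gcongr
            _ = _ := by ring
      _ = (C ^ j * heatK p s x x ^ e * N) * C := by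
          rw [lintegral_const_mul]
          exact (by fun_prop : Measurable fun t : ℝ => ENNReal.ofReal (Real.exp (-a * t))).mul
            ((hp.measurable_heatK_diag x).pow_const _)
      _ = _ := by rw [pow_succ]; ring

/-- For the last resolvent the previous bound is used at `j = k - 1`: the remaining exponent is `1 /
(2k)`, and its time integral is the `k`-th factor. -/
lemma resOp_iterate_le (hp : IsHeatKernel μ p) {g : X → ℝ≥0∞} (hg : Measurable g) (a : ℝ)
    {k : ℕ} (hk : 0 < k) (x : X) :
    (resOp μ p a)^[k] g x ≤
      (∫⁻ t in Set.Ioi (0 : ℝ), ENNReal.ofReal (Real.exp (-a * t)) *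
        heatK p t x x ^ (1 / (2 * k : ℝ))) ^ k * (∫⁻ y, g y ^ 2 ∂μ) ^ (1 / 2 : ℝ) := by
  obtain ⟨j, rfl⟩ : ∃ j, k = j + 1 := ⟨k - 1, by omega⟩
  set C := ∫⁻ t in Set.Ioi (0 : ℝ), ENNReal.ofReal (Real.exp (-a * t)) *
    heatK p t x x ^ (1 / (2 * (j + 1 : ℕ) : ℝ)) with hC
  set N := (∫⁻ y, g y ^ 2 ∂μ) ^ (1 / 2 : ℝ) with hN
  rw [Function.iterate_succ_apply', resOp]
  calc _ ≤ ∫⁻ t in Set.Ioi (0 : ℝ), (C ^ j * N) *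
          (ENNReal.ofReal (Real.exp (-a * t)) * heatK p t x x ^ (1 / (2 * (j + 1 : ℕ) : ℝ))) := by
        refine setLIntegral_mono' measurableSet_Ioi fun t ht => ?_
        have h1 := hp.heatOp_resOp_iterate_le hg a hk x j (Nat.le_succ j) ht
        have e : (((j + 1 : ℕ) : ℝ) - j) / (2 * (j + 1 : ℕ)) = 1 / (2 * (j + 1 : ℕ)) := by
          push_cast; ring
        rw [e] at h1
        calc _ ≤ ENNReal.ofReal (Real.exp (-a * t)) *
              (C ^ j * heatK p t x x ^ (1 / (2 * (j + 1 : ℕ) : ℝ)) * N) := by gcongr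
          _ = _ := by ring
    _ = (C ^ j * N) * C := by
        rw [lintegral_const_mul]
        exact (by fun_prop : Measurable fun t : ℝ => ENNReal.ofReal (Real.exp (-a * t))).mul
          ((hp.measurable_heatK_diag x).pow_const _)
    _ = _ := by rw [pow_succ]; ring

end IsHeatKernel

/-- The pointwise consequence of the existence of a control function. -/
lemma IsControlFunction.resOp_iterate_le [SigmaFinite μ] (hp : IsHeatKernel μ p) {q : ℝ}
    (hq : 1 ≤ q) {F₁ : X → ℝ} (hF : IsControlFunction p q F₁) {k : ℕ} (hqk : q ≤ k) {a : ℝ}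
    (ha : 1 ≤ a) : ∃ C : ℝ≥0, ∀ g : X → ℝ≥0∞, Measurable g → ∀ x,
      (resOp μ p a)^[k] g x ≤
        C * ENNReal.ofReal (F₁ x) ^ (1 / 2 : ℝ) * (∫⁻ y, g y ^ 2 ∂μ) ^ (1 / 2 : ℝ) := by
  obtain ⟨-, hF₁, F₂, hF₂m, hF₂, hle, hfin⟩ := hF
  have hk' : (0 : ℝ) < k := lt_of_lt_of_le (by linarith) hqk
  have hk : 0 < k := Nat.cast_pos.1 hk'
  set D := ∫⁻ t in Set.Ioi (0 : ℝ), ENNReal.ofReal (Real.exp (-t)) *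
    ENNReal.ofReal (F₂ t) ^ (1 / (2 * k : ℝ)) with hD
  have hDtop : D ≠ ∞ := by
    -- This is where `k ≥ q` enters: `F₂^{1/(2k)} ≤ 1 + F₂^{1/(2q)}`.
    have h1 : D ≤ ∫⁻ t in Set.Ioi (0 : ℝ), (ENNReal.ofReal (Real.exp (-1 * t)) +
        ENNReal.ofReal (Real.exp (-t) * F₂ t ^ (1 / (2 * q)))) := by
      refine setLIntegral_mono' measurableSet_Ioi fun t ht => ?_
      have hF0 := hF₂ t ht
      rw [ENNReal.ofReal_mul (Real.exp_nonneg _),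
        ← ENNReal.ofReal_rpow_of_nonneg hF0.le (by positivity), neg_one_mul]
      conv_rhs => rw [← mul_one (ENNReal.ofReal (Real.exp (-t))), mul_assoc, one_mul]
      rw [← mul_add]
      gcongr
      rcases le_total (ENNReal.ofReal (F₂ t)) 1 with h | h
      · exact (ENNReal.rpow_le_one h (by positivity)).trans le_self_add
      · refine le_trans ?_ le_add_self
        refine ENNReal.rpow_le_rpow_of_exponent_le h ?_
        gcongr
    refine ne_top_of_le_ne_top ?_ h1
    rw [lintegral_add_left (by fun_prop)]
    refine ENNReal.add_ne_top.2 ⟨?_, hfin.ne⟩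
    have := (exp_neg_integrableOn_Ioi 0 one_pos).lintegral_lt_top
    exact this.ne
  refine ⟨(D ^ k).toNNReal, fun g hg x => ?_⟩
  rw [ENNReal.coe_toNNReal (ENNReal.pow_ne_top hDtop)]
  refine (hp.resOp_iterate_le hg a hk x).trans ?_
  gcongr
  have h2 : ∫⁻ t in Set.Ioi (0 : ℝ), ENNReal.ofReal (Real.exp (-a * t)) *
      heatK p t x x ^ (1 / (2 * k : ℝ)) ≤ D * ENNReal.ofReal (F₁ x) ^ (1 / (2 * k : ℝ)) := by
    rw [hD, ← lintegral_mul_const' _ _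
      (ENNReal.rpow_ne_top_of_nonneg (by positivity) ENNReal.ofReal_ne_top)]
    refine setLIntegral_mono' measurableSet_Ioi fun t ht => ?_
    have ht0 : (0 : ℝ) < t := ht
    rw [mul_assoc, ← ENNReal.mul_rpow_of_nonneg _ _ (by positivity),
      ← ENNReal.ofReal_mul (hF₂ t ht).le, heatK_of_pos ht]
    gcongr
    · nlinarith
    · rw [← ENNReal.ofReal_coe_nnreal, mul_comm]
      exact ENNReal.ofReal_le_ofReal (hle t ht x)
  calc _ ≤ (D * ENNReal.ofReal (F₁ x) ^ (1 / (2 * k : ℝ))) ^ k := by gcongr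
    _ = _ := by
        rw [mul_pow, ← ENNReal.rpow_natCast (_ ^ (1 / (2 * k : ℝ))), ← ENNReal.rpow_mul]
        congr 2
        field_simp

/-- `(P_t g)²` is split into its powers `1/q` and `1 - 1/q`. The first is bounded pointwise by the
diagonal; the second is paired with the weight by Hölder's inequality and controlled by the
`L²`-contractivity of `P_t`. -/
lemma IsHeatKernel.lintegral_mul_heatOp_sq_le [SigmaFinite μ] (hp : IsHeatKernel μ p) {q : ℝ}
    (hq : 1 ≤ q) {F w g : X → ℝ≥0∞} (hF : Measurable F) (hw : Measurable w) (hg : Measurable g)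
    {t : ℝ} (ht : 0 < t) {c : ℝ≥0∞} (hle : ∀ x, heatK p t x x ≤ F x * c) :
    ∫⁻ x, w x ^ 2 * heatOp μ p t g x ^ 2 ∂μ ≤
      c ^ (1 / q) * (∫⁻ x, w x ^ (2 * q) * F x ∂μ) ^ (1 / q) * ∫⁻ y, g y ^ 2 ∂μ := by
  have hq0 : 0 < q := by linarith
  have h1q : 0 ≤ 1 / q := by positivity
  have h2q : 0 ≤ 1 - 1 / q := sub_nonneg.2 (by rw [div_le_one hq0]; exact hq)
  set G := ∫⁻ y, g y ^ 2 ∂μ with hG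
  have hB := hp.measurable_heatOp hg t
  calc _ ≤ ∫⁻ x, (c ^ (1 / q) * G ^ (1 / q)) *
        ((w x ^ (2 * q) * F x) ^ (1 / q) * (heatOp μ p t g x ^ 2) ^ (1 - 1 / q)) ∂μ := by
        refine lintegral_mono fun x => ?_
        have h1 : heatOp μ p t g x ^ 2 ≤ F x * c * G :=
          (hp.heatOp_sq_le_diag hg ht x).trans (by gcongr; exact hle x)
        have h2 : heatOp μ p t g x ^ 2 =
            (heatOp μ p t g x ^ 2) ^ (1 / q) * (heatOp μ p t g x ^ 2) ^ (1 - 1 / q) := by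
          rw [← ENNReal.rpow_add_of_nonneg _ _ h1q h2q]; simp
        have h3 : (w x ^ (2 * q) * F x) ^ (1 / q) = w x ^ 2 * F x ^ (1 / q) := by
          rw [ENNReal.mul_rpow_of_nonneg _ _ h1q, ← ENNReal.rpow_mul, ← ENNReal.rpow_two]
          congr 2
          field_simp
        rw [h3]
        calc w x ^ 2 * heatOp μ p t g x ^ 2
            = w x ^ 2 * ((heatOp μ p t g x ^ 2) ^ (1 / q) *
              (heatOp μ p t g x ^ 2) ^ (1 - 1 / q)) := by rw [← h2]
          _ ≤ w x ^ 2 * ((F x * c * G) ^ (1 / q) *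
              (heatOp μ p t g x ^ 2) ^ (1 - 1 / q)) := by gcongr
          _ = _ := by
              rw [ENNReal.mul_rpow_of_nonneg _ _ h1q, ENNReal.mul_rpow_of_nonneg _ _ h1q]
              ring
    _ = (c ^ (1 / q) * G ^ (1 / q)) * ∫⁻ x, (w x ^ (2 * q) * F x) ^ (1 / q) *
          (heatOp μ p t g x ^ 2) ^ (1 - 1 / q) ∂μ := by
        rw [lintegral_const_mul]
        exact (((hw.pow_const _).mul hF).pow_const _).mul ((hB.pow_const _).pow_const _)
    _ ≤ (c ^ (1 / q) * G ^ (1 / q)) * ((∫⁻ x, w x ^ (2 * q) * F x ∂μ) ^ (1 / q) *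
          (∫⁻ x, heatOp μ p t g x ^ 2 ∂μ) ^ (1 - 1 / q)) := by
        gcongr
        exact ENNReal.lintegral_mul_norm_pow_le ((hw.pow_const _).mul hF).aemeasurable
          (hB.pow_const _).aemeasurable h1q h2q (by ring)
    _ ≤ (c ^ (1 / q) * G ^ (1 / q)) * ((∫⁻ x, w x ^ (2 * q) * F x ∂μ) ^ (1 / q) *
          G ^ (1 - 1 / q)) := by
        gcongr
        exact hp.lintegral_heatOp_sq_le hg t
    _ = c ^ (1 / q) * (∫⁻ x, w x ^ (2 * q) * F x ∂μ) ^ (1 / q) *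
          (G ^ (1 / q) * G ^ (1 - 1 / q)) := by ring
    _ = _ := by
        rw [← ENNReal.rpow_add_of_nonneg _ _ h1q h2q]; simp

/-- The weighted `L²` estimate for the resolvent. -/
lemma IsControlFunction.lintegral_mul_resOp_sq_le [SigmaFinite μ] (hp : IsHeatKernel μ p) {q : ℝ}
    (hq : 1 ≤ q) {F₁ : X → ℝ} (hF : IsControlFunction p q F₁) {a : ℝ} (ha : 1 ≤ a) :
    ∃ C : ℝ≥0, ∀ w g : X → ℝ≥0∞, Measurable w → Measurable g →
      ∫⁻ x, w x ^ 2 * resOp μ p a g x ^ 2 ∂μ ≤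
        C * (∫⁻ x, w x ^ (2 * q) * ENNReal.ofReal (F₁ x) ∂μ) ^ (1 / q) * ∫⁻ y, g y ^ 2 ∂μ := by
  obtain ⟨hF₁m, hF₁, F₂, hF₂m, hF₂, hle, hfin⟩ := hF
  have hq0 : 0 < q := by linarith
  let ν : Measure ℝ := volume.restrict (Set.Ioi (0 : ℝ))
  let e : ℝ → ℝ≥0∞ := fun t => ENNReal.ofReal (Real.exp (-a * t))
  -- The weight balances the Cauchy-Schwarz inequality in time: the spatial estimate at time `t`
  -- contributes `F₂^{1/q} = φ²`, so both `∫ e φ` and `∫ e φ⁻¹ φ²` are the finite number `D`.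
  let φ : ℝ → ℝ≥0∞ := fun t => ENNReal.ofReal (F₂ t) ^ (1 / (2 * q))
  have hem : Measurable e := by fun_prop
  have hφm : AEMeasurable φ ν := by
    have h1 : AEMeasurable F₂ ν :=
      aemeasurable_restrict_of_measurable_subtype measurableSet_Ioi hF₂m
    exact h1.ennreal_ofReal.pow_const _
  set D := ∫⁻ t, e t * φ t ∂ν with hD
  have hDtop : D ≠ ∞ := by
    refine ne_top_of_le_ne_top hfin.ne (setLIntegral_mono' measurableSet_Ioi fun t ht => ?_)
    have ht0 : (0 : ℝ) < t := ht
    have hF0 := hF₂ t ht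
    rw [ENNReal.ofReal_mul (Real.exp_nonneg _),
      ← ENNReal.ofReal_rpow_of_nonneg hF0.le (by positivity)]
    simp only [e, φ]
    gcongr
    nlinarith
  have hφ0 : ∀ t, 0 < t → φ t ≠ 0 := fun t ht => by
    have : ENNReal.ofReal (F₂ t) ≠ 0 := by simpa using hF₂ t ht
    exact (ENNReal.rpow_pos (pos_iff_ne_zero.2 this) ENNReal.ofReal_ne_top).ne'
  have hφt : ∀ t, φ t ≠ ∞ := fun t =>
    ENNReal.rpow_ne_top_of_nonneg (by positivity) ENNReal.ofReal_ne_top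
  refine ⟨(D * D).toNNReal, fun w g hw hg => ?_⟩
  rw [ENNReal.coe_toNNReal (ENNReal.mul_ne_top hDtop hDtop)]
  set G := ∫⁻ y, g y ^ 2 ∂μ with hG
  set M := (∫⁻ x, w x ^ (2 * q) * ENNReal.ofReal (F₁ x) ∂μ) ^ (1 / q) with hM
  have hsq : ∀ b : ℝ≥0∞, (b ^ (1 / 2 : ℝ)) ^ 2 = b := fun b => by
    rw [← ENNReal.rpow_two, ← ENNReal.rpow_mul]; norm_num
  -- Cauchy-Schwarz in the time variable
  have hcs : ∀ x, resOp μ p a g x ^ 2 ≤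
      D * ∫⁻ t, e t * (φ t)⁻¹ * heatOp μ p t g x ^ 2 ∂ν := by
    intro x
    have hPm := hp.measurable_heatOp_time hg x
    have h1 := lintegral_mul_sq_le ν (f := fun t => (e t * φ t) ^ (1 / 2 : ℝ))
      (g := fun t => (e t * (φ t)⁻¹) ^ (1 / 2 : ℝ) * heatOp μ p t g x)
      ((hem.aemeasurable.mul hφm).pow_const _)
      (((hem.aemeasurable.mul hφm.inv).pow_const _).mul hPm.aemeasurable)
    simp only [mul_pow, hsq] at h1
    refine le_trans (le_of_eq ?_) h1
    congr 1
    refine setLIntegral_congr_fun measurableSet_Ioi fun t ht => ?_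
    rw [← mul_assoc, ← ENNReal.mul_rpow_of_nonneg _ _ (by norm_num)]
    have : e t * φ t * (e t * (φ t)⁻¹) = e t ^ 2 := by
      calc _ = e t ^ 2 * (φ t * (φ t)⁻¹) := by ring
        _ = _ := by rw [ENNReal.mul_inv_cancel (hφ0 t ht) (hφt t), mul_one]
    rw [this, ← ENNReal.rpow_two, ← ENNReal.rpow_mul, mul_one_div_cancel two_ne_zero,
      ENNReal.rpow_one]
  have hmeas : AEMeasurable (fun z : X × ℝ => w z.1 ^ 2 *
      (e z.2 * (φ z.2)⁻¹ * heatOp μ p z.2 g z.1 ^ 2)) (μ.prod ν) := by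
    have h1 : AEMeasurable (fun z : X × ℝ => φ z.2) (μ.prod ν) :=
      hφm.comp_quasiMeasurePreserving Measure.quasiMeasurePreserving_snd
    have h2 : Measurable (fun z : X × ℝ => heatOp μ p z.2 g z.1) :=
      (hp.measurable_heatOp_uncurry hg).comp measurable_swap
    exact ((hw.comp measurable_fst).pow_const 2).aemeasurable.mul
      ((((hem.comp measurable_snd).aemeasurable).mul h1.inv).mul (h2.pow_const 2).aemeasurable)
  calc _ ≤ ∫⁻ x, D * ∫⁻ t, w x ^ 2 * (e t * (φ t)⁻¹ * heatOp μ p t g x ^ 2) ∂ν ∂μ := by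
        refine lintegral_mono fun x => ?_
        have hm : AEMeasurable (fun t => e t * (φ t)⁻¹ * heatOp μ p t g x ^ 2) ν :=
          (hem.aemeasurable.mul hφm.inv).mul
            ((hp.measurable_heatOp_time hg x).pow_const 2).aemeasurable
        rw [lintegral_const_mul'' _ hm]
        calc _ ≤ w x ^ 2 * (D * ∫⁻ t, e t * (φ t)⁻¹ * heatOp μ p t g x ^ 2 ∂ν) := by
              gcongr; exact hcs x
          _ = _ := by ring
    _ = D * ∫⁻ t, ∫⁻ x, w x ^ 2 * (e t * (φ t)⁻¹ * heatOp μ p t g x ^ 2) ∂μ ∂ν := by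
        rw [lintegral_const_mul'' _ hmeas.lintegral_prod_right', lintegral_lintegral_swap hmeas]
    _ ≤ D * ∫⁻ t, e t * φ t * (M * G) ∂ν := by
        refine mul_le_mul' le_rfl (setLIntegral_mono' measurableSet_Ioi fun t ht => ?_)
        have h1 := hp.lintegral_mul_heatOp_sq_le hq hF₁m.ennreal_ofReal hw hg ht
          (c := ENNReal.ofReal (F₂ t)) (fun x => by
            rw [heatK_of_pos ht, ← ENNReal.ofReal_mul (hF₁ x).le, ← ENNReal.ofReal_coe_nnreal]
            exact ENNReal.ofReal_le_ofReal (hle t ht x))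
        have hφ2 : ENNReal.ofReal (F₂ t) ^ (1 / q) = φ t ^ 2 := by
          simp only [φ]
          rw [← ENNReal.rpow_two, ← ENNReal.rpow_mul]
          congr 1
          field_simp
        rw [hφ2] at h1
        calc _ = ∫⁻ x, (e t * (φ t)⁻¹) * (w x ^ 2 * heatOp μ p t g x ^ 2) ∂μ :=
              lintegral_congr fun x => by ring
          _ = (e t * (φ t)⁻¹) * ∫⁻ x, w x ^ 2 * heatOp μ p t g x ^ 2 ∂μ := by
              rw [lintegral_const_mul]
              exact (hw.pow_const 2).mul ((hp.measurable_heatOp hg t).pow_const 2)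
          _ ≤ (e t * (φ t)⁻¹) * (φ t ^ 2 * M * G) := by gcongr
          _ = e t * (φ t * (φ t)⁻¹) * φ t * (M * G) := by ring
          _ = _ := by rw [ENNReal.mul_inv_cancel (hφ0 t ht) (hφt t), mul_one]
    _ = D * (D * (M * G)) := by
        congr 1
        exact lintegral_mul_const'' _ (hem.aemeasurable.mul hφm)
    _ = _ := by ring

end KernelEstimates

/-! ### Compactness criteria in Hilbert space -/

section CompactnessCriteria

variable {H : Type*} [NormedAddCommGroup H] [InnerProductSpace ℂ H] [CompleteSpace H]

lemma isCompactOperator_of_approx {K : H →L[ℂ] H}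
    (h : ∀ ε : ℝ, 0 < ε → ∃ K' : H →L[ℂ] H, IsCompactOperator K' ∧ ∀ f, ‖K f - K' f‖ ≤ ε * ‖f‖) :
    IsCompactOperator K := by
  have hcl : IsClosed {f : H →L[ℂ] H | IsCompactOperator f} := isClosed_setOfPred_isCompactOperator
  refine hcl.closure_subset (Metric.mem_closure_iff.2 fun ε hε => ?_)
  obtain ⟨K', hK', hd⟩ := h (ε / 2) (by positivity)
  refine ⟨K', hK', ?_⟩
  rw [dist_eq_norm]
  have : ‖K - K'‖ ≤ ε / 2 := ContinuousLinearMap.opNorm_le_bound _ (by positivity) hd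
  linarith

/-- Hilbert-Schmidt operators are compact. -/
lemma isCompactOperator_of_sum_sq_le {T : H →L[ℂ] H} {C : ℝ}
    (h : ∀ (n : ℕ) (e : Fin n → H), Orthonormal ℂ e → ∑ i, ‖T (e i)‖ ^ 2 ≤ C) :
    IsCompactOperator T := by
  refine isCompactOperator_of_approx fun ε hε => ?_
  let S : Set ℝ := {s | ∃ (n : ℕ) (e : Fin n → H), Orthonormal ℂ e ∧ ∑ i, ‖T (e i)‖ ^ 2 = s}
  have hne : S.Nonempty := ⟨0, 0, Fin.elim0, ⟨fun i => i.elim0, fun i => i.elim0⟩, by simp⟩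
  have hbdd : BddAbove S := ⟨C, by rintro s ⟨n, e, he, rfl⟩; exact h n e he⟩
  -- A finite orthonormal family is taken whose sum is within `ε²` of the supremum. Adjoining a unit
  -- vector `g` orthogonal to it cannot exceed the supremum, so `‖T g‖ ≤ ε`; hence `T` is `ε`-close
  -- to a finite rank operator.
  obtain ⟨s, ⟨n, e, he, rfl⟩, hs⟩ := exists_lt_of_lt_csSup hne
    (show sSup S - ε ^ 2 < sSup S by linarith [pow_pos hε 2])
  let N : Submodule ℂ H := Submodule.span ℂ (Set.range e)
  have hN : FiniteDimensional ℂ N := FiniteDimensional.span_of_finite ℂ (Set.finite_range e)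
  have hproper : ProperSpace N := FiniteDimensional.proper ℂ N
  have hunit : ∀ g ∈ Nᗮ, ‖g‖ = 1 → ‖T g‖ ≤ ε := by
    intro g hg hg1
    have horth : ∀ i, inner ℂ (e i) g = 0 := fun i => hg _ (Submodule.subset_span ⟨i, rfl⟩)
    have hcons : Orthonormal ℂ (Fin.cons g e : Fin (n + 1) → H) := by
      refine ⟨fun i => ?_, fun i j => ?_⟩
      · refine Fin.cases ?_ (fun i => ?_) i
        · simpa using hg1
        · simpa using he.1 i
      · refine Fin.cases ?_ (fun i => ?_) i <;> refine Fin.cases ?_ (fun j => ?_) j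
        · intro hij; exact absurd rfl hij
        · intro _
          simp only [Fin.cons_zero, Fin.cons_succ]
          rw [← inner_conj_symm, horth, map_zero]
        · intro _
          simpa using horth i
        · intro hij
          simpa using he.2 (fun hh => hij (by rw [hh]))
    have h1 := le_csSup hbdd ⟨n + 1, _, hcons, rfl⟩
    rw [Fin.sum_univ_succ] at h1
    simp only [Fin.cons_zero, Fin.cons_succ] at h1
    exact (sq_le_sq₀ (norm_nonneg _) hε.le).1 (by linarith)
  have horth : ∀ g ∈ Nᗮ, ‖T g‖ ≤ ε * ‖g‖ := by
    intro g hg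
    rcases eq_or_ne g 0 with rfl | hg0
    · simp
    have hgn : 0 < ‖g‖ := norm_pos_iff.2 hg0
    have h1 := hunit (((‖g‖⁻¹ : ℝ) : ℂ) • g) (Nᗮ.smul_mem _ hg) (by
      rw [norm_smul, Complex.norm_real, norm_inv, norm_norm, inv_mul_cancel₀ hgn.ne'])
    rw [map_smul, norm_smul, Complex.norm_real, norm_inv, norm_norm, inv_mul_le_iff₀ hgn] at h1
    linarith
  refine ⟨(T.comp N.subtypeL).comp N.orthogonalProjectionOnto, ?_, fun f => ?_⟩
  · have h1 : IsCompactOperator (T.comp N.subtypeL) :=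
      isCompactOperator_of_locallyCompactSpace_rng _
    exact h1.comp_clm N.orthogonalProjectionOnto
  · have h2 : (T.comp N.subtypeL).comp N.orthogonalProjectionOnto f = T (N.starProjection f) := rfl
    rw [h2, ← map_sub]
    refine (horth _ (Submodule.sub_starProjection_mem_orthogonal f)).trans ?_
    gcongr
    have h3 : f - N.starProjection f = Nᗮ.starProjection f := by
      rw [Submodule.starProjection_orthogonal_val]
    rw [h3]
    exact Submodule.norm_starProjection_apply_le _ _

end CompactnessCriteria

/-- Vectors whose linear combinations are bounded by `r ‖c‖` have square sum at most `dim · r²`. -/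
lemma sum_sq_norm_le_of_forall {F : Type*} [NormedAddCommGroup F] [InnerProductSpace ℂ F]
    [FiniteDimensional ℂ F] {n : ℕ} {v : Fin n → F} {r : ℝ} (hr : 0 ≤ r)
    (h : ∀ c : Fin n → ℂ, ‖∑ i, c i • v i‖ ≤ r * √(∑ i, ‖c i‖ ^ 2)) :
    ∑ i, ‖v i‖ ^ 2 ≤ Module.finrank ℂ F * r ^ 2 := by
  let b := stdOrthonormalBasis ℂ F
  have h1 : ∀ i, ‖v i‖ ^ 2 = ∑ j, ‖(inner ℂ (b j) (v i) : ℂ)‖ ^ 2 := fun i =>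
    (b.sum_sq_norm_inner_right (v i)).symm
  simp only [h1]
  rw [Finset.sum_comm]
  have h2 : ∀ j, ∑ i, ‖(inner ℂ (b j) (v i) : ℂ)‖ ^ 2 ≤ r ^ 2 := by
    intro j
    set s := ∑ i, ‖(inner ℂ (b j) (v i) : ℂ)‖ ^ 2 with hs
    have hs0 : 0 ≤ s := Finset.sum_nonneg fun i _ => by positivity
    -- The coefficients conjugate to `⟨b j, v i⟩` are extremal: they give `s ≤ r √s`. Summation over
    -- `j` produces the dimension.
    have h3 := h fun i => starRingEnd ℂ (inner ℂ (b j) (v i))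
    simp only [RCLike.norm_conj] at h3
    rw [← hs] at h3
    have h4 : (inner ℂ (b j) (∑ i, (starRingEnd ℂ (inner ℂ (b j) (v i))) • v i) : ℂ) = (s : ℂ) := by
      rw [inner_sum, hs]
      push_cast
      refine Finset.sum_congr rfl fun i _ => ?_
      rw [inner_smul_right, RCLike.conj_mul]
      rfl
    have h5 : s ≤ r * √s := by
      calc s = ‖(s : ℂ)‖ := by rw [Complex.norm_real, Real.norm_of_nonneg hs0]
        _ ≤ ‖b j‖ * ‖∑ i, (starRingEnd ℂ (inner ℂ (b j) (v i))) • v i‖ := by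
            rw [← h4]; exact norm_inner_le_norm _ _
        _ ≤ r * √s := by rw [b.norm_eq_one, one_mul]; exact h3
    have h6 : √s ≤ r := by
      rcases (Real.sqrt_nonneg s).eq_or_lt with h0 | h0
      · rw [← h0]; exact hr
      · refine le_of_mul_le_mul_right ?_ h0
        rwa [Real.mul_self_sqrt hs0]
    calc s = √s ^ 2 := (Real.sq_sqrt hs0).symm
      _ ≤ r ^ 2 := by gcongr
  calc _ ≤ ∑ _j : Fin (Module.finrank ℂ F), r ^ 2 := Finset.sum_le_sum fun j _ => h2 j
    _ = _ := by simp

/-! ### Square integrable sections and multiplication operators -/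

section Sections

variable {X : Type u} [MeasurableSpace X] {d : ℕ} {E : X → Type v}
  [∀ x, NormedAddCommGroup (E x)] [∀ x, InnerProductSpace ℂ (E x)]
  [MeasurableSpace (TotalSpace (Fin d → ℂ) E)]

open Classical in
lemma IsMeasurableEndSection.indicator {W : ∀ x, E x →L[ℂ] E x}
    (hW : IsMeasurableEndSection d E W) {D : Set X} (hD : MeasurableSet D) :
    IsMeasurableEndSection d E (fun x => if x ∈ D then W x else 0) := by
  intro U hU φ i j
  have : (fun x : U => φ.fiberEquiv x ((if (x : X) ∈ D then W x else 0)
      ((φ.fiberEquiv x).symm (Pi.single j 1))) i) =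
      fun x : U => if (x : X) ∈ D then
        φ.fiberEquiv x (W x ((φ.fiberEquiv x).symm (Pi.single j 1))) i else 0 := by
    funext x
    split_ifs <;> simp
  rw [this]
  exact Measurable.ite (measurable_subtype_coe hD) (hW U hU φ i j) measurable_const

lemma isMeasurableEndSection_id :
    IsMeasurableEndSection d E (fun x => ContinuousLinearMap.id ℂ (E x)) := by
  intro U hU φ i j
  simp

variable [IsCountablyGeneratedBundle d E]

/-- In a chart, each coordinate of `W f` is a finite sum of matrix entries of `W` times coordinates
of `f`. -/
lemma IsMeasurableEndSection.apply {W : ∀ x, E x →L[ℂ] E x} (hW : IsMeasurableEndSection d E W)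
    {f : ∀ x, E x} (hf : IsMeasurableSection d E f) :
    IsMeasurableSection d E (fun x => W x (f x)) := by
  obtain ⟨U, hU, hc, hφ⟩ := IsCountablyGeneratedBundle.exists_cover (d := d) (E := E)
  refine isMeasurableSection_of_coord hU hc (fun n => (hφ n).some) fun n => ?_
  set φ := (hφ n).some
  rw [measurable_pi_iff]
  intro i
  have hcoord := φ.measurable_coord hf
  have : (fun x : U n => φ.fiberEquiv x (W x (f x)) i) = fun x : U n =>
      ∑ j, φ.fiberEquiv x (f x) j *
        φ.fiberEquiv x (W x ((φ.fiberEquiv x).symm (Pi.single j 1))) i := by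
    funext x
    have h1 : f x = ∑ j, φ.fiberEquiv x (f x) j • (φ.fiberEquiv x).symm (Pi.single j 1) := by
      apply (φ.fiberEquiv x).injective
      simp only [map_sum, map_smul, LinearEquiv.apply_symm_apply]
      exact pi_eq_sum_univ' _
    conv_lhs => rw [h1]
    simp [map_sum, Finset.sum_apply]
  rw [this]
  exact Finset.measurable_sum _ fun j _ =>
    ((measurable_pi_apply j).comp hcoord).mul (hW _ (hU n) φ i j)

variable (d E) in
lemma finrank_fiber (x : X) : Module.finrank ℂ (E x) = d := by
  obtain ⟨U, hU, hc, hφ⟩ := IsCountablyGeneratedBundle.exists_cover (d := d) (E := E)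
  have hx : x ∈ ⋃ n, U n := by rw [hc]; trivial
  obtain ⟨n, hxn⟩ := Set.mem_iUnion.1 hx
  rw [((hφ n).some.fiberEquiv ⟨x, hxn⟩).finrank_eq]
  simp

variable [IsMeasurableHermitian d E] {μ : Measure X}

namespace L2Sections

lemma enorm_sq (f : L2Sections d E μ) : ‖f‖ₑ ^ 2 = ∫⁻ x, ‖f x‖ₑ ^ 2 ∂μ := by
  have h := PreL2Sections.ofReal_norm_sq (rep f)
  rw [← h, ← SeparationQuotient.norm_mk, mk_rep, ENNReal.ofReal_pow (norm_nonneg _), ofReal_norm]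

lemma measurable_enorm (f : L2Sections d E μ) : Measurable (fun x => ‖f x‖ₑ) := by
  have : (fun x => ‖f x‖ₑ) = fun x => ENNReal.ofReal ‖f x‖ := by
    funext x; rw [ofReal_norm]
  rw [this]
  exact (rep f).2.1.norm.ennreal_ofReal

lemma coe_sub (f g : L2Sections d E μ) : ∀ᵐ x ∂μ, (f - g) x = f x - g x := by
  filter_upwards [coe_add f ((-1 : ℂ) • g), coe_smul (-1) g] with x h1 h2
  have : f - g = f + (-1 : ℂ) • g := by rw [neg_smul, one_smul, sub_eq_add_neg]
  rw [this, h1, h2, neg_smul, one_smul, sub_eq_add_neg]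

lemma coe_sum_smul {ι : Type*} (s : Finset ι) (c : ι → ℂ) (f : ι → L2Sections d E μ) :
    ∀ᵐ x ∂μ, (∑ i ∈ s, c i • f i) x = ∑ i ∈ s, c i • f i x := by
  classical
  induction s using Finset.induction_on with
  | empty =>
    filter_upwards [coe_zero (d := d) (E := E) (μ := μ)] with x hx
    simpa using hx
  | insert i s hi ih =>
    filter_upwards [ih, coe_add (c i • f i) (∑ i ∈ s, c i • f i), coe_smul (c i) (f i)]
      with x h1 h2 h3
    rw [Finset.sum_insert hi, Finset.sum_insert hi, h2, h1, h3]

/-- Square integrable measurable sections have classes. -/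
lemma exists_coe_eq {g : ∀ x, E x} (hg : IsMeasurableSection d E g)
    (hg2 : ∫⁻ x, ‖g x‖ₑ ^ 2 ∂μ < ∞) : ∃ f : L2Sections d E μ, ∀ᵐ x ∂μ, f x = g x := by
  have hmem : g ∈ sqIntegrableSections d E μ := by
    refine ⟨hg, hg.norm.aestronglyMeasurable, ?_⟩
    rw [eLpNorm_lt_top_iff_lintegral_rpow_enorm_lt_top (by simp) (by simp)]
    simpa using hg2
  exact ⟨SeparationQuotient.mk (⟨g, hmem⟩ : PreL2Sections d E μ), coe_mk _⟩

lemma enorm_le_of_lintegral_le {f : L2Sections d E μ} {c : ℝ≥0∞}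
    (h : ∫⁻ x, ‖f x‖ₑ ^ 2 ∂μ ≤ c ^ 2) : ‖f‖ₑ ≤ c := by
  rw [← enorm_sq] at h
  exact (ENNReal.pow_le_pow_left_iff two_ne_zero).1 h

lemma norm_le_of_lintegral_le {f g : L2Sections d E μ} {C : ℝ≥0}
    (h : ∫⁻ x, ‖f x‖ₑ ^ 2 ∂μ ≤ (C * ‖g‖ₑ) ^ 2) : ‖f‖ ≤ C * ‖g‖ := by
  have h1 := enorm_le_of_lintegral_le h
  have h2 : (C : ℝ≥0∞) * ‖g‖ₑ = ENNReal.ofReal (C * ‖g‖) := by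
    rw [ENNReal.ofReal_mul C.coe_nonneg, ENNReal.ofReal_coe_nnreal, ofReal_norm]
  rw [h2, ← ofReal_norm] at h1
  exact (ENNReal.ofReal_le_ofReal_iff (by positivity)).1 h1

/-- The composition of a bounded operator `T` with multiplication by `V`. -/
lemma exists_mul_comp {V : ∀ x, E x →L[ℂ] E x} (hV : IsMeasurableEndSection d E V)
    (T : L2Sections d E μ →L[ℂ] L2Sections d E μ) {C : ℝ≥0}
    (h : ∀ f : L2Sections d E μ, ∫⁻ x, ‖V x (T f x)‖ₑ ^ 2 ∂μ ≤ (C * ‖f‖ₑ) ^ 2) :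
    ∃ K : L2Sections d E μ →L[ℂ] L2Sections d E μ, (∀ f, ∀ᵐ x ∂μ, K f x = V x (T f x)) ∧
      ∀ f, ‖K f‖ ≤ C * ‖f‖ := by
  have hex : ∀ f : L2Sections d E μ, ∃ g : L2Sections d E μ, ∀ᵐ x ∂μ, g x = V x (T f x) := by
    intro f
    refine exists_coe_eq (hV.apply (rep (T f)).2.1) ((h f).trans_lt ?_)
    exact ENNReal.pow_lt_top (ENNReal.mul_lt_top ENNReal.coe_lt_top enorm_lt_top)
  choose k hk using hex
  have hbound : ∀ f, ‖k f‖ ≤ C * ‖f‖ := by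
    intro f
    refine norm_le_of_lintegral_le (le_of_eq_of_le (lintegral_congr_ae ?_) (h f))
    filter_upwards [hk f] with x hx
    rw [hx]
  refine ⟨LinearMap.mkContinuous
    { toFun := k
      map_add' := fun f g => ext_ae ?_
      map_smul' := fun c f => ext_ae ?_ } C hbound, hk, hbound⟩
  · filter_upwards [hk (f + g), hk f, hk g, coe_add (k f) (k g), coe_add (T f) (T g)]
      with x h1 h2 h3 h4 h5
    rw [h4, h1, h2, h3, map_add, h5, map_add]
  · filter_upwards [hk (c • f), hk f, coe_smul c (k f), coe_smul c (T f)] with x h1 h2 h3 h4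
    rw [RingHom.id_apply, h3, h1, h2, map_smul, h4, map_smul]

/-- Multiplication by an essentially bounded section of `End(E)`. -/
lemma exists_mul {V : ∀ x, E x →L[ℂ] E x} (hV : IsMeasurableEndSection d E V) {C : ℝ≥0}
    (h : ∀ᵐ x ∂μ, ‖V x‖ ≤ C) :
    ∃ K : L2Sections d E μ →L[ℂ] L2Sections d E μ, (∀ f, ∀ᵐ x ∂μ, K f x = V x (f x)) ∧
      ∀ f, ‖K f‖ ≤ C * ‖f‖ := by
  refine exists_mul_comp hV (ContinuousLinearMap.id ℂ _) fun f => ?_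
  rw [mul_pow, enorm_sq, ← lintegral_const_mul' _ _ (by simp)]
  refine lintegral_mono_ae ?_
  filter_upwards [h] with x hx
  rw [← mul_pow]
  gcongr
  have hC : ‖V x‖ₑ ≤ C := by
    rw [← ofReal_norm, ← ENNReal.ofReal_coe_nnreal]
    exact ENNReal.ofReal_le_ofReal hx
  exact ((V x).le_opENorm _).trans (mul_le_mul_left hC _)

/-- An operator with `|T f(x)| ≤ h(x) ‖f‖` for some `h ∈ L²` is compact. -/
theorem isCompactOperator_of_pointwise_bound {T : L2Sections d E μ →L[ℂ] L2Sections d E μ}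
    {h : X → ℝ≥0∞} (hm : AEMeasurable h μ) (hh : ∫⁻ x, h x ^ 2 ∂μ ≠ ∞)
    (hT : ∀ f : L2Sections d E μ, ∀ᵐ x ∂μ, ‖T f x‖ₑ ≤ h x * ‖f‖ₑ) : IsCompactOperator T := by
  refine isCompactOperator_of_sum_sq_le (C := (d * ∫⁻ x, h x ^ 2 ∂μ).toReal) fun n e he => ?_
  have hfin : ∀ᵐ x ∂μ, h x < ∞ := by
    filter_upwards [ae_lt_top' (hm.pow_const 2) hh] with x hx
    by_contra hcon
    rw [not_lt_top_iff.1 hcon] at hx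
    simp at hx
  have hpt : ∀ᵐ x ∂μ, ∑ i, ‖T (e i) x‖ₑ ^ 2 ≤ d * h x ^ 2 := by
    -- The null set in `hT` depends on the section. Countably many coefficient vectors share one
    -- null set, and off it density and continuity give the bound for all linear combinations;
    -- linear algebra in the fibre of dimension `d` then bounds the square sum.
    let c := TopologicalSpace.denseSeq (Fin n → ℂ)
    have h1 : ∀ᵐ x ∂μ, ∀ m, ‖T (∑ i, c m i • e i) x‖ₑ ≤ h x * ‖∑ i, c m i • e i‖ₑ :=
      ae_all_iff.2 fun m => hT _
    have h2 : ∀ᵐ x ∂μ, ∀ m, T (∑ i, c m i • e i) x = ∑ i, c m i • T (e i) x :=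
      ae_all_iff.2 fun m => by
        have := coe_sum_smul Finset.univ (c m) (fun i => T (e i))
        simpa only [map_sum, map_smul] using this
    filter_upwards [h1, h2, hfin] with x h1 h2 h3
    set r := (h x).toReal with hr
    have hhr : h x = ENNReal.ofReal r := (ENNReal.ofReal_toReal h3.ne).symm
    have hr0 : 0 ≤ r := ENNReal.toReal_nonneg
    have hnorm : ∀ c : Fin n → ℂ, ‖∑ i, c i • e i‖ = √(∑ i, ‖c i‖ ^ 2) := by
      intro c
      rw [norm_eq_sqrt_re_inner (𝕜 := ℂ), he.inner_sum c c Finset.univ, map_sum]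
      congr 1
      refine Finset.sum_congr rfl fun i _ => ?_
      rw [RCLike.conj_mul, ← RCLike.ofReal_pow, RCLike.ofReal_re]
    have hall : ∀ c : Fin n → ℂ, ‖∑ i, c i • T (e i) x‖ ≤ r * √(∑ i, ‖c i‖ ^ 2) := by
      have hclosed : IsClosed {c : Fin n → ℂ | ‖∑ i, c i • T (e i) x‖ ≤ r * √(∑ i, ‖c i‖ ^ 2)} :=
        isClosed_le (by fun_prop) (by fun_prop)
      intro c'
      refine hclosed.closure_subset_iff.2 ?_
        ((TopologicalSpace.denseRange_denseSeq (Fin n → ℂ)) c')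
      rintro _ ⟨m, rfl⟩
      have h4 := h1 m
      rw [h2 m, hhr, ← ofReal_norm, ← ofReal_norm, hnorm, ← ENNReal.ofReal_mul hr0] at h4
      exact (ENNReal.ofReal_le_ofReal_iff (by positivity)).1 h4
    have := finiteDimensional_fiber d E x
    have h5 := sum_sq_norm_le_of_forall hr0 hall
    rw [finrank_fiber d E x] at h5
    have h6 := ENNReal.ofReal_le_ofReal h5
    rw [ENNReal.ofReal_sum_of_nonneg (fun i _ => by positivity),
      ENNReal.ofReal_mul (by positivity), ENNReal.ofReal_natCast, ENNReal.ofReal_pow hr0,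
      ← hhr] at h6
    simpa only [ENNReal.ofReal_pow (norm_nonneg _), ofReal_norm] using h6
  have hsum : ∑ i, ‖T (e i)‖ₑ ^ 2 ≤ d * ∫⁻ x, h x ^ 2 ∂μ := by
    simp only [enorm_sq]
    rw [← lintegral_finsetSum _ fun i _ => (measurable_enorm (T (e i))).pow_const 2,
      ← lintegral_const_mul' _ _ (by simp)]
    exact lintegral_mono_ae hpt
  have htop : (d * ∫⁻ x, h x ^ 2 ∂μ) ≠ ∞ := ENNReal.mul_ne_top (by simp) hh
  have h7 := ENNReal.toReal_mono htop hsum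
  refine le_of_eq_of_le ?_ h7
  rw [ENNReal.toReal_sum (fun i _ => by simp)]
  refine Finset.sum_congr rfl fun i _ => ?_
  rw [ENNReal.toReal_pow, toReal_enorm]

lemma coe_abs (f : L2Sections d E μ) : ∀ᵐ x ∂μ, abs f x = (‖f x‖ : ℂ) :=
  MemLp.coeFn_toLp _

lemma norm_abs (f : L2Sections d E μ) : ‖abs f‖ = ‖f‖ := by
  have h1 : ‖abs f‖ₑ ^ 2 = ‖f‖ₑ ^ 2 := by
    rw [enorm_sq, Lp.enorm_def, eLpNorm_eq_lintegral_rpow_enorm_toReal (by simp) (by simp),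
      ← ENNReal.rpow_two, ← ENNReal.rpow_mul]
    norm_num
    refine lintegral_congr_ae ?_
    filter_upwards [coe_abs f] with x hx
    rw [hx]
    simp [enorm_eq_nnnorm]
  have h2 : ‖abs f‖ₑ = ‖f‖ₑ := le_antisymm
    ((ENNReal.pow_le_pow_left_iff two_ne_zero).1 h1.le)
    ((ENNReal.pow_le_pow_left_iff two_ne_zero).1 h1.ge)
  rw [← toReal_enorm, h2, toReal_enorm]

/-- The map is `1`-Lipschitz by the reverse triangle inequality. Continuity makes `|u| ≤ g` a closed
condition on pairs `(u, g)`. -/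
lemma continuous_abs : Continuous (abs : L2Sections d E μ → Lp ℂ 2 μ) := by
  refine (LipschitzWith.of_dist_le_mul (K := 1) fun f g => ?_).continuous
  rw [dist_eq_norm, dist_eq_norm, NNReal.coe_one, one_mul, ← norm_abs (f - g)]
  refine Lp.norm_le_norm_of_ae_le ?_
  filter_upwards [Lp.coeFn_sub (abs f) (abs g), coe_abs f, coe_abs g, coe_abs (f - g), coe_sub f g]
    with x h1 h2 h3 h4 h5
  rw [h1, Pi.sub_apply, h2, h3, h4, h5, ← Complex.ofReal_sub, Complex.norm_real, Complex.norm_real,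
    norm_norm]
  exact abs_norm_sub_norm_le _ _

lemma abs_le_iff {f : L2Sections d E μ} {g : Lp ℂ 2 μ} :
    abs f ≤ g ↔ ∀ᵐ x ∂μ, (‖f x‖ : ℂ) ≤ g x := by
  rw [← Lp.coeFn_le]
  constructor
  · intro h
    filter_upwards [h, coe_abs f] with x h1 h2
    rwa [← h2]
  · intro h
    filter_upwards [h, coe_abs f] with x h1 h2
    rwa [h2]

end L2Sections

end Sections

/-! ### The heat semigroup in `L²` and its resolvent kernel -/

section HeatSemigroup

lemma enorm_coe_smul (r : ℝ≥0) (c : ℂ) :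
    ‖(r : ℝ) • c‖ₑ = r * ‖c‖ₑ := by
  rw [enorm_smul]
  simp [enorm_eq_nnnorm]

variable {X : Type u} [MeasurableSpace X] {μ : Measure X} {p : ℝ → X → X → ℝ≥0} [SigmaFinite μ]

namespace IsHeatKernel

lemma coe_P (hp : IsHeatKernel μ p) {t : ℝ} (ht : 0 < t) (f : Lp ℂ 2 μ) :
    ∀ᵐ x ∂μ, hp.P t f x = ∫ y, (p t x y : ℝ) • f y ∂μ := by
  have h : hp.P t f = (hp.memLp ht f).toLp := by
    unfold P
    rw [dif_pos ht]
    rfl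
  rw [h]
  exact MemLp.coeFn_toLp _

lemma P_zero (hp : IsHeatKernel μ p) : hp.P 0 = ContinuousLinearMap.id ℂ _ := by
  unfold P
  rw [dif_neg (lt_irrefl _)]

lemma norm_P_le (hp : IsHeatKernel μ p) (t : ℝ) : ‖hp.P t‖ ≤ 1 := by
  unfold P
  split_ifs with ht
  · exact LinearMap.mkContinuous_norm_le _ zero_le_one _
  · exact ContinuousLinearMap.norm_id_le

/-- This is Chapman-Kolmogorov followed by Fubini. Joint integrability also comes from
Chapman-Kolmogorov: integrating the absolute value over `z` first gives `p(s + t, x, y) |f(y)|`. -/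
lemma integral_kernel_add (hp : IsHeatKernel μ p) {s t : ℝ} (hs : 0 < s) (ht : 0 < t) (x : X)
    (f : Lp ℂ 2 μ) : ∫ y, (p (s + t) x y : ℝ) • f y ∂μ =
      ∫ z, (p s x z : ℝ) • ∫ y, (p t z y : ℝ) • f y ∂μ ∂μ := by
  have hms : Measurable (fun z => p s x z) :=
    (hp.measurable_kernel hs).comp (measurable_const.prodMk measurable_id)
  have hmt := hp.measurable_kernel ht
  have hck : ∀ y, (p (s + t) x y : ℝ) = ∫ z, (p s x z : ℝ) * p t z y ∂μ := by
    intro y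
    have hm : Measurable (fun z => (p s x z : ℝ) * p t z y) :=
      hms.coe_nnreal_real.mul (hmt.comp (measurable_id.prodMk measurable_const)).coe_nnreal_real
    rw [integral_eq_lintegral_of_nonneg_ae (.of_forall fun z => by positivity)
      hm.aestronglyMeasurable]
    have h := congrArg ENNReal.toReal (hp.chapman_kolmogorov s t hs ht x y)
    rw [ENNReal.coe_toReal] at h
    rw [h]
    congr 1
    refine lintegral_congr fun z => ?_
    rw [ENNReal.ofReal_mul (by positivity), ENNReal.ofReal_coe_nnreal, ENNReal.ofReal_coe_nnreal]
  have hfin : Integrable (Function.uncurry fun y z => ((p s x z : ℝ) * p t z y) • f y)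
      (μ.prod μ) := by
    have hm : Measurable (Function.uncurry fun y z => ((p s x z : ℝ) * p t z y) • f y) :=
      ((hms.comp measurable_snd).coe_nnreal_real.mul
        (hmt.comp (measurable_snd.prodMk measurable_fst)).coe_nnreal_real).smul
        ((Lp.stronglyMeasurable f).measurable.comp measurable_fst)
    refine ⟨hm.aestronglyMeasurable, ?_⟩
    rw [hasFiniteIntegral_iff_enorm, lintegral_prod _ hm.enorm.aemeasurable]
    refine lt_of_eq_of_lt (lintegral_congr fun y => ?_)
      (hasFiniteIntegral_iff_enorm.1
        (hp.integrable_kernel_smul (add_pos hs ht) x (Lp.memLp f)).hasFiniteIntegral)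
    have e : ∀ z, ‖((p s x z : ℝ) * p t z y) • f y‖ₑ = (p s x z * p t z y : ℝ≥0∞) * ‖f y‖ₑ := by
      intro z
      rw [mul_smul, enorm_smul, enorm_coe_smul, mul_assoc]
      simp [enorm_eq_nnnorm]
    simp only [Function.uncurry_apply_pair, e]
    rw [enorm_coe_smul, hp.chapman_kolmogorov s t hs ht x y,
      lintegral_mul_const']
    exact enorm_ne_top
  calc _ = ∫ y, ∫ z, ((p s x z : ℝ) * p t z y) • f y ∂μ ∂μ := by
        refine integral_congr_ae (.of_forall fun y => ?_)
        simp only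
        rw [hck, integral_smul_const]
    _ = ∫ z, ∫ y, ((p s x z : ℝ) * p t z y) • f y ∂μ ∂μ := integral_integral_swap hfin
    _ = _ := by
        refine integral_congr_ae (.of_forall fun z => ?_)
        simp only [mul_smul]
        rw [integral_smul]

lemma P_add (hp : IsHeatKernel μ p) {s t : ℝ} (hs : 0 ≤ s) (ht : 0 ≤ t) :
    hp.P (s + t) = (hp.P s).comp (hp.P t) := by
  rcases hs.eq_or_lt with rfl | hs
  · rw [zero_add, hp.P_zero, ContinuousLinearMap.id_comp]
  rcases ht.eq_or_lt with rfl | ht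
  · rw [add_zero, hp.P_zero, ContinuousLinearMap.comp_id]
  ext f
  filter_upwards [hp.coe_P (add_pos hs ht) f, hp.coe_P hs (hp.P t f)] with x h1 h2
  rw [ContinuousLinearMap.comp_apply, h1, h2, hp.integral_kernel_add hs ht]
  refine integral_congr_ae ?_
  filter_upwards [hp.coe_P ht f] with z hz
  rw [hz]

lemma tendsto_P (hp : IsHeatKernel μ p) (f : Lp ℂ 2 μ) :
    Tendsto (fun t => hp.P t f) (𝓝[≥] 0) (𝓝 f) := by
  rw [← Set.Ioi_insert, nhdsWithin_insert, tendsto_sup]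
  refine ⟨?_, ?_⟩
  · rw [tendsto_pure_left]
    intro s hs
    rw [hp.P_zero]
    exact mem_of_mem_nhds hs
  · rw [tendsto_iff_norm_sub_tendsto_zero]
    have h := (ENNReal.tendsto_toReal ENNReal.zero_ne_top).comp (hp.tendsto f (Lp.memLp f))
    rw [ENNReal.toReal_zero] at h
    refine h.congr' ?_
    filter_upwards [self_mem_nhdsWithin] with t ht
    rw [Function.comp_apply, Lp.norm_def]
    congr 1
    refine eLpNorm_congr_ae ?_
    filter_upwards [hp.coe_P ht f, Lp.coeFn_sub (hp.P t f) f] with x h1 h2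
    rw [h2, Pi.sub_apply, h1]

/-- The semigroup law and contractivity carry strong continuity from time `0` to all times. -/
lemma norm_P_sub_le (hp : IsHeatKernel μ p) (f : Lp ℂ 2 μ) {s t : ℝ} (hs : 0 ≤ s) (ht : 0 ≤ t) :
    ‖hp.P t f - hp.P s f‖ ≤ ‖hp.P |t - s| f - f‖ := by
  wlog hst : s ≤ t generalizing s t
  · rw [norm_sub_rev, abs_sub_comm]
    exact this ht hs (le_of_not_ge hst)
  rw [abs_of_nonneg (sub_nonneg.2 hst)]
  have h : hp.P t f = hp.P s (hp.P (t - s) f) := by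
    have := hp.P_add hs (sub_nonneg.2 hst)
    rw [add_sub_cancel] at this
    rw [this]; rfl
  rw [h, ← map_sub]
  exact ((hp.P s).le_opNorm _).trans (mul_le_of_le_one_left (norm_nonneg _) (hp.norm_P_le s))

/-- The operators `P_t` form the semigroup of `H_p`. -/
theorem isSemigroupOf_P (hp : IsHeatKernel μ p) : IsSemigroupOf hp.generator hp.P where
  zero := hp.P_zero
  add _ _ hs ht := hp.P_add hs ht
  norm_le t _ := hp.norm_P_le t
  negGenerator_eq := rfl
  continuousOn f s hs := by
    rw [ContinuousWithinAt, tendsto_iff_norm_sub_tendsto_zero]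
    have h1 : Tendsto (fun t : ℝ => |t - s|) (𝓝[Set.Ici 0] s) (𝓝[≥] 0) := by
      refine tendsto_nhdsWithin_iff.2 ⟨?_, .of_forall fun t => Set.mem_Ici.2 (abs_nonneg _)⟩
      have : Tendsto (fun t : ℝ => |t - s|) (𝓝 s) (𝓝 |s - s|) :=
        ((continuous_id.sub continuous_const).abs).tendsto s
      rw [sub_self, abs_zero] at this
      exact this.mono_left nhdsWithin_le_nhds
    have h2 := tendsto_iff_norm_sub_tendsto_zero.1 ((hp.tendsto_P f).comp h1)
    refine squeeze_zero' (.of_forall fun t => norm_nonneg _) ?_ h2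
    filter_upwards [self_mem_nhdsWithin] with t ht
    exact hp.norm_P_sub_le f hs ht

lemma enorm_P_le (hp : IsHeatKernel μ p) {t : ℝ} (ht : 0 < t) (f : Lp ℂ 2 μ) :
    ∀ᵐ x ∂μ, ‖hp.P t f x‖ₑ ≤ heatOp μ p t (fun y => ‖f y‖ₑ) x := by
  filter_upwards [hp.coe_P ht f] with x hx
  rw [hx]
  refine (enorm_integral_le_lintegral_enorm _).trans (le_of_eq (lintegral_congr fun y => ?_))
  rw [enorm_coe_smul, heatK_of_pos ht]

/-- The Laplace transform is an `L²`-valued integral, so its values at points are not directly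
available. Pairing with `φ` gives scalar integrals, to which Tonelli's theorem applies. -/
lemma enorm_inner_laplace_P_le (hp : IsHeatKernel μ p) {a : ℝ} (ha : 0 < a) (φ g : Lp ℂ 2 μ) :
    ‖inner ℂ φ (laplace hp.P a g)‖ₑ ≤ ∫⁻ x, ‖φ x‖ₑ * resOp μ p a (fun y => ‖g y‖ₑ) x ∂μ := by
  have hgm : Measurable (fun y => ‖g y‖ₑ) := (Lp.stronglyMeasurable g).measurable.enorm
  have hφm : Measurable (fun y => ‖φ y‖ₑ) := (Lp.stronglyMeasurable φ).measurable.enorm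
  have h1 : inner ℂ φ (laplace hp.P a g) =
      ∫ t in Set.Ioi (0 : ℝ), inner ℂ φ (Real.exp (-a * t) • hp.P t g) :=
    (ContinuousLinearMap.integral_comp_comm (innerSL ℂ φ)
      (hp.isSemigroupOf_P.integrableOn ha g)).symm
  have h2 : ∀ t : ℝ, 0 < t → ‖inner ℂ φ (Real.exp (-a * t) • hp.P t g)‖ₑ ≤
      ∫⁻ x, ‖φ x‖ₑ * (ENNReal.ofReal (Real.exp (-a * t)) *
        heatOp μ p t (fun y => ‖g y‖ₑ) x) ∂μ := by
    intro t ht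
    rw [L2.inner_def]
    refine (enorm_integral_le_lintegral_enorm _).trans (lintegral_mono_ae ?_)
    filter_upwards [hp.enorm_P_le ht g, Lp.coeFn_smul (Real.exp (-a * t) : ℂ) (hp.P t g)]
      with x hx h3
    have e : (Real.exp (-a * t) • hp.P t g : Lp ℂ 2 μ) =
      (Real.exp (-a * t) : ℂ) • hp.P t g := (Complex.coe_smul _ _).symm
    rw [e, h3, Pi.smul_apply, inner_smul_right, enorm_mul, mul_left_comm]
    have e2 : ‖(Real.exp (-a * t) : ℂ)‖ₑ = ENNReal.ofReal (Real.exp (-a * t)) := by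
      rw [← ofReal_norm, Complex.norm_real, Real.norm_of_nonneg (Real.exp_nonneg _)]
    rw [e2]
    gcongr
    refine le_trans ?_ (mul_le_mul_right hx _)
    simp [mul_comm]
  calc _ ≤ ∫⁻ t in Set.Ioi (0 : ℝ), ‖inner ℂ φ (Real.exp (-a * t) • hp.P t g)‖ₑ := by
        rw [h1]; exact enorm_integral_le_lintegral_enorm _
    _ ≤ ∫⁻ t in Set.Ioi (0 : ℝ), ∫⁻ x, ‖φ x‖ₑ * (ENNReal.ofReal (Real.exp (-a * t)) *
        heatOp μ p t (fun y => ‖g y‖ₑ) x) ∂μ := setLIntegral_mono' measurableSet_Ioi h2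
    _ = ∫⁻ x, (∫⁻ t in Set.Ioi (0 : ℝ), ‖φ x‖ₑ * (ENNReal.ofReal (Real.exp (-a * t)) *
        heatOp μ p t (fun y => ‖g y‖ₑ) x)) ∂μ := by
        refine lintegral_lintegral_swap (Measurable.aemeasurable ?_)
        exact (hφm.comp measurable_snd).mul ((by fun_prop : Measurable fun z : ℝ × X =>
          ENNReal.ofReal (Real.exp (-a * z.1))).mul (hp.measurable_heatOp_uncurry hgm))
    _ = _ := by
        refine lintegral_congr fun x => ?_
        rw [lintegral_const_mul' _ _ enorm_ne_top]
        rfl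

/-- The Laplace transform of `P_t` is dominated by the resolvent kernel. -/
theorem enorm_laplace_P_le (hp : IsHeatKernel μ p) {a : ℝ} (ha : 0 < a) (g : Lp ℂ 2 μ) :
    ∀ᵐ x ∂μ, ‖laplace hp.P a g x‖ₑ ≤ resOp μ p a (fun y => ‖g y‖ₑ) x := by
  set L := laplace hp.P a g
  have hLm : Measurable (fun y => ‖L y‖ₑ) := (Lp.stronglyMeasurable L).measurable.enorm
  have hgm : Measurable (fun y => ‖g y‖ₑ) := (Lp.stronglyMeasurable g).measurable.enorm
  -- Testing with `φ = 1_B L` gives the integrated inequality over every such set `B`, hence the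
  -- pointwise one; a factor `|L|` cancels where it is nonzero.
  have key : (fun x => ‖L x‖ₑ ^ 2) ≤ᵐ[μ] fun x => ‖L x‖ₑ * resOp μ p a (fun y => ‖g y‖ₑ) x := by
    refine ae_le_of_forall_setLIntegral_le_of_sigmaFinite (hLm.pow_const 2) fun B hB _ => ?_
    let φ : Lp ℂ 2 μ := ((Lp.memLp L).indicator hB).toLp
    have hφ : ∀ᵐ x ∂μ, φ x = B.indicator L x := MemLp.coeFn_toLp _
    have h1 : inner ℂ φ L = inner ℂ φ φ := by
      rw [L2.inner_def, L2.inner_def]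
      refine integral_congr_ae ?_
      filter_upwards [hφ] with x hx
      rw [hx]
      by_cases hxB : x ∈ B <;> simp [hxB]
    have h2 : ‖(inner ℂ φ φ : ℂ)‖ₑ = ∫⁻ x in B, ‖L x‖ₑ ^ 2 ∂μ := by
      have h3 : ‖φ‖ₑ ^ 2 = ∫⁻ x, ‖φ x‖ₑ ^ 2 ∂μ := by
        rw [Lp.enorm_def, eLpNorm_eq_lintegral_rpow_enorm_toReal (by simp) (by simp),
          ← ENNReal.rpow_two, ← ENNReal.rpow_mul]
        norm_num
      rw [inner_self_eq_norm_sq_to_K, enorm_pow]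
      have h4 : ‖((‖φ‖ : ℝ) : ℂ)‖ₑ = ‖φ‖ₑ := by
        rw [← ofReal_norm, Complex.norm_real, norm_norm, ofReal_norm]
      refine (congrArg (· ^ 2) h4).trans ?_
      rw [h3, ← lintegral_indicator hB]
      refine lintegral_congr_ae ?_
      filter_upwards [hφ] with x hx
      rw [hx]
      by_cases hxB : x ∈ B <;> simp [hxB]
    have h5 := hp.enorm_inner_laplace_P_le ha φ g
    rw [h1, h2] at h5
    refine h5.trans (le_of_eq ?_)
    rw [← lintegral_indicator hB]
    refine lintegral_congr_ae ?_
    filter_upwards [hφ] with x hx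
    rw [hx]
    by_cases hxB : x ∈ B <;> simp [hxB]
  filter_upwards [key] with x hx
  rcases eq_or_ne ‖L x‖ₑ 0 with h0 | h0
  · rw [h0]; exact bot_le
  · rw [sq] at hx
    exact (ENNReal.mul_le_mul_iff_right h0 enorm_ne_top).1 hx

end IsHeatKernel

end HeatSemigroup

/-! ### Kato domination of resolvents -/

section Domination

/-- The two Laplace transforms form one integral of pairs, and a positively weighted integral of a
curve in a closed convex cone stays in the cone. The cone of interest is `|u| ≤ g`. -/
lemma laplace_pair_mem {H H' : Type*} [NormedAddCommGroup H] [InnerProductSpace ℂ H]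
    [CompleteSpace H] [NormedAddCommGroup H'] [InnerProductSpace ℂ H'] [CompleteSpace H']
    {T : H →ₗ.[ℂ] H} {T' : H' →ₗ.[ℂ] H'} {U : ℝ → H →L[ℂ] H} {V : ℝ → H' →L[ℂ] H'}
    (hU : IsSemigroupOf T U) (hV : IsSemigroupOf T' V) {C : Set (H × H')} (hclosed : IsClosed C)
    (hadd : ∀ x ∈ C, ∀ y ∈ C, x + y ∈ C)
    (hsmul : ∀ c : ℝ, 0 ≤ c → ∀ x ∈ C, (c : ℂ) • x ∈ C) {f : H} {g : H'}
    (h : ∀ t, 0 < t → (U t f, V t g) ∈ C) {a : ℝ} (ha : 0 < a) :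
    (laplace U a f, laplace V a g) ∈ C := by
  have hcone : ∀ c : ℝ, 0 ≤ c → ∀ x ∈ C, c • x ∈ C := by
    intro c hc x hx
    have := hsmul c hc x hx
    have e : (c : ℂ) • x = c • x := Prod.ext (Complex.coe_smul c x.1) (Complex.coe_smul c x.2)
    rwa [e] at this
  have hconv : Convex ℝ C := fun x hx y hy s t hs ht _ =>
    hadd _ (hcone s hs x hx) _ (hcone t ht y hy)
  have hi := hU.integrableOn ha f
  have hi' := hV.integrableOn ha g
  have e : (laplace U a f, laplace V a g) = ∫ t in Set.Ioi (0 : ℝ),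
      (Real.exp (-a * t) • U t f, Real.exp (-a * t) • V t g) :=
    (integral_pair hi hi').symm
  rw [e]
  exact integral_Ioi_mem_cone hconv hclosed hcone (hi.prodMk hi')
    fun t ht => hcone _ (Real.exp_nonneg _) _ (h t ht)

variable {X : Type u} [MeasurableSpace X] {d : ℕ} {E : X → Type v}
  [∀ x, NormedAddCommGroup (E x)] [∀ x, InnerProductSpace ℂ (E x)]
  [MeasurableSpace (TotalSpace (Fin d → ℂ) E)]
  [IsCountablyGeneratedBundle d E] [IsMeasurableHermitian d E] {μ : Measure X}

lemma L2Sections.abs_laplace_le {T : L2Sections d E μ →ₗ.[ℂ] L2Sections d E μ}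
    {S : Lp ℂ 2 μ →ₗ.[ℂ] Lp ℂ 2 μ} {U : ℝ → L2Sections d E μ →L[ℂ] L2Sections d E μ}
    {V : ℝ → Lp ℂ 2 μ →L[ℂ] Lp ℂ 2 μ} (hU : IsSemigroupOf T U) (hV : IsSemigroupOf S V)
    {f : L2Sections d E μ} (h : ∀ t : ℝ, 0 ≤ t → ∀ᵐ x ∂μ, (‖U t f x‖ : ℂ) ≤ V t f.abs x)
    {a : ℝ} (ha : 0 < a) : abs (laplace U a f) ≤ laplace V a f.abs := by
  refine laplace_pair_mem (C := {z | abs z.1 ≤ z.2}) hU hV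
    (isClosed_le (continuous_abs.comp continuous_fst) continuous_snd) ?_ ?_
    (fun t ht => abs_le_iff.2 (h t ht.le)) ha
  · rintro ⟨u, g⟩ h1 ⟨u', g'⟩ h2
    have h1 := abs_le_iff.1 h1
    have h2 := abs_le_iff.1 h2
    refine abs_le_iff.2 ?_
    filter_upwards [h1, h2, coe_add u u', Lp.coeFn_add g g'] with x h1 h2 h3 h4
    simp only [Prod.mk_add_mk]
    rw [h3, h4, Pi.add_apply]
    refine le_trans ?_ (add_le_add h1 h2)
    exact_mod_cast norm_add_le _ _
  · rintro c hc ⟨u, g⟩ h1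
    have h1 := abs_le_iff.1 h1
    refine abs_le_iff.2 ?_
    filter_upwards [h1, coe_smul (c : ℂ) u, Lp.coeFn_smul (c : ℂ) g] with x h1 h3 h4
    simp only [Prod.smul_mk]
    rw [h3, h4, Pi.smul_apply, norm_smul, Complex.norm_real, Real.norm_of_nonneg hc,
      Complex.ofReal_mul, smul_eq_mul]
    exact mul_le_mul_of_nonneg_left h1 (by exact_mod_cast hc)

lemma L2Sections.enorm_le_of_abs_le {f : L2Sections d E μ} {g : Lp ℂ 2 μ} (h : abs f ≤ g) :
    ∀ᵐ x ∂μ, ‖f x‖ₑ ≤ ‖g x‖ₑ := by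
  filter_upwards [abs_le_iff.1 h] with x hx
  rw [← ofReal_norm, ← ofReal_norm]
  refine ENNReal.ofReal_le_ofReal ?_
  refine le_trans ?_ (Complex.re_le_norm _)
  have := (Complex.le_def.1 hx).1
  rwa [Complex.ofReal_re] at this

/-- Kato domination bounds the resolvents by the resolvent kernels of `p`. -/
theorem KatoDominates.exists_isBoundedInverse [SigmaFinite μ] {p : ℝ → X → X → ℝ≥0}
    {hp : IsHeatKernel μ p} {T : L2Sections d E μ →ₗ.[ℂ] L2Sections d E μ}
    (hK : KatoDominates T hp.generator) (hT : IsSelfAdjoint T) (h0 : BoundedBelowBy T 0) {a : ℝ}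
    (ha : 0 < a) : ∃ R : L2Sections d E μ →L[ℂ] L2Sections d E μ,
      IsBoundedInverse (shift T a) R ∧
        (∀ f : L2Sections d E μ, ∀ᵐ x ∂μ, ‖R f x‖ₑ ≤ resOp μ p a (fun y => ‖f y‖ₑ) x) := by
  have key : ∀ f u : L2Sections d E μ, L2Sections.abs u ≤ laplace hp.P a f.abs →
      ∀ᵐ x ∂μ, ‖u x‖ₑ ≤ resOp μ p a (fun y => ‖f y‖ₑ) x := by
    intro f u h
    filter_upwards [L2Sections.enorm_le_of_abs_le h, hp.enorm_laplace_P_le ha f.abs] with x h1 h2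
    refine h1.trans (h2.trans (resOp_mono_ae ?_ x))
    filter_upwards [L2Sections.coe_abs f] with y hy
    rw [hy, ← ofReal_norm, Complex.norm_real, norm_norm, ofReal_norm]
  -- In both variants `|R f|` is dominated by the Laplace transform of `P_t |f|`. The scalar
  -- semigroup or resolvent supplied by the domination is replaced by that of `P_t` because the
  -- generator determines it.
  rcases hK with ⟨U, V, hU, hV, hUV⟩ | hK
  · obtain ⟨R, hR, -⟩ := exists_isBoundedInverse_of_nonneg hT h0 ha
    refine ⟨R, hR, fun f => key f _ ?_⟩
    rw [← hU.laplace_eq_of_isBoundedInverse ha hR, ← hV.laplace_eq hp.isSemigroupOf_P ha]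
    exact L2Sections.abs_laplace_le hU hV (fun t ht => hUV t ht f) ha
  · obtain ⟨R, Q, hR, hQ, hRQ⟩ := hK a ha
    refine ⟨R, hR, fun f => key f _ ?_⟩
    rw [hp.isSemigroupOf_P.laplace_eq_of_isBoundedInverse ha hQ]
    exact L2Sections.abs_le_iff.2 (hRQ f)

end Domination

/-! ### Approximation by powers of the resolvent -/

section Yosida

variable {H : Type*} [NormedAddCommGroup H] [InnerProductSpace ℂ H]

lemma IsBoundedInverse.eq {T : H →ₗ.[ℂ] H} {z : ℂ} {R S : H →L[ℂ] H}
    (hR : IsBoundedInverse (shift T z) R) (hS : IsBoundedInverse (shift T z) S) : R = S := by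
  ext f
  have h := hR.resolvent_identity hS f
  rwa [sub_self, zero_smul, add_zero] at h

/-- The powers of `b (T + b)⁻¹` approximate the identity on the range of the resolvent. -/
lemma IsBoundedInverse.norm_pow_apply_sub_le {T : H →ₗ.[ℂ] H} {a b : ℝ} (hb : 0 < b)
    {R S : H →L[ℂ] H} (hR : IsBoundedInverse (shift T (a : ℂ)) R)
    (hS : IsBoundedInverse (shift T (b : ℂ)) S) (hSn : ∀ f, ‖S f‖ ≤ b⁻¹ * ‖f‖) (k : ℕ) (f : H) :
    ‖(((b : ℂ) • S) ^ k) (R f) - R f‖ ≤ k * (b⁻¹ * ‖f - (a : ℂ) • R f‖) := by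
  induction k with
  | zero => simp
  | succ k ih =>
    have hJ : ∀ g, ‖((b : ℂ) • S) g‖ ≤ ‖g‖ := by
      intro g
      rw [smul_apply, norm_smul, Complex.norm_real, Real.norm_of_nonneg hb.le]
      calc _ ≤ b * (b⁻¹ * ‖g‖) := by gcongr; exact hSn g
        _ = ‖g‖ := by rw [← mul_assoc, mul_inv_cancel₀ hb.ne', one_mul]
    -- This is `(b S - 1) R = -S T R` with `T R = 1 - a R`. As `b S` is a contraction, each further
    -- power adds at most the same error.
    have h1 : ((b : ℂ) • S) (R f) - R f = -S (f - (a : ℂ) • R f) := by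
      have h := hR.resolvent_identity hS f
      rw [smul_apply, map_sub, map_smul]
      conv_lhs => rw [sub_eq_add_neg]; arg 2; rw [h]
      rw [sub_smul]
      abel
    have h2 : (((b : ℂ) • S) ^ (k + 1)) (R f) - R f =
        ((b : ℂ) • S) ((((b : ℂ) • S) ^ k) (R f) - R f) + (((b : ℂ) • S) (R f) - R f) := by
      rw [pow_succ', mul_apply_eq_comp, map_sub]
      abel
    rw [h2]
    calc _ ≤ ‖((b : ℂ) • S) ((((b : ℂ) • S) ^ k) (R f) - R f)‖ + ‖((b : ℂ) • S) (R f) - R f‖ :=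
          norm_add_le _ _
      _ ≤ k * (b⁻¹ * ‖f - (a : ℂ) • R f‖) + b⁻¹ * ‖f - (a : ℂ) • R f‖ := by
          gcongr
          · exact (hJ _).trans ih
          · rw [h1, norm_neg]; exact hSn _
      _ = _ := by push_cast; ring

end Yosida

/-! ### Compactness of multipliers composed with resolvents -/

section Compactness

variable {X : Type u} [MeasurableSpace X] {d : ℕ} {E : X → Type v}
  [∀ x, NormedAddCommGroup (E x)] [∀ x, InnerProductSpace ℂ (E x)]
  [MeasurableSpace (TotalSpace (Fin d → ℂ) E)]
  [IsCountablyGeneratedBundle d E] [IsMeasurableHermitian d E] {μ : Measure X}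
  {p : ℝ → X → X → ℝ≥0}

lemma enorm_pow_apply_le_resOp_iterate {a : ℝ} {R : L2Sections d E μ →L[ℂ] L2Sections d E μ}
    (hR : ∀ f : L2Sections d E μ, ∀ᵐ x ∂μ, ‖R f x‖ₑ ≤ resOp μ p a (fun y => ‖f y‖ₑ) x) (k : ℕ)
    (f : L2Sections d E μ) :
    ∀ᵐ x ∂μ, ‖(R ^ k) f x‖ₑ ≤ (resOp μ p a)^[k] (fun y => ‖f y‖ₑ) x := by
  induction k with
  | zero => exact .of_forall fun x => le_rfl
  | succ k ih =>
    filter_upwards [hR ((R ^ k) f)] with x hx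
    rw [pow_succ', mul_apply_eq_comp, Function.iterate_succ_apply']
    exact hx.trans (resOp_mono_ae ih x)

variable [SigmaFinite μ]

open Classical in
/-- The resolvent cut off to a set of finite `F₁ dμ`-measure is compact. -/
theorem isCompactOperator_indicator_comp {hp : IsHeatKernel μ p} {q : ℝ} (hq : 1 ≤ q)
    {F₁ : X → ℝ} (hF : IsControlFunction p q F₁)
    {T : L2Sections d E μ →ₗ.[ℂ] L2Sections d E μ} (hT : IsSelfAdjoint T)
    (h0 : BoundedBelowBy T 0) (hK : KatoDominates T hp.generator)
    {R : L2Sections d E μ →L[ℂ] L2Sections d E μ} (hR : IsBoundedInverse (shift T ((1 : ℝ) : ℂ)) R)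
    {D : Set X} (hD : MeasurableSet D) (hDF : weighted F₁ μ D < ∞)
    {χ : L2Sections d E μ →L[ℂ] L2Sections d E μ}
    (hχ : ∀ f : L2Sections d E μ, ∀ᵐ x ∂μ, χ f x = if x ∈ D then f x else 0)
    (hχn : ∀ f, ‖χ f‖ ≤ ‖f‖) : IsCompactOperator (χ.comp R) := by
  refine isCompactOperator_of_approx fun ε hε => ?_
  obtain ⟨k, hk⟩ := exists_nat_ge q
  set M : ℝ := ‖ContinuousLinearMap.id ℂ (L2Sections d E μ) - ((1 : ℝ) : ℂ) • R‖
  -- `b ≥ 1` is required by the kernel bound, and `b ≥ k M / ε` makes the error `k M / b` of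
  -- replacing `R` by `(b S')^k R` at most `ε`.
  set b : ℝ := max 1 (k * M / ε) with hb_def
  have hb1 : 1 ≤ b := le_max_left _ _
  have hb : 0 < b := by linarith
  obtain ⟨S, hS, hSp⟩ := hK.exists_isBoundedInverse hT h0 hb
  obtain ⟨S', hS', hSn⟩ := exists_isBoundedInverse_of_nonneg hT h0 hb
  obtain rfl := hS'.eq hS
  obtain ⟨C, hC⟩ := hF.resOp_iterate_le hp hq hk hb1
  -- The kernel bound gives the majorant `C F₁^{1/2}` on `D`, and it is square integrable because
  -- `∫_D F₁ dμ < ∞`.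
  have hcomp : IsCompactOperator (χ.comp (S' ^ k)) := by
    refine L2Sections.isCompactOperator_of_pointwise_bound
      (h := D.indicator fun x => C * ENNReal.ofReal (F₁ x) ^ (1 / 2 : ℝ)) ?_ ?_ fun f => ?_
    · exact (((hF.1.ennreal_ofReal).pow_const _).const_mul _ |>.indicator hD).aemeasurable
    · have e : ∀ x, D.indicator (fun x => C * ENNReal.ofReal (F₁ x) ^ (1 / 2 : ℝ)) x ^ 2 =
          D.indicator (fun x => (C : ℝ≥0∞) ^ 2 * ENNReal.ofReal (F₁ x)) x := by
        intro x
        by_cases hx : x ∈ D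
        · simp only [Set.indicator_of_mem hx]
          rw [mul_pow, ← ENNReal.rpow_two (_ ^ (1 / 2 : ℝ)), ← ENNReal.rpow_mul]
          norm_num
        · simp [hx]
      simp only [e]
      rw [lintegral_indicator hD, lintegral_const_mul' _ _ (by simp)]
      rw [weighted, withDensity_apply _ hD] at hDF
      exact ENNReal.mul_ne_top (by simp) hDF.ne
    · filter_upwards [hχ ((S' ^ k) f), enorm_pow_apply_le_resOp_iterate hSp k f] with x h1 h2
      rw [ContinuousLinearMap.comp_apply, h1]
      by_cases hx : x ∈ D
      · rw [if_pos hx, Set.indicator_of_mem hx]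
        refine h2.trans ((hC _ (L2Sections.measurable_enorm f) x).trans (le_of_eq ?_))
        rw [← L2Sections.enorm_sq, ← ENNReal.rpow_two, ← ENNReal.rpow_mul]
        norm_num
      · simp [hx]
  refine ⟨(χ.comp (((b : ℂ) • S') ^ k)).comp R, ?_, fun f => ?_⟩
  · have e : χ.comp (((b : ℂ) • S') ^ k) = ((b : ℂ) ^ k) • χ.comp (S' ^ k) := by
      rw [smul_pow, ContinuousLinearMap.comp_smul]
    have h1 : IsCompactOperator (χ.comp (((b : ℂ) • S') ^ k)) := by
      rw [e]
      exact hcomp.smul ((b : ℂ) ^ k)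
    exact h1.comp_clm R
  · have h1 := hR.norm_pow_apply_sub_le hb hS hSn k f
    have h2 : ‖f - ((1 : ℝ) : ℂ) • R f‖ ≤ M * ‖f‖ :=
      (ContinuousLinearMap.id ℂ (L2Sections d E μ) - ((1 : ℝ) : ℂ) • R).le_opNorm f
    simp only [ContinuousLinearMap.comp_apply]
    rw [← map_sub]
    refine (hχn _).trans ?_
    rw [norm_sub_rev]
    refine h1.trans ?_
    calc _ ≤ k * (b⁻¹ * (M * ‖f‖)) := by gcongr
      _ = (k * M / b) * ‖f‖ := by ring
      _ ≤ ε * ‖f‖ := by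
          gcongr
          rw [div_le_iff₀ hb]
          have := (div_le_iff₀ hε).1 (le_max_right 1 (k * M / ε))
          rw [← hb_def] at this
          linarith

open Classical in
/-- Bounded multiplication operators supported on a set of finite `F₁ dμ`-measure are relatively
compact. -/
theorem exists_isCompactOperator_indicator {hp : IsHeatKernel μ p} {q : ℝ} (hq : 1 ≤ q)
    {F₁ : X → ℝ} (hF : IsControlFunction p q F₁)
    {T : L2Sections d E μ →ₗ.[ℂ] L2Sections d E μ} (hT : IsSelfAdjoint T)
    (h0 : BoundedBelowBy T 0) (hK : KatoDominates T hp.generator)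
    {R : L2Sections d E μ →L[ℂ] L2Sections d E μ} (hR : IsBoundedInverse (shift T ((1 : ℝ) : ℂ)) R)
    {D : Set X} (hD : MeasurableSet D) (hDF : weighted F₁ μ D < ∞) {V : ∀ x, E x →L[ℂ] E x}
    (hV : IsMeasurableEndSection d E V) {C : ℝ≥0} (hVC : ∀ᵐ x ∂μ, x ∈ D → ‖V x‖ₑ ≤ C) :
    ∃ K : L2Sections d E μ →L[ℂ] L2Sections d E μ, IsCompactOperator K ∧
      ∀ f, ∀ᵐ x ∂μ, K f x = if x ∈ D then V x (R f x) else 0 := by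
  obtain ⟨χ, hχ, hχn⟩ := L2Sections.exists_mul (μ := μ) (C := 1)
    (isMeasurableEndSection_id.indicator hD : IsMeasurableEndSection d E _)
    (.of_forall fun x => by
      split_ifs
      · exact ContinuousLinearMap.norm_id_le
      · simp)
  obtain ⟨M, hM, -⟩ := L2Sections.exists_mul (μ := μ) (C := C) (hV.indicator hD) (by
    filter_upwards [hVC] with x hx
    split_ifs with h
    · have h1 := hx h
      rw [← ofReal_norm, ← ENNReal.ofReal_coe_nnreal] at h1
      exact (ENNReal.ofReal_le_ofReal_iff C.2).1 h1
    · simp)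
  have hχ' : ∀ f : L2Sections d E μ, ∀ᵐ x ∂μ, χ f x = if x ∈ D then f x else 0 := by
    intro f
    filter_upwards [hχ f] with x hx
    rw [hx]
    split_ifs <;> rfl
  have hc := isCompactOperator_indicator_comp hq hF hT h0 hK hR hD hDF hχ'
    (fun f => by simpa using hχn f)
  refine ⟨M.comp (χ.comp R), hc.clm_comp M, fun f => ?_⟩
  filter_upwards [hM (χ (R f)), hχ' (R f)] with x h1 h2
  simp only [ContinuousLinearMap.comp_apply]
  rw [h1, h2]
  split_ifs <;> rfl

/-- The operators `V (T + a)⁻¹` for `|V|` bounded by `w ∈ L^{2q}(F₁ dμ)`. -/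
lemma exists_mul_comp_resolvent (hp : IsHeatKernel μ p) {q : ℝ} (hq : 1 ≤ q) {F₁ : X → ℝ}
    (hF : IsControlFunction p q F₁) {a : ℝ} (ha : 1 ≤ a)
    {R : L2Sections d E μ →L[ℂ] L2Sections d E μ}
    (hR : ∀ f : L2Sections d E μ, ∀ᵐ x ∂μ, ‖R f x‖ₑ ≤ resOp μ p a (fun y => ‖f y‖ₑ) x) :
    ∃ C : ℝ≥0, ∀ (V : ∀ x, E x →L[ℂ] E x) (w : X → ℝ≥0∞), IsMeasurableEndSection d E V →
      Measurable w → (∀ᵐ x ∂μ, ‖V x‖ₑ ≤ w x) →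
      ∫⁻ x, w x ^ (2 * q) * ENNReal.ofReal (F₁ x) ∂μ ≠ ∞ →
      ∃ K : L2Sections d E μ →L[ℂ] L2Sections d E μ, (∀ f, ∀ᵐ x ∂μ, K f x = V x (R f x)) ∧
        ∀ f, ‖K f‖ ≤ ((C * (∫⁻ x, w x ^ (2 * q) * ENNReal.ofReal (F₁ x) ∂μ) ^ (1 / q)) ^
          (1 / 2 : ℝ)).toReal * ‖f‖ := by
  obtain ⟨C, hC⟩ := hF.lintegral_mul_resOp_sq_le hp hq ha
  refine ⟨C, fun V w hV hw hVw hI => ?_⟩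
  set B : ℝ≥0∞ := (C * (∫⁻ x, w x ^ (2 * q) * ENNReal.ofReal (F₁ x) ∂μ) ^ (1 / q)) ^ (1 / 2 : ℝ)
    with hB
  have hBt : B ≠ ∞ := ENNReal.rpow_ne_top_of_nonneg (by norm_num)
    (ENNReal.mul_ne_top (by simp) (ENNReal.rpow_ne_top_of_nonneg (by positivity) hI))
  refine L2Sections.exists_mul_comp (C := B.toNNReal) hV R fun f => ?_
  rw [ENNReal.coe_toNNReal hBt, mul_pow, L2Sections.enorm_sq f]
  have hB2 : B ^ 2 = C * (∫⁻ x, w x ^ (2 * q) * ENNReal.ofReal (F₁ x) ∂μ) ^ (1 / q) := by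
    rw [hB, ← ENNReal.rpow_two, ← ENNReal.rpow_mul]
    norm_num
  rw [hB2]
  refine le_trans (lintegral_mono_ae ?_) (hC w _ hw (L2Sections.measurable_enorm f))
  filter_upwards [hVw, hR f] with x h1 h2
  rw [← mul_pow]
  gcongr
  exact ((V x).le_opENorm _).trans (mul_le_mul' h1 h2)

open Classical in
/-- Multiplication operators with `|V| ∈ L^{2q}(F₁ dμ)` are relatively compact. -/
theorem exists_isCompactOperator_of_lintegral_ne_top {hp : IsHeatKernel μ p} {q : ℝ} (hq : 1 ≤ q)
    {F₁ : X → ℝ} (hF : IsControlFunction p q F₁)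
    {T : L2Sections d E μ →ₗ.[ℂ] L2Sections d E μ} (hT : IsSelfAdjoint T)
    (h0 : BoundedBelowBy T 0) (hK : KatoDominates T hp.generator)
    {R : L2Sections d E μ →L[ℂ] L2Sections d E μ} (hR : IsBoundedInverse (shift T ((1 : ℝ) : ℂ)) R)
    {V : ∀ x, E x →L[ℂ] E x} (hV : IsMeasurableEndSection d E V) {w : X → ℝ≥0∞}
    (hw : Measurable w) (hVw : ∀ᵐ x ∂μ, ‖V x‖ₑ ≤ w x)
    (hI : ∫⁻ x, w x ^ (2 * q) * ENNReal.ofReal (F₁ x) ∂μ ≠ ∞) :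
    ∃ K : L2Sections d E μ →L[ℂ] L2Sections d E μ, IsCompactOperator K ∧
      ∀ f, ∀ᵐ x ∂μ, K f x = V x (R f x) := by
  obtain ⟨R', hR', hRp⟩ := hK.exists_isBoundedInverse hT h0 one_pos
  obtain rfl := hR'.eq hR
  obtain ⟨C, hC⟩ := exists_mul_comp_resolvent hp hq hF le_rfl hRp
  obtain ⟨K, hKV, -⟩ := hC V w hV hw hVw hI
  refine ⟨K, isCompactOperator_of_approx fun ε hε => ?_, hKV⟩
  have hq0 : 0 < 2 * q := by linarith
  have hF₁m := hF.1.ennreal_ofReal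
  have hum : Measurable fun x => w x ^ (2 * q) * ENNReal.ofReal (F₁ x) :=
    (hw.pow_const _).mul hF₁m
  -- On `D n` the multiplier is bounded, and the lower bound for `w` makes the `F₁ dμ`-measure
  -- finite by Chebyshev. Off `D n` the weighted integral of `w^{2q}` tends to `0` by dominated
  -- convergence; since `C` does not depend on the multiplier, the remainder tends to `0` in norm.
  let D : ℕ → Set X := fun n => {x | ((n : ℝ≥0∞) + 1)⁻¹ ≤ w x ∧ w x ≤ (n : ℝ≥0∞) + 1}
  have hD : ∀ n, MeasurableSet (D n) := fun n =>
    (measurableSet_le measurable_const hw).inter (measurableSet_le hw measurable_const)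
  have hDF : ∀ n, weighted F₁ μ (D n) < ∞ := by
    intro n
    have hc : ((n : ℝ≥0∞) + 1)⁻¹ ^ (2 * q) ≠ 0 := by
      simp [ENNReal.rpow_eq_zero_iff, hq0, not_lt.2 hq0.le]
    have h1 : ((n : ℝ≥0∞) + 1)⁻¹ ^ (2 * q) * weighted F₁ μ (D n) ≤
        ∫⁻ x, w x ^ (2 * q) * ENNReal.ofReal (F₁ x) ∂μ := by
      rw [weighted, withDensity_apply _ (hD n), ← lintegral_const_mul _ hF₁m]
      refine (setLIntegral_mono hum fun x hx => ?_).trans (setLIntegral_le_lintegral _ _)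
      gcongr
      exact hx.1
    by_contra hcon
    rw [not_lt_top_iff.1 hcon, ENNReal.mul_top hc] at h1
    exact hI (top_le_iff.1 h1)
  have hle : ∀ n x, (Set.indicator (D n)ᶜ w x) ^ (2 * q) * ENNReal.ofReal (F₁ x) ≤
      w x ^ (2 * q) * ENNReal.ofReal (F₁ x) := fun n x =>
    mul_le_mul_left (ENNReal.rpow_le_rpow (Set.indicator_le_self _ _ _) hq0.le) _
  have hlim : Tendsto (fun n => ∫⁻ x, (Set.indicator (D n)ᶜ w x) ^ (2 * q) *
      ENNReal.ofReal (F₁ x) ∂μ) atTop (𝓝 0) := by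
    have h1 := tendsto_lintegral_of_dominated_convergence (μ := μ)
      (F := fun n x => (Set.indicator (D n)ᶜ w x) ^ (2 * q) * ENNReal.ofReal (F₁ x))
      (f := fun _ => 0) _ (fun n => ((hw.indicator (hD n).compl).pow_const _).mul hF₁m)
      (fun n => .of_forall (hle n)) hI ?_
    · simpa using h1
    · filter_upwards [ae_lt_top hum hI] with x hx
      have hwx : w x < ∞ := by
        by_contra hcon
        rw [not_lt_top_iff.1 hcon, ENNReal.top_rpow_of_pos hq0, ENNReal.top_mul] at hx
        · exact lt_irrefl _ hx
        · simpa using hF.2.1 x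
      rcases eq_or_ne (w x) 0 with hw0 | hw0
      · have : ∀ n, Set.indicator (D n)ᶜ w x = 0 := fun n => by
          exact le_antisymm ((Set.indicator_le_self _ _ x).trans hw0.le) bot_le
        simp [this, ENNReal.zero_rpow_of_pos hq0]
      · refine tendsto_const_nhds.congr' ?_
        obtain ⟨n₁, hn₁⟩ := ENNReal.exists_nat_gt hwx.ne
        obtain ⟨n₂, hn₂⟩ := ENNReal.exists_nat_gt (ENNReal.inv_ne_top.2 hw0)
        filter_upwards [eventually_ge_atTop n₁, eventually_ge_atTop n₂] with n h1 h2
        have hxD : x ∈ D n := by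
          refine ⟨?_, ?_⟩
          · rw [ENNReal.inv_le_iff_inv_le]
            refine hn₂.le.trans ?_
            exact_mod_cast h2.trans (Nat.le_succ n)
          · refine hn₁.le.trans ?_
            exact_mod_cast h1.trans (Nat.le_succ n)
        rw [Set.indicator_of_notMem (by simpa using hxD), ENNReal.zero_rpow_of_pos hq0, zero_mul]
  have hlim2 : Tendsto (fun n => ((C * (∫⁻ x, (Set.indicator (D n)ᶜ w x) ^ (2 * q) *
      ENNReal.ofReal (F₁ x) ∂μ) ^ (1 / q)) ^ (1 / 2 : ℝ)).toReal) atTop (𝓝 0) := by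
    have h1 := (ENNReal.continuous_rpow_const (y := 1 / q)).tendsto 0 |>.comp hlim
    rw [ENNReal.zero_rpow_of_pos (by positivity)] at h1
    have h2 := ENNReal.Tendsto.const_mul (a := (C : ℝ≥0∞)) h1 (Or.inr (by simp))
    rw [mul_zero] at h2
    have h3 := (ENNReal.continuous_rpow_const (y := 1 / 2)).tendsto 0 |>.comp h2
    rw [ENNReal.zero_rpow_of_pos (by norm_num)] at h3
    have h4 := (ENNReal.tendsto_toReal ENNReal.zero_ne_top).comp h3
    rwa [ENNReal.toReal_zero] at h4
  obtain ⟨n, hn⟩ := (hlim2.eventually (gt_mem_nhds hε)).exists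
  obtain ⟨K₁, hK₁, hK₁V⟩ := exists_isCompactOperator_indicator hq hF hT h0 hK hR (hD n) (hDF n) hV
    (C := (n : ℝ≥0) + 1) (by
      filter_upwards [hVw] with x hx hxD
      refine hx.trans ?_
      have := hxD.2
      push_cast
      exact this)
  obtain ⟨K₂, hK₂V, hK₂n⟩ := hC _ (Set.indicator (D n)ᶜ w) (hV.indicator (hD n).compl)
    (hw.indicator (hD n).compl) (by
      filter_upwards [hVw] with x hx
      by_cases hxD : x ∈ (D n)ᶜ
      · rwa [if_pos hxD, Set.indicator_of_mem hxD]
      · rw [if_neg hxD, ← ofReal_norm, norm_zero, ENNReal.ofReal_zero]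
        exact bot_le) (ne_top_of_le_ne_top hI (lintegral_mono (hle n)))
  refine ⟨K₁, hK₁, fun f => ?_⟩
  have e : K f - K₁ f = K₂ f := by
    refine L2Sections.ext_ae ?_
    filter_upwards [L2Sections.coe_sub (K f) (K₁ f), hKV f, hK₁V f, hK₂V f] with x h1 h2 h3 h4
    rw [h1, h2, h3, h4]
    by_cases hx : x ∈ D n <;> simp [hx]
  rw [e]
  exact (hK₂n f).trans (by gcongr)

open Classical in
/-- Bounded multiplication operators with `|V|` vanishing `F₁ dμ`-weakly at infinity are relatively
compact. -/
theorem exists_isCompactOperator_of_vanishing {hp : IsHeatKernel μ p} {q : ℝ} (hq : 1 ≤ q)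
    {F₁ : X → ℝ} (hF : IsControlFunction p q F₁)
    {T : L2Sections d E μ →ₗ.[ℂ] L2Sections d E μ} (hT : IsSelfAdjoint T)
    (h0 : BoundedBelowBy T 0) (hK : KatoDominates T hp.generator)
    {R : L2Sections d E μ →L[ℂ] L2Sections d E μ} (hR : IsBoundedInverse (shift T ((1 : ℝ) : ℂ)) R)
    {V : ∀ x, E x →L[ℂ] E x} (hV : IsMeasurableEndSection d E V) {w : X → ℝ≥0∞}
    (hw : Measurable w) (hVw : ∀ᵐ x ∂μ, ‖V x‖ₑ ≤ w x) {C : ℝ≥0} (hwC : ∀ᵐ x ∂μ, w x ≤ C)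
    (hv : ∀ c : ℝ≥0, 0 < c → weighted F₁ μ {x | (c : ℝ≥0∞) ≤ w x} < ∞) :
    ∃ K : L2Sections d E μ →L[ℂ] L2Sections d E μ, IsCompactOperator K ∧
      ∀ f, ∀ᵐ x ∂μ, K f x = V x (R f x) := by
  have hVn : ∀ (c : ℝ≥0) (x : X), ‖V x‖ₑ ≤ c → ‖V x‖ ≤ c := by
    intro c x h
    rw [← ofReal_norm, ← ENNReal.ofReal_coe_nnreal] at h
    exact (ENNReal.ofReal_le_ofReal_iff c.2).1 h
  have hVC : ∀ᵐ x ∂μ, ‖V x‖ₑ ≤ C := by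
    filter_upwards [hVw, hwC] with x h1 h2 using h1.trans h2
  obtain ⟨M, hM, -⟩ := L2Sections.exists_mul (μ := μ) (C := C) hV
    (hVC.mono fun x hx => hVn C x hx)
  refine ⟨M.comp R, isCompactOperator_of_approx fun ε hε => ?_, fun f => hM (R f)⟩
  -- Where `w < c` the remaining multiplier has norm at most `c`, and `c ‖R‖ ≤ ε`. Adding `1` avoids
  -- division by zero.
  let c : ℝ≥0 := ⟨ε / (‖R‖ + 1), by positivity⟩
  have hc : 0 < c := by
    refine NNReal.coe_pos.1 ?_
    show 0 < ε / (‖R‖ + 1)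
    positivity
  let D : Set X := {x | (c : ℝ≥0∞) ≤ w x}
  have hD : MeasurableSet D := measurableSet_le measurable_const hw
  obtain ⟨K₁, hK₁, hK₁V⟩ := exists_isCompactOperator_indicator hq hF hT h0 hK hR hD (hv c hc) hV
    (hVC.mono fun x hx _ => hx)
  obtain ⟨M₂, hM₂, hM₂n⟩ := L2Sections.exists_mul (μ := μ) (C := c) (hV.indicator hD.compl) (by
    filter_upwards [hVw] with x hx
    split_ifs with h
    · exact hVn c x (hx.trans (not_le.1 (Set.mem_compl_iff _ _ |>.1 h)).le)
    · simp)
  refine ⟨K₁, hK₁, fun f => ?_⟩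
  have e : M.comp R f - K₁ f = M₂ (R f) := by
    refine L2Sections.ext_ae ?_
    filter_upwards [L2Sections.coe_sub (M (R f)) (K₁ f), hM (R f), hK₁V f, hM₂ (R f)]
      with x h1 h2 h3 h4
    rw [ContinuousLinearMap.comp_apply, h1, h2, h3, h4]
    by_cases hx : x ∈ D <;> simp [hx]
  rw [e]
  refine (hM₂n _).trans ?_
  calc (c : ℝ) * ‖R f‖ ≤ c * (‖R‖ * ‖f‖) := by gcongr; exact R.le_opNorm f
    _ = (ε / (‖R‖ + 1)) * ‖R‖ * ‖f‖ := by rw [← mul_assoc]; rfl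
    _ ≤ ε * ‖f‖ := by
        gcongr
        rw [div_mul_eq_mul_div, div_le_iff₀ (by positivity)]
        nlinarith [norm_nonneg R]

end Compactness

/-! ### Relative compactness of multiplication by `W` and the conclusion -/

section Assembly

variable {X : Type u} [MeasurableSpace X] {d : ℕ} {E : X → Type v}
  [∀ x, NormedAddCommGroup (E x)] [∀ x, InnerProductSpace ℂ (E x)]
  [MeasurableSpace (TotalSpace (Fin d → ℂ) E)]
  [IsCountablyGeneratedBundle d E] [IsMeasurableHermitian d E] {μ : Measure X}

lemma L2Sections.inner_eq (f g : L2Sections d E μ) :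
    inner ℂ f g = ∫ x, inner ℂ (f x) (g x) ∂μ := by
  conv_lhs => rw [← mk_rep f, ← mk_rep g, SeparationQuotient.inner_mk_mk]
  rfl

lemma isSymmetricOp_mulOp {W : ∀ x, E x →L[ℂ] E x}
    (hW : ∀ x, (W x : E x →ₗ[ℂ] E x).IsSymmetric) : IsSymmetricOp (mulOp d μ W) := by
  intro u v u' v' h h'
  rw [mem_graph_mulOp] at h h'
  rw [L2Sections.inner_eq, L2Sections.inner_eq]
  refine integral_congr_ae ?_
  filter_upwards [h, h'] with x h1 h2
  rw [h1, h2]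
  exact hW x (u x) (u' x)

lemma ae_of_ae_weighted {F₁ : X → ℝ} (hm : Measurable F₁) (hF₁ : ∀ x, 0 < F₁ x) {P : X → Prop}
    (h : ∀ᵐ x ∂weighted F₁ μ, P x) : ∀ᵐ x ∂μ, P x := by
  rw [weighted, ae_withDensity_iff hm.ennreal_ofReal] at h
  filter_upwards [h] with x hx
  exact hx (by simpa using hF₁ x)

/-- The kernel estimates need a genuinely measurable majorant, while `h` is only almost everywhere
measurable. As `F₁ > 0`, agreement almost everywhere for `F₁ dμ` is agreement almost everywhere for
`μ`. -/
lemma exists_measurable_of_memLp_weighted {F₁ : X → ℝ} (hm : Measurable F₁)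
    (hF₁ : ∀ x, 0 < F₁ x) {r : ℝ} (hr : 0 < r) {h : X → ℝ}
    (hh : MemLp h (ENNReal.ofReal r) (weighted F₁ μ)) :
    ∃ w : X → ℝ≥0∞, Measurable w ∧ (∀ᵐ x ∂μ, w x = ‖h x‖ₑ) ∧
      ∫⁻ x, w x ^ r * ENNReal.ofReal (F₁ x) ∂μ ≠ ∞ := by
  have hmk := hh.1.ae_eq_mk
  have hwm : Measurable fun x => ‖hh.1.mk h x‖ₑ := hh.1.stronglyMeasurable_mk.measurable.enorm
  refine ⟨fun x => ‖hh.1.mk h x‖ₑ, hwm, ae_of_ae_weighted hm hF₁ ?_, ?_⟩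
  · filter_upwards [hmk] with x hx
    rw [hx]
  · have h1 := (eLpNorm_lt_top_iff_lintegral_rpow_enorm_lt_top
      (by simpa using hr) ENNReal.ofReal_ne_top).1 hh.2
    rw [ENNReal.toReal_ofReal hr.le] at h1
    have h2 : ∫⁻ x, ‖hh.1.mk h x‖ₑ ^ r ∂weighted F₁ μ < ∞ := by
      refine lt_of_eq_of_lt (lintegral_congr_ae ?_) h1
      filter_upwards [hmk] with x hx
      rw [hx]
    have h3 := lintegral_withDensity_eq_lintegral_mul μ hm.ennreal_ofReal (hwm.pow_const r)
    refine ne_of_eq_of_ne ((lintegral_congr fun x => ?_).trans h3.symm) h2.ne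
    rw [Pi.mul_apply, mul_comm]

lemma exists_measurable_of_memLp_top {F₁ : X → ℝ} {h : X → ℝ} (hh : MemLp h ∞ μ)
    (hv : VanishesWeakly h (weighted F₁ μ)) :
    ∃ (w : X → ℝ≥0∞) (C : ℝ≥0), Measurable w ∧ (∀ᵐ x ∂μ, w x = ‖h x‖ₑ) ∧ (∀ᵐ x ∂μ, w x ≤ C) ∧
      ∀ c : ℝ≥0, 0 < c → weighted F₁ μ {x | (c : ℝ≥0∞) ≤ w x} < ∞ := by
  have hmk := hh.1.ae_eq_mk
  have hwm : Measurable fun x => ‖hh.1.mk h x‖ₑ := hh.1.stronglyMeasurable_mk.measurable.enorm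
  refine ⟨fun x => ‖hh.1.mk h x‖ₑ, (eLpNorm h ∞ μ).toNNReal, hwm, ?_, ?_, fun c hc => ?_⟩
  · filter_upwards [hmk] with x hx
    rw [hx]
  · filter_upwards [hmk, enorm_ae_le_eLpNormEssSup h μ] with x hx h1
    rw [ENNReal.coe_toNNReal hh.2.ne]
    rwa [← hx]
  · refine lt_of_eq_of_lt (measure_congr ?_) (hv c (NNReal.coe_pos.2 hc))
    have hac : weighted F₁ μ ≪ μ := withDensity_absolutelyContinuous _ _
    filter_upwards [hac.ae_le hmk] with x hx
    refine propext ?_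
    show (c : ℝ≥0∞) ≤ ‖hh.1.mk h x‖ₑ ↔ (c : ℝ) ≤ |h x|
    rw [← hx, ← ofReal_norm, ← ENNReal.ofReal_coe_nnreal,
      ENNReal.ofReal_le_ofReal_iff (norm_nonneg _), Real.norm_eq_abs]

lemma weighted_eq_self {F : X → ℝ} (hF : ∀ x, F x = 1) : weighted F μ = μ := by
  have : (fun x => ENNReal.ofReal (F x)) = 1 := by
    funext x
    simp [hF x]
  rw [weighted, this, withDensity_one]

/-- The multiplication operator by `W = W₁ + W₂` is relatively compact. -/
theorem exists_isRelativelyCompact_mulOp [SigmaFinite μ] {p : ℝ → X → X → ℝ≥0}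
    {hp : IsHeatKernel μ p} {q : ℝ} (hq : 1 ≤ q) {F₁ : X → ℝ} (hF : IsControlFunction p q F₁)
    {T : L2Sections d E μ →ₗ.[ℂ] L2Sections d E μ} (hT : IsSelfAdjoint T)
    (h0 : BoundedBelowBy T 0) (hK : KatoDominates T hp.generator)
    {W W₁ W₂ : ∀ x, E x →L[ℂ] E x} (hW : ∀ x, W x = W₁ x + W₂ x)
    (hW₁ : IsMeasurableEndSection d E W₁) (hW₂ : IsMeasurableEndSection d E W₂)
    (h₁ : MemLp (fun x => ‖W₁ x‖) (ENNReal.ofReal (2 * q)) (weighted F₁ μ))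
    (h₂ : MemLp (fun x => ‖W₂ x‖) ∞ μ)
    (hv : VanishesWeakly (fun x => ‖W₂ x‖) (weighted F₁ μ)) :
    ∃ K : L2Sections d E μ →L[ℂ] L2Sections d E μ,
      IsRelativelyCompact T (mulOp d μ W) (-((1 : ℝ) : ℂ)) K := by
  obtain ⟨R, hR, -⟩ := exists_isBoundedInverse_of_nonneg hT h0 one_pos
  obtain ⟨w, hw, hwe, hwi⟩ :=
    exists_measurable_of_memLp_weighted hF.1 hF.2.1 (by linarith) h₁
  obtain ⟨w', C, hw', hwe', hwC, hwv⟩ := exists_measurable_of_memLp_top h₂ hv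
  obtain ⟨K₁, hK₁, hKV₁⟩ := exists_isCompactOperator_of_lintegral_ne_top hq hF hT h0 hK hR hW₁ hw
    (hwe.mono fun x hx => by rw [hx, enorm_norm]) hwi
  obtain ⟨K₂, hK₂, hKV₂⟩ := exists_isCompactOperator_of_vanishing hq hF hT h0 hK hR hW₂ hw'
    (hwe'.mono fun x hx => by rw [hx, enorm_norm]) hwC hwv
  refine ⟨K₁ + K₂, hK₁.add hK₂, fun u v huv => ?_⟩
  have hu := (isBoundedInverse_shift_iff.1 hR u v).1 huv
  rw [neg_smul, sub_neg_eq_add, mem_graph_mulOp, add_apply]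
  set f := v + ((1 : ℝ) : ℂ) • u
  filter_upwards [hKV₁ f, hKV₂ f, L2Sections.coe_add (K₁ f) (K₂ f)] with x h1 h2 h3
  rw [h3, h1, h2, hW, hu, add_apply]

end Assembly

end BundleSchrodinger

end

open BundleSchrodinger
theorem mainTheorem2 {X : Type*} [MeasurableSpace X] (μ : Measure X) [SigmaFinite μ]
    (p : ℝ → X → X → ℝ≥0) (hp : IsHeatKernel μ p)
    (q : ℝ) (hq : 1 ≤ q) (F₁ : X → ℝ) (hF₁ : IsControlFunction p q F₁)
    (d : ℕ) (E : X → Type*)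
    [∀ x, NormedAddCommGroup (E x)] [∀ x, InnerProductSpace ℂ (E x)]
    [MeasurableSpace (TotalSpace (Fin d → ℂ) E)]
    [IsMeasurableVectorBundle d E] [IsCountablyGeneratedBundle d E] [IsMeasurableHermitian d E]
    (H : L2Sections d E μ →ₗ.[ℂ] L2Sections d E μ)
    (hH : IsSelfAdjoint H) (hH_nonneg : BoundedBelowBy H 0)
    (hKato : KatoDominates H hp.generator)
    (W W₁ W₂ : ∀ x, E x →L[ℂ] E x) (hW : ∀ x, W x = W₁ x + W₂ x)
    (hW₁ : IsMeasurableEndSection d E W₁) (hW₂ : IsMeasurableEndSection d E W₂)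
    (hW₁_symm : ∀ x, (W₁ x : E x →ₗ[ℂ] E x).IsSymmetric)
    (hW₂_symm : ∀ x, (W₂ x : E x →ₗ[ℂ] E x).IsSymmetric)
    (hcond :
      (q = 1 ∧ MemLp (fun x => ‖W₁ x‖) 2 (weighted F₁ μ) ∧
        MemLp (fun x => ‖W₂ x‖) ∞ μ ∧ VanishesWeakly (fun x => ‖W₂ x‖) μ ∧
        VanishesWeakly (fun x => ‖W₂ x‖) (weighted F₁ μ)) ∨
      (1 < q ∧ (∀ x, F₁ x = 1) ∧ MemLp (fun x => ‖W₁ x‖) (ENNReal.ofReal (2 * q)) μ ∧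
        MemLp (fun x => ‖W₂ x‖) ∞ μ ∧ VanishesWeakly (fun x => ‖W₂ x‖) μ)) :
    (∀ a : ℝ, 0 < a → ∃ R K : L2Sections d E μ →L[ℂ] L2Sections d E μ,
      IsBoundedInverse (shift H a) R ∧ IsCompactOperator K ∧
      ∀ f, (R f, K f) ∈ (mulOp d μ W).graph) ∧
    (H + mulOp d μ W).domain = H.domain ∧
    IsSelfAdjoint (H + mulOp d μ W) ∧
    (∃ c : ℝ, BoundedBelowBy (H + mulOp d μ W) c) ∧
    essSpectrum (H + mulOp d μ W) = essSpectrum H := by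
  -- Both cases become one condition for the measure `F₁ dμ`: for `q = 1` the exponent `2q` is `2`,
  -- and for `F₁ = 1` the weighted measure is `μ`.
  obtain ⟨h₁, h₂, hv⟩ : MemLp (fun x => ‖W₁ x‖) (ENNReal.ofReal (2 * q)) (weighted F₁ μ) ∧
      MemLp (fun x => ‖W₂ x‖) ∞ μ ∧ VanishesWeakly (fun x => ‖W₂ x‖) (weighted F₁ μ) := by
    rcases hcond with ⟨rfl, h₁, h₂, -, hv⟩ | ⟨-, hF, h₁, h₂, hv⟩
    · exact ⟨by simpa using h₁, h₂, hv⟩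
    · rw [weighted_eq_self hF]
      exact ⟨h₁, h₂, hv⟩
  have hsymm : IsSymmetricOp (mulOp d μ W) := isSymmetricOp_mulOp fun x => by
    rw [hW x]
    exact (hW₁_symm x).add (hW₂_symm x)
  obtain ⟨K, hK⟩ := exists_isRelativelyCompact_mulOp hq hF₁ hH hH_nonneg hKato hW hW₁ hW₂ h₁ h₂ hv
  refine ⟨fun a ha => ?_, hK.domain_add, hK.isSelfAdjoint_add hH hsymm,
    hK.exists_boundedBelowBy hH hH_nonneg hsymm, hK.essSpectrum_add hH hsymm⟩
  obtain ⟨R, hR, -⟩ := exists_isBoundedInverse_of_nonneg hH hH_nonneg ha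
  -- `K` is `W (H + 1)⁻¹`; moving the base point from `-1` to `-a` gives the compact operator `W (H
  -- + a)⁻¹`.
  have hKa := hK.change_point (w' := -(a : ℂ)) (G := R) (by rwa [neg_neg])
  refine ⟨R, _, hR, hKa.1, fun f => ?_⟩
  have h := hKa.2 _ _ (hR.mem_graph f)
  have e : f - (a : ℂ) • R f - -(a : ℂ) • R f = f := by rw [neg_smul]; abel
  rwa [e] at h
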